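/- Setting. Let $T\ge 0$, let $(\Omega,\mathcal F,\mathbb P)$ be a complete probability space with a filtration $(\mathcal F_t)_{0\le t\le T}$ satisfying the usual conditions (right-continuous, and $\mathcal F_0$ contains all subsets of $\mathbb P$-null sets), let $H$ be a separable real Hilbert space, let $U$ be a Lusin space, in the sense that it is homeomorphic to a Borel subset of the real line, and let $\mathcal A$ be a ring of Borel subsets of $U$. For square integrable $H$-valued martingales $Y,Z$ on $[0,T]$, $\langle Y,Z\rangle$ denotes the predictable quadratic covariation: the (unique up to indistinguishability) predictable real-valued process with right-continuous paths of finite variation, null at $0$, such that $(Y,Z)_H-\langle Y,Z\rangle$ is a martingale; $\langle Y\rangle=\langle Y,Y\rangle$. A family $N=(N(A))_{A\in\mathcal A}$ of $H$-valued random variables is a $\sigma$-finite $L^2(\Omega,\mathcal F,\mathbb P;H)$-valued measure if $\mathbb E\|N(A)\|^2<\infty$ for all $A\in\mathcal A$; $N(A\cup B)=N(A)+N(B)$ a.s. for disjoint $A,B\in\mathcal A$; and there are Borel sets $U_n\uparrow U$ such that every Borel subset of every $U_n$ belongs to $\mathcal A$, $\sup\{\mathbb E\|N(B)\|^2 : B\subseteq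 U_n \text{ Borel}\}<\infty$ for every $n$, $\mathbb E\|N(B_j)\|^2\to0$ whenever $B_j\subseteq U_n$ are Borel sets decreasing to $\emptyset$, and $N(A\cap U_n)\to N(A)$ in $L^2$ for every $A\in\mathcal A$. Let $M=(M_t(A): 0\le t\le T,\ A\in\mathcal A)$ be an orthogonal $H$-valued martingale-valued measure, i.e. for all $A\in\mathcal A$, $M_0(A)=0$ a.s. and $M(A)=(M_t(A))_{0\le t\le T}$ is a mean-zero square integrable $H$-valued martingale; for every $t\in(0,T]$, $M_t(\cdot)$ is a $\sigma$-finite $L^2(\Omega,\mathcal F,\mathbb P;H)$-valued measure; and $\langle M(A),M(B)\rangle_t=0$ a.s. for all $t\in(0,T]$ and all disjoint $A,B\in\mathcal A$. Theorem. There exists a family $(\nu_t)_{0\le t\le T}$ of random $\sigma$-finite measures on $(U,\mathcal B(U))$ such that: (i) $(\nu_t)_{0\le t\le T}$ is predictable, i.e. for every $B\in\mathcal B(U)$ the map $(t,\omega)\mapsto\nu_t(\omega)(B)$ is measurable with respect to the predictable $\sigma$-algebra on $[0,T]\times\Omega$; (ii) for every $A\in\mathcal A$, $t\mapsto\nu_t(A)$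 is increasing, and almost surely it is right-continuous; (iii) for every $A\in\mathcal A$ the predictable quadratic variation $\langle M(A)\rangle$ exists, and for every $0\le t\le T$, $\mathbb P\big(\nu_t(A)=\langle M(A)\rangle_t\big)=1$. -/

import Mathlib

open MeasureTheory ProbabilityTheory Filter Topology Set
open scoped NNReal ENNReal

/-- A topological space is Lusin (in the sense used here) if it is homeomorphic to a Borel subset
of the real line; in particular it is Hausdorff. -/
def IsLusin (U : Type*) [TopologicalSpace U] : Prop :=
  ∃ S : Set ℝ, MeasurableSet S ∧ Nonempty (U ≃ₜ S)

/-- The usual conditions: the filtration is right continuous, and the σ-algebra at the initial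
time contains every subset of a null set (`P` is an outer measure on all sets), so that in
particular `(Ω, m, P)` is complete. -/
structure UsualConditions {Ω ι : Type*} {m : MeasurableSpace Ω} [PartialOrder ι] [OrderBot ι]
    (𝓕 : Filtration ι m) (P : Measure Ω) : Prop where
  rightCont : 𝓕.IsRightContinuous
  null_mem : ∀ s : Set Ω, P s = 0 → MeasurableSet[𝓕 ⊥] s

section QuadraticVariation

variable {Ω ι H : Type*} {m : MeasurableSpace Ω}
  [LinearOrder ι] [OrderBot ι] [TopologicalSpace ι]
  [NormedAddCommGroup H] [InnerProductSpace ℝ H] [CompleteSpace H]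

/-- A mean-zero, square integrable `H`-valued martingale. -/
structure IsSqIntegrableMartingale (𝓕 : Filtration ι m) (P : Measure Ω) (Y : ι → Ω → H) :
    Prop where
  martingale : Martingale Y 𝓕 P
  memLp : ∀ t, MemLp (Y t) 2 P
  mean_zero : ∀ t, ∫ ω, Y t ω ∂P = 0

/-- `V` is (a version of) the predictable quadratic covariation `⟨Y, Z⟩`: a predictable real-valued
process, null at the initial time, whose paths are a.s. right-continuous and of finite variation on
compact intervals, and such that `(Y, Z)_H - V` is a martingale. -/
structure IsPredictableCovariation (𝓕 : Filtration ι m) (P : Measure Ω) (Y Z : ι → Ω → H)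
    (V : ι → Ω → ℝ) : Prop where
  predictable : IsStronglyPredictable 𝓕 V
  initial : ∀ᵐ ω ∂P, V ⊥ ω = 0
  rightCont : ∀ᵐ ω ∂P, ∀ t, ContinuousWithinAt (fun s => V s ω) (Ici t) t
  finiteVariation : ∀ᵐ ω ∂P, LocallyBoundedVariationOn (fun s => V s ω) univ
  martingale : Martingale (fun t ω => inner ℝ (Y t ω) (Z t ω) - V t ω) 𝓕 P

/-- `V` is (a version of) the predictable quadratic variation `⟨Y⟩ = ⟨Y, Y⟩`. -/
def IsPredictableQuadraticVariation (𝓕 : Filtration ι m) (P : Measure Ω) (Y : ι → Ω → H)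
    (V : ι → Ω → ℝ) : Prop :=
  IsPredictableCovariation 𝓕 P Y Y V

end QuadraticVariation

section MartingaleMeasure

variable {Ω ι U H : Type*} {m : MeasurableSpace Ω}
  [MeasurableSpace U]
  [NormedAddCommGroup H] [InnerProductSpace ℝ H] [CompleteSpace H]

/-- A σ-finite `L²(Ω, P; H)`-valued measure on the ring `𝒜` of Borel subsets of `U`. The values of
`N` at sets outside `𝒜` are irrelevant. -/
structure IsSigmaFiniteL2Measure (P : Measure Ω) (𝒜 : Set (Set U)) (N : Set U → Ω → H) :
    Prop where
  memLp : ∀ A ∈ 𝒜, MemLp (N A) 2 P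
  additive : ∀ A ∈ 𝒜, ∀ B ∈ 𝒜, Disjoint A B → ∀ᵐ ω ∂P, N (A ∪ B) ω = N A ω + N B ω
  sigmaFinite : ∃ Un : ℕ → Set U,
    (∀ n, MeasurableSet (Un n)) ∧ Monotone Un ∧ ⋃ n, Un n = univ ∧
    (∀ n B, MeasurableSet B → B ⊆ Un n → B ∈ 𝒜) ∧
    -- the second moments are bounded on each `Un n`
    (∀ n, ∃ C : ℝ, ∀ B, MeasurableSet B → B ⊆ Un n → ∫ ω, ‖N B ω‖ ^ 2 ∂P ≤ C) ∧
    -- countable additivity on each `Un n`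
    (∀ n, ∀ B : ℕ → Set U, (∀ j, MeasurableSet (B j)) → (∀ j, B j ⊆ Un n) → Antitone B →
      ⋂ j, B j = ∅ → Tendsto (fun j => ∫ ω, ‖N (B j) ω‖ ^ 2 ∂P) atTop (𝓝 0)) ∧
    -- `N A` is the `L²`-limit of `N (A ∩ Un n)`
    (∀ A ∈ 𝒜, Tendsto (fun n => ∫ ω, ‖N A ω - N (A ∩ Un n) ω‖ ^ 2 ∂P) atTop (𝓝 0))

/-- An `H`-valued orthogonal martingale-valued measure `(M(t, A) : t ∈ ι, A ∈ 𝒜)`, where the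
index set `ι` is an interval of times with smallest element `⊥` (time `0`). -/
structure IsOrthogonalMartingaleMeasure [LinearOrder ι] [OrderBot ι] [TopologicalSpace ι]
    (𝓕 : Filtration ι m) (P : Measure Ω) (𝒜 : Set (Set U)) (M : ι → Set U → Ω → H) : Prop where
  initial : ∀ A ∈ 𝒜, ∀ᵐ ω ∂P, M ⊥ A ω = 0
  martingale : ∀ A ∈ 𝒜, IsSqIntegrableMartingale 𝓕 P (fun t => M t A)
  l2Measure : ∀ t, ⊥ < t → IsSigmaFiniteL2Measure P 𝒜 (M t)
  -- `⟨M(A), M(B)⟩_t = 0` a.s. for every `t > 0`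
  orthogonal : ∀ A ∈ 𝒜, ∀ B ∈ 𝒜, Disjoint A B →
    ∃ V : ι → Ω → ℝ, IsPredictableCovariation 𝓕 P (fun t => M t A) (fun t => M t B) V ∧
      ∀ t, ⊥ < t → ∀ᵐ ω ∂P, V t ω = 0

/-- A family of random σ-finite measures on `U`. -/
structure IsRandomSigmaFiniteFamily {Ω ι U : Type*} [MeasurableSpace Ω] [MeasurableSpace U]
    (ν : ι → Ω → Measure U) : Prop where
  measurable : ∀ t, ∀ B, MeasurableSet B → Measurable fun ω => ν t ω B
  sigmaFinite : ∀ t ω, SigmaFinite (ν t ω)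

/-- The family `(ν_t)` of random measures is predictable: `(t, ω) ↦ ν_t(ω)(B)` is measurable with
respect to the predictable σ-algebra, for every measurable `B`. -/
def IsPredictableFamily [LinearOrder ι] [OrderBot ι] (𝓕 : Filtration ι m)
    (ν : ι → Ω → Measure U) : Prop :=
  ∀ B, MeasurableSet B → IsStronglyPredictable 𝓕 fun t ω => ν t ω B

end MartingaleMeasure

/-! For each `A` in the ring, `‖M_t(A)‖²` is a submartingale, and its predictable compensator `V(A)`
is a version of `⟨M(A)⟩`. Orthogonality makes `A ↦ V(A)` additive up to null sets. The intensity `ν`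
is a regularization of this almost surely additive set function into genuine measures, in the way a
regular conditional distribution is built from a distribution function on the rationals.

Uniqueness of compensators comes from `predictable_martingale_eq_zero`: a predictable martingale `D`
of finite variation, null at the initial time, vanishes. Write `D = a - b` with `a`, `b` predictable
and increasing. After localization their Doléans measures agree on the predictable σ-algebra
(`exists_localizing_set`), so predictable integrands, in particular `a`, `b` and their left limits,
have the same expected integral against `da` and `db`. Integration by parts then turns `E[x² + y²]`
into `E[2xy]` for the total masses `x`, `y` of the path measures restricted to `{v < K}`, where `v =
a + b` is the variation and `K` a level, so `x = y` almost surely.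

Existence is a Doob–Meyer decomposition proved from scratch. For a bounded submartingale the
discrete compensators along dyadic partitions are bounded in L² (`integral_sq_gridCompensator_le`),
so convex combinations of them converge in L² at the terminal time, hence almost surely at all grid
points, to an increasing right-continuous `V`. To see that `V` is predictable one shows that it is
the upper limit of the predictable approximations at all times. Off the jumps of `V` this is
monotonicity. At the jumps it follows from an energy inequality
(`lintegral_doleans_gridCompensator_le`) and Fatou's lemma for the Doléans measure of `V`, since a
jump is an atom of the path measure. No path regularity of `M` is assumed: the only regularity of
`‖Y_t‖²` that enters is right-continuity of its mean, which the usual conditions give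
(`tendsto_integral_sq_norm`). Unbounded martingales are reached by truncating the terminal value. A
Kunita–Watanabe type estimate (`ae_forall_abs_sub_le`) makes the compensators converge uniformly in
time.

For the measures, `E V_T(A) ≤ E‖M_T(A)‖²` transfers the continuity of the L²-valued measure `M_T` to
`V`. Carrying `U` into the real line by a measurable embedding, one uses the values of `V` on
rational half-lines as a distribution function on each piece of the exhausting sequence, and sums
the pieces. Because increments in space of this function increase in time, monotonicity of `ν_t`
holds for every path. -/

set_option linter.unusedSectionVars false

/-! ### Dyadic partitions of the time interval -/

/-- A refining sequence of finite partitions of an order interval whose points are dense. -/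
structure RefiningGrid (ι : Type*) [LinearOrder ι] [OrderBot ι] [OrderTop ι] where
  pt : ℕ → ℕ → ι
  strict : ∀ n i j, i < j → j ≤ 2 ^ n → pt n i < pt n j
  zero : ∀ n, pt n 0 = ⊥
  last : ∀ n, pt n (2 ^ n) = ⊤
  refine : ∀ n i, pt (n + 1) (2 * i) = pt n i
  dense : ∀ s t, s < t → ∃ n i, i ≤ 2 ^ n ∧ s < pt n i ∧ pt n i < t

namespace RefiningGrid

variable {ι : Type*} [LinearOrder ι] [OrderBot ι] [OrderTop ι] (g : RefiningGrid ι)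

lemma lt_iff {n i j : ℕ} (hi : i ≤ 2 ^ n) (hj : j ≤ 2 ^ n) : g.pt n i < g.pt n j ↔ i < j := by
  constructor
  · intro h
    by_contra! hc
    rcases hc.eq_or_lt with rfl | hc
    · exact lt_irrefl _ h
    · exact lt_asymm h (g.strict n j i hc hi)
  · exact fun h => g.strict n i j h hj

lemma mono {n i j : ℕ} (hij : i ≤ j) (hj : j ≤ 2 ^ n) : g.pt n i ≤ g.pt n j := by
  rcases hij.eq_or_lt with rfl | h
  · exact le_rfl
  · exact (g.strict n i j h hj).le

lemma refine_add (n k i : ℕ) : g.pt (n + k) (2 ^ k * i) = g.pt n i := by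
  induction k with
  | zero => simp
  | succ k ih => rw [← ih, ← add_assoc, pow_succ', mul_assoc, g.refine]

lemma exists_pt_of_le {n k i : ℕ} (hnk : n ≤ k) (hi : i ≤ 2 ^ n) :
    ∃ j ≤ 2 ^ k, g.pt k j = g.pt n i := by
  obtain ⟨l, rfl⟩ := Nat.exists_eq_add_of_le hnk
  refine ⟨2 ^ l * i, ?_, g.refine_add n l i⟩
  rw [pow_add, mul_comm]
  exact Nat.mul_le_mul_right _ hi

/-- The set of all points of the grid. -/
def points : Set ι := {t | ∃ n, ∃ i ≤ 2 ^ n, g.pt n i = t}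

lemma pt_mem {n i : ℕ} (hi : i ≤ 2 ^ n) : g.pt n i ∈ g.points := ⟨n, i, hi, rfl⟩

lemma countable_points : g.points.Countable := by
  have : g.points ⊆ range (fun p : ℕ × ℕ => g.pt p.1 p.2) := by
    rintro t ⟨n, i, -, rfl⟩
    exact ⟨(n, i), rfl⟩
  exact (countable_range _).mono this

lemma bot_mem : ⊥ ∈ g.points := ⟨0, 0, by simp, g.zero 0⟩

lemma top_mem : ⊤ ∈ g.points := ⟨0, 2 ^ 0, le_rfl, g.last 0⟩

lemma exists_between {s t : ι} (h : s < t) : ∃ q ∈ g.points, s < q ∧ q < t := by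
  obtain ⟨n, i, hi, h1, h2⟩ := g.dense s t h
  exact ⟨_, g.pt_mem hi, h1, h2⟩

/-- Every point other than `⊥` lies in one half-open cell of the `n`-th partition. -/
lemma exists_cell (n : ℕ) {t : ι} (ht : t ≠ ⊥) :
    ∃ i < 2 ^ n, g.pt n i < t ∧ t ≤ g.pt n (i + 1) := by
  classical
  have hex : ∃ j, t ≤ g.pt n j := ⟨2 ^ n, by rw [g.last]; exact le_top⟩
  set j := Nat.find hex with hj
  have h1 : t ≤ g.pt n j := Nat.find_spec hex
  have h0 : j ≠ 0 := by
    intro h0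
    rw [h0, g.zero] at h1
    exact ht (le_bot_iff.1 h1)
  have hle : j ≤ 2 ^ n := Nat.find_min' hex (by rw [g.last]; exact le_top)
  refine ⟨j - 1, by omega, ?_, ?_⟩
  · exact not_le.1 (Nat.find_min hex (m := j - 1) (by omega))
  · rwa [Nat.sub_add_cancel (by omega)]

/-- The largest point of the `n`-th partition strictly below `t`. -/
noncomputable def below (n : ℕ) (t : ι) : ι := by
  classical
  exact if h : t = ⊥ then ⊥ else g.pt n (g.exists_cell n h).choose

lemma below_bot (n : ℕ) : g.below n ⊥ = ⊥ := by simp [below]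

lemma below_spec (n : ℕ) {t : ι} (ht : t ≠ ⊥) :
    ∃ i < 2 ^ n, g.below n t = g.pt n i ∧ g.pt n i < t ∧ t ≤ g.pt n (i + 1) := by
  have h := (g.exists_cell n ht).choose_spec
  exact ⟨_, h.1, by simp [below, ht], h.2.1, h.2.2⟩

lemma below_lt (n : ℕ) {t : ι} (ht : t ≠ ⊥) : g.below n t < t := by
  obtain ⟨i, -, h1, h2, -⟩ := g.below_spec n ht
  rwa [h1]

lemma below_eq {n i : ℕ} (hi : i < 2 ^ n) {t : ι} (h1 : g.pt n i < t) (h2 : t ≤ g.pt n (i + 1)) :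
    g.below n t = g.pt n i := by
  have ht : t ≠ ⊥ := fun h => by simp [h] at h1
  obtain ⟨j, hj, hj1, hj2, hj3⟩ := g.below_spec n ht
  rw [hj1]
  have a := (g.lt_iff hi.le (by omega : j + 1 ≤ 2 ^ n)).1 (h1.trans_le hj3)
  have b := (g.lt_iff hj.le (by omega : i + 1 ≤ 2 ^ n)).1 (hj2.trans_le h2)
  have : j = i := by omega
  rw [this]

lemma le_below {n k i : ℕ} (hnk : n ≤ k) (hi : i ≤ 2 ^ n) {t : ι} (ht : g.pt n i < t) :
    g.pt n i ≤ g.below k t := by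
  obtain ⟨j, hj, hji⟩ := g.exists_pt_of_le hnk hi
  have ht' : t ≠ ⊥ := fun h => by simp [h] at ht
  obtain ⟨l, hl, hl1, hl2, hl3⟩ := g.below_spec k ht'
  rw [hl1, ← hji]
  have := (g.lt_iff hj (by omega : l + 1 ≤ 2 ^ k)).1 ((hji ▸ ht).trans_le hl3)
  exact g.mono (by omega) hl.le

lemma eventually_lt_below {s t : ι} (h : s < t) : ∀ᶠ n in atTop, s < g.below n t := by
  obtain ⟨n, i, hi, h1, h2⟩ := g.dense s t h
  filter_upwards [eventually_ge_atTop n] with k hk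
  exact h1.trans_le (g.le_below hk hi h2)

lemma tendsto_below [TopologicalSpace ι] [OrderTopology ι] {t : ι} (ht : t ≠ ⊥) :
    Tendsto (fun n => g.below n t) atTop (𝓝[<] t) := by
  refine tendsto_nhdsWithin_iff.2 ⟨?_, Eventually.of_forall fun n => g.below_lt n ht⟩
  refine tendsto_order.2 ⟨fun s hs => g.eventually_lt_below hs, fun s hs => ?_⟩
  exact Eventually.of_forall fun n => (g.below_lt n ht).trans hs

/-- The smallest point of the `n`-th partition above `t`. -/
noncomputable def above (n : ℕ) (t : ι) : ι := by
  classical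
  exact if h : t = ⊥ then ⊥ else g.pt n ((g.exists_cell n h).choose + 1)

lemma above_bot (n : ℕ) : g.above n ⊥ = ⊥ := by simp [above]

lemma above_spec (n : ℕ) {t : ι} (ht : t ≠ ⊥) :
    ∃ i < 2 ^ n, g.above n t = g.pt n (i + 1) ∧ g.pt n i < t ∧ t ≤ g.pt n (i + 1) := by
  have h := (g.exists_cell n ht).choose_spec
  exact ⟨_, h.1, by simp [above, ht], h.2.1, h.2.2⟩

lemma le_above (n : ℕ) (t : ι) : t ≤ g.above n t := by
  by_cases ht : t = ⊥
  · simp [ht]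
  · obtain ⟨i, -, h1, -, h2⟩ := g.above_spec n ht
    rwa [h1]

lemma above_le {n k i : ℕ} (hnk : n ≤ k) (hi : i ≤ 2 ^ n) {t : ι} (ht : t ≤ g.pt n i) :
    g.above k t ≤ g.pt n i := by
  by_cases htb : t = ⊥
  · simp [htb, above_bot]
  obtain ⟨j, hj, hji⟩ := g.exists_pt_of_le hnk hi
  obtain ⟨l, hl, hl1, hl2, hl3⟩ := g.above_spec k htb
  rw [hl1, ← hji]
  have := (g.lt_iff hl.le hj).1 (hl2.trans_le (hji ▸ ht))
  exact g.mono (by omega) hj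

lemma above_mono (n : ℕ) : Monotone (g.above n) := by
  intro s t hst
  by_cases ht : t = ⊥
  · simp [le_bot_iff.1 (ht ▸ hst), ht]
  · obtain ⟨i, hi, h1, -, h2⟩ := g.above_spec n ht
    rw [h1]
    exact g.above_le le_rfl hi (hst.trans h2)

lemma tendsto_above [TopologicalSpace ι] [OrderTopology ι] (t : ι) :
    Tendsto (fun n => g.above n t) atTop (𝓝[≥] t) := by
  refine tendsto_nhdsWithin_iff.2 ⟨?_, Eventually.of_forall fun n => g.le_above n t⟩
  refine tendsto_order.2 ⟨fun s hs => Eventually.of_forall fun n => hs.trans_le (g.le_above n t),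
    fun s hs => ?_⟩
  obtain ⟨n, i, hi, h1, h2⟩ := g.dense t s hs
  filter_upwards [eventually_ge_atTop n] with k hk
  exact (g.above_le hk hi h1.le).trans_lt h2

end RefiningGrid

/-- The dyadic partitions of `[0, T]`. -/
noncomputable def dyadicGrid {T : ℝ≥0} (hT : 0 < T) : RefiningGrid (Set.Iic T) where
  -- The minimum matters only for `i > 2 ^ n`; it keeps the point inside the interval.
  pt n i := ⟨min T (T * (i / 2 ^ n)), Set.mem_Iic.2 (min_le_left _ _)⟩
  strict n i j hij hj := by
    have hi' : (i : ℝ≥0) / 2 ^ n < j / 2 ^ n := by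
      gcongr
    have hj' : (j : ℝ≥0) / 2 ^ n ≤ 1 := by
      rw [div_le_one (by positivity)]
      exact_mod_cast hj
    have a : T * (j / 2 ^ n) ≤ T := mul_le_of_le_one_right' hj'
    have b : T * (i / 2 ^ n) < T * (j / 2 ^ n) := by gcongr
    rw [Subtype.mk_lt_mk, min_eq_right a, min_eq_right (b.le.trans a)]
    exact b
  zero n := by
    apply Subtype.ext
    simp
  last n := by
    apply Subtype.ext
    simp
  refine n i := by
    apply Subtype.ext
    have : ((2 * i : ℕ) : ℝ≥0) / 2 ^ (n + 1) = i / 2 ^ n := by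
      push_cast
      rw [pow_succ']
      exact mul_div_mul_left _ _ (by norm_num)
    simp only [this]
  dense s t hst := by
    have hst' : (s : ℝ≥0) < t := hst
    have htT : (t : ℝ≥0) ≤ T := t.2
    have hd : (0 : ℝ) < ((t : ℝ≥0) : ℝ) - (s : ℝ≥0) := sub_pos.2 hst'
    have hTr : (0 : ℝ) < T := hT
    -- The level is chosen so that the mesh `T / 2 ^ n` is smaller than `t - s`. The first grid
    -- point beyond `s` is then still below `t`.
    obtain ⟨n, hn⟩ := exists_nat_gt ((T : ℝ) / (((t : ℝ≥0) : ℝ) - (s : ℝ≥0)))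
    have hn2 : (T : ℝ) < 2 ^ n * (((t : ℝ≥0) : ℝ) - (s : ℝ≥0)) := by
      rw [div_lt_iff₀ hd] at hn
      refine hn.trans_le ?_
      gcongr
      exact_mod_cast Nat.lt_two_pow_self.le
    set k := ⌊((s : ℝ≥0) : ℝ) * 2 ^ n / T⌋₊ with hk
    have h1 : (k : ℝ) ≤ ((s : ℝ≥0) : ℝ) * 2 ^ n / T := Nat.floor_le (by positivity)
    have h2 : ((s : ℝ≥0) : ℝ) * 2 ^ n / T < k + 1 := Nat.lt_floor_add_one _
    rw [le_div_iff₀ hTr] at h1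
    rw [div_lt_iff₀ hTr] at h2
    have e1 : ((s : ℝ≥0) : ℝ) < T * ((k + 1) / 2 ^ n) := by
      rw [← mul_div_assoc, lt_div_iff₀ (by positivity)]
      linarith
    have e2 : (T : ℝ) * ((k + 1) / 2 ^ n) < (t : ℝ≥0) := by
      rw [← mul_div_assoc, div_lt_iff₀ (by positivity)]
      linarith
    have htr : ((t : ℝ≥0) : ℝ) ≤ T := htT
    have e3 : T * (((k + 1 : ℕ) : ℝ≥0) / 2 ^ n) < (t : ℝ≥0) := by
      rw [← NNReal.coe_lt_coe]
      push_cast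
      exact e2
    have e4 : min T (T * (((k + 1 : ℕ) : ℝ≥0) / 2 ^ n)) = T * (((k + 1 : ℕ) : ℝ≥0) / 2 ^ n) :=
      min_eq_right (e3.le.trans htT)
    refine ⟨n, k + 1, ?_, ?_, ?_⟩
    · have : ((k : ℝ) + 1) / 2 ^ n < 1 := by
        by_contra! hc
        have : (T : ℝ) * 1 ≤ T * ((k + 1) / 2 ^ n) := by gcongr
        linarith
      rw [div_lt_one (by positivity)] at this
      exact_mod_cast this.le
    · rw [← Subtype.coe_lt_coe]
      simp only [e4]
      rw [← NNReal.coe_lt_coe]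
      push_cast
      exact e1
    · rw [← Subtype.coe_lt_coe]
      simp only [e4]
      exact e3

lemma compactIccSpace_Iic (T : ℝ≥0) : CompactIccSpace (Set.Iic T) := by
  refine ⟨fun {a b} => ?_⟩
  rw [Subtype.isCompact_iff]
  have : (Subtype.val '' Icc a b : Set ℝ≥0) = Icc a.1 b.1 := by
    ext x
    constructor
    · rintro ⟨y, hy, rfl⟩
      exact hy
    · rintro hx
      exact ⟨⟨x, hx.2.trans b.2⟩, hx, rfl⟩
  rw [this]
  exact isCompact_Icc

/-! ### Predictable processes -/

section Predictable

variable {Ω ι E : Type*} {m : MeasurableSpace Ω} [LinearOrder ι] [OrderBot ι]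
  {𝓕 : Filtration ι m}

lemma measurableSet_predictable_univ_prod {A : Set Ω} (hA : MeasurableSet[𝓕 ⊥] A) :
    MeasurableSet[𝓕.predictable] ((univ : Set ι) ×ˢ A) := by
  have : (univ : Set ι) ×ˢ A = {⊥} ×ˢ A ∪ Ioi ⊥ ×ˢ A := by
    rw [← union_prod]
    congr 1
    ext t
    simp
  rw [this]
  exact (measurableSet_predictable_singleton_bot_prod hA).union
    (measurableSet_predictable_Ioi_prod hA)

lemma predictable_le_prod [TopologicalSpace ι] [OrderTopology ι] [MeasurableSpace ι]
    [BorelSpace ι] : 𝓕.predictable ≤ Prod.instMeasurableSpace := by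
  refine measurableSpace_le_predictable_of_measurableSet ?_ ?_
  · exact fun A hA => (measurableSet_singleton _).prod (𝓕.le _ _ hA)
  · exact fun i A hA => measurableSet_Ioi.prod (𝓕.le _ _ hA)

lemma measurable_predictable_indicator_Ioi [MeasurableSpace E] [Zero E] {s : ι} {f : Ω → E}
    (hf : Measurable[𝓕 s] f) :
    Measurable[𝓕.predictable] fun p : ι × Ω => (Ioi s).indicator (fun _ => f p.2) p.1 := by
  classical
  intro B hB
  have : (fun p : ι × Ω => (Ioi s).indicator (fun _ => f p.2) p.1) ⁻¹' B =
      Ioi s ×ˢ (f ⁻¹' B) ∪ ((Ioi s ×ˢ (univ : Set Ω))ᶜ ∩ {p | (0 : E) ∈ B}) := by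
    ext ⟨t, ω⟩
    by_cases h : s < t <;> simp [indicator, h]
  rw [this]
  refine (measurableSet_predictable_Ioi_prod (hf hB)).union
    (MeasurableSet.inter (MeasurableSet.compl ?_) (MeasurableSet.const _))
  exact measurableSet_predictable_Ioi_prod MeasurableSet.univ

/-- Up to time `q` the stopped process is the predictable process itself, and after `q` it is frozen
at an `𝓕 q`-measurable value on `(q, ⊤]`, which is a generator of the predictable σ-algebra. -/
lemma measurable_predictable_min [MeasurableSpace E] {f : ι → Ω → E}
    (hf : Measurable[𝓕.predictable] (Function.uncurry f)) {q : ι} (hq : Measurable[𝓕 q] (f q)) :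
    Measurable[𝓕.predictable] fun p : ι × Ω => f (min q p.1) p.2 := by
  intro B hB
  have : (fun p : ι × Ω => f (min q p.1) p.2) ⁻¹' B =
      ((Ioi q ×ˢ (univ : Set Ω))ᶜ ∩ Function.uncurry f ⁻¹' B) ∪ Ioi q ×ˢ (f q ⁻¹' B) := by
    ext ⟨t, ω⟩
    by_cases h : q < t
    · simp [h, min_eq_left h.le]
    · simp [h, min_eq_right (not_lt.1 h)]
  rw [this]
  refine MeasurableSet.union (MeasurableSet.inter (MeasurableSet.compl ?_) (hf hB))
    (measurableSet_predictable_Ioi_prod (hq hB))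
  exact measurableSet_predictable_Ioi_prod MeasurableSet.univ

/-- On each half-open cell the value is that at the left endpoint, known at the start of the cell.
Such step processes are the elementary predictable ones. -/
lemma measurable_predictable_below [OrderTop ι] (g : RefiningGrid ι) [MeasurableSpace E]
    {f : ι → Ω → E} (hf : ∀ t, Measurable[𝓕 t] (f t)) (n : ℕ) :
    Measurable[𝓕.predictable] fun p : ι × Ω => f (g.below n p.1) p.2 := by
  intro B hB
  have : (fun p : ι × Ω => f (g.below n p.1) p.2) ⁻¹' B = {⊥} ×ˢ (f ⊥ ⁻¹' B) ∪
      ⋃ i ∈ Finset.range (2 ^ n), Ioc (g.pt n i) (g.pt n (i + 1)) ×ˢ (f (g.pt n i) ⁻¹' B) := by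
    ext ⟨t, ω⟩
    simp only [mem_preimage, mem_union, mem_prod, mem_singleton_iff, Finset.mem_range, mem_iUnion,
      exists_prop, mem_Ioc]
    constructor
    · intro h
      by_cases ht : t = ⊥
      · left
        rw [ht, g.below_bot] at h
        exact ⟨ht, h⟩
      · right
        obtain ⟨i, hi, h1, h2, h3⟩ := g.below_spec n ht
        exact ⟨i, hi, ⟨h2, h3⟩, h1 ▸ h⟩
    · rintro (⟨rfl, h⟩ | ⟨i, hi, ⟨h1, h2⟩, h3⟩)
      · rwa [g.below_bot]
      · rwa [g.below_eq hi h1 h2]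
  rw [this]
  refine (measurableSet_predictable_singleton_bot_prod (hf _ hB)).union ?_
  exact Finset.measurableSet_biUnion _ fun i _ => measurableSet_predictable_Ioc_prod _ _ (hf _ hB)

/-- Sampling an adapted process at the last grid point strictly before `t` gives predictable step
processes, and they converge to the left limits. -/
lemma measurable_predictable_leftLim [OrderTop ι] [TopologicalSpace ι] [OrderTopology ι]
    (g : RefiningGrid ι) [TopologicalSpace E] [TopologicalSpace.PseudoMetrizableSpace E]
    [MeasurableSpace E] [BorelSpace E] {f L : ι → Ω → E} (hf : ∀ t, Measurable[𝓕 t] (f t))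
    (hbot : L ⊥ = f ⊥) (hL : ∀ t ω, t ≠ ⊥ → Tendsto (fun s => f s ω) (𝓝[<] t) (𝓝 (L t ω))) :
    Measurable[𝓕.predictable] (Function.uncurry L) := by
  refine @measurable_of_tendsto_metrizable _ _ 𝓕.predictable _ _ _ _ _ _
    (measurable_predictable_below (𝓕 := 𝓕) g hf) ?_
  rw [tendsto_pi_nhds]
  rintro ⟨t, ω⟩
  by_cases ht : t = ⊥
  · subst ht
    simp only [g.below_bot, Function.uncurry_apply_pair, hbot]
    exact tendsto_const_nhds
  · exact (hL t ω ht).comp (g.tendsto_below ht)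

/-- Restricted to times up to `t`, a predictable process is jointly measurable for `𝓕 t`; its
section at `t` is therefore `𝓕 t`-measurable. -/
lemma measurable_of_predictable [MeasurableSpace E] {f : ι → Ω → E} [MeasurableSpace ι]
    [TopologicalSpace ι] [OrderTopology ι] [BorelSpace ι]
    (hf : Measurable[𝓕.predictable] (Function.uncurry f)) (t : ι) : Measurable[𝓕 t] (f t) := by
  have h := @Measurable.comp _ _ _ (Subtype.instMeasurableSpace.prod (𝓕 t)) 𝓕.predictable _ _ _ hf
    (measurable_inclusion_predictable (𝓕 := 𝓕) (i := t))
  exact @Measurable.comp _ _ _ (𝓕 t) (Subtype.instMeasurableSpace.prod (𝓕 t)) _ _ _ h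
    (measurable_prodMk_left (x := (⟨t, le_rfl⟩ : Set.Iic t)))

end Predictable

/-! ### Increasing processes, their path measures and Doléans measures -/

/-- A process with increasing right-continuous paths, null at the initial time. -/
structure IncreasingProcess (Ω ι : Type*) [MeasurableSpace Ω] [LinearOrder ι] [OrderBot ι]
    [TopologicalSpace ι] where
  toFun : ι → Ω → ℝ
  mono : ∀ ω, Monotone fun t => toFun t ω
  rightCont : ∀ ω t, ContinuousWithinAt (fun s => toFun s ω) (Ici t) t
  measurable : ∀ t, Measurable (toFun t)
  bot : ∀ ω, toFun ⊥ ω = 0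

namespace IncreasingProcess

variable {Ω ι : Type*} {m : MeasurableSpace Ω} [LinearOrder ι] [OrderBot ι]
  [TopologicalSpace ι]

lemma nonneg (A : IncreasingProcess Ω ι) (t : ι) (ω : Ω) : 0 ≤ A.toFun t ω := by
  rw [← A.bot ω]
  exact A.mono ω bot_le

/-- A path of an increasing process as a Stieltjes function. -/
def stieltjes (A : IncreasingProcess Ω ι) (ω : Ω) : StieltjesFunction ι where
  toFun t := A.toFun t ω
  mono' := A.mono ω
  right_continuous' := A.rightCont ω

variable [OrderTop ι] [OrderTopology ι] [MeasurableSpace ι] [BorelSpace ι]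
  [SecondCountableTopology ι] [DenselyOrdered ι] [CompactIccSpace ι]

/-- The Stieltjes measure of a path. -/
noncomputable def pathMeasure (A : IncreasingProcess Ω ι) (ω : Ω) : Measure ι :=
  (A.stieltjes ω).measure

variable (A : IncreasingProcess Ω ι) (ω : Ω)

lemma pathMeasure_Ioc (s t : ι) :
    A.pathMeasure ω (Ioc s t) = ENNReal.ofReal (A.toFun t ω - A.toFun s ω) :=
  StieltjesFunction.measure_Ioc _ _ _

/-- A Stieltjes measure puts no mass on the least element. As the process starts at `0` nothing is
lost, and `Iic t` carries exactly `A t`. -/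
lemma pathMeasure_bot : A.pathMeasure ω {⊥} = 0 := by
  have := (A.stieltjes ω).measure_botSet
  rwa [botSet_eq_singleton_of_isBot isBot_bot] at this

lemma pathMeasure_Iic (t : ι) : A.pathMeasure ω (Iic t) = ENNReal.ofReal (A.toFun t ω) := by
  have : Iic t = {⊥} ∪ Ioc ⊥ t := by
    rw [← Icc_bot, ← Icc_union_Ioc_eq_Icc (le_refl (⊥ : ι)) bot_le, Icc_self]
  rw [this, measure_union (by simp) measurableSet_Ioc, pathMeasure_bot, pathMeasure_Ioc, A.bot,
    sub_zero, zero_add]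

lemma pathMeasure_univ : A.pathMeasure ω univ = ENNReal.ofReal (A.toFun ⊤ ω) := by
  rw [← Iic_top, pathMeasure_Iic]

instance : IsFiniteMeasure (A.pathMeasure ω) :=
  ⟨by rw [pathMeasure_univ]; exact ENNReal.ofReal_lt_top⟩

lemma pathMeasure_Ioi (t : ι) :
    A.pathMeasure ω (Ioi t) = ENNReal.ofReal (A.toFun ⊤ ω - A.toFun t ω) := by
  rw [← Ioc_top, pathMeasure_Ioc]

lemma pathMeasure_singleton (t : ι) :
    A.pathMeasure ω {t} =
      ENNReal.ofReal (A.toFun t ω - Function.leftLim (fun s => A.toFun s ω) t) :=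
  StieltjesFunction.measure_singleton _ _

/-- There is nothing to the left of `⊥`, so `Function.leftLim` takes its default there, the value of
the function itself. -/
lemma leftLim_bot : Function.leftLim (fun s => A.toFun s ω) ⊥ = 0 := by
  rw [leftLim_eq_of_eq_bot _ (by simp), A.bot]

lemma pathMeasure_Iio (t : ι) : A.pathMeasure ω (Iio t) =
    ENNReal.ofReal (Function.leftLim (fun s => A.toFun s ω) t) := by
  have : Iio t = Ico ⊥ t := by simp
  rw [this]
  refine (StieltjesFunction.measure_Ico _ _ _).trans ?_
  congr 1
  change Function.leftLim (fun s => A.toFun s ω) t - Function.leftLim (fun s => A.toFun s ω) ⊥ = _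
  rw [leftLim_bot, sub_zero]

lemma measurable_pathMeasure : Measurable fun ω => A.pathMeasure ω := by
  refine Measurable.measure_of_isPiSystem (S := range Iic) ?_ isPiSystem_Iic ?_ ?_
  · rw [BorelSpace.measurable_eq (α := ι), borel_eq_generateFrom_Iic]
  · rintro _ ⟨t, rfl⟩
    simp_rw [pathMeasure_Iic]
    exact (A.measurable t).ennreal_ofReal
  · simp_rw [pathMeasure_univ]
    exact (A.measurable ⊤).ennreal_ofReal

lemma measurable_map_pathMeasure :
    Measurable fun ω => (A.pathMeasure ω).map fun t => ((t, ω) : ι × Ω) := by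
  have : ∀ ω, IsFiniteMeasure ((A.pathMeasure ω).map fun t => ((t, ω) : ι × Ω)) := fun ω =>
    Measure.isFiniteMeasure_map _ _
  refine Measurable.measure_of_isPiSystem generateFrom_prod.symm isPiSystem_prod ?_ ?_
  · rintro _ ⟨s, hs, t, ht, rfl⟩
    have : (fun ω => ((A.pathMeasure ω).map fun t => ((t, ω) : ι × Ω)) (s ×ˢ t)) =
        t.indicator fun ω => A.pathMeasure ω s := by
      ext ω
      rw [Measure.map_apply (by fun_prop) (MeasurableSet.prod hs ht)]
      by_cases h : ω ∈ t <;> simp [h]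
    rw [this]
    exact ((Measure.measurable_coe hs).comp A.measurable_pathMeasure).indicator ht
  · have : (fun ω => ((A.pathMeasure ω).map fun t => ((t, ω) : ι × Ω)) univ) =
        fun ω => A.pathMeasure ω univ := by
      ext ω
      rw [Measure.map_apply (by fun_prop) .univ, preimage_univ]
    rw [this]
    exact (Measure.measurable_coe .univ).comp A.measurable_pathMeasure

/-- The Doléans measure of an increasing process, on the Borel sets of the product space. -/
noncomputable def doleans (P : Measure Ω) : Measure (ι × Ω) :=
  P.bind fun ω => (A.pathMeasure ω).map fun t => ((t, ω) : ι × Ω)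

lemma lintegral_doleans {P : Measure Ω} {f : ι × Ω → ℝ≥0∞} (hf : Measurable f) :
    ∫⁻ p, f p ∂A.doleans P = ∫⁻ ω, ∫⁻ t, f (t, ω) ∂A.pathMeasure ω ∂P := by
  rw [doleans, Measure.lintegral_bind A.measurable_map_pathMeasure.aemeasurable hf.aemeasurable]
  refine lintegral_congr fun ω => ?_
  rw [lintegral_map hf (by fun_prop)]

lemma doleans_apply {P : Measure Ω} {S : Set (ι × Ω)} (hS : MeasurableSet S) :
    A.doleans P S = ∫⁻ ω, A.pathMeasure ω {t | (t, ω) ∈ S} ∂P := by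
  rw [doleans, Measure.bind_apply hS A.measurable_map_pathMeasure.aemeasurable]
  refine lintegral_congr fun ω => ?_
  rw [Measure.map_apply (by fun_prop) hS]
  rfl

lemma measurable_lintegral_pathMeasure {f : ι × Ω → ℝ≥0∞} (hf : Measurable f) :
    Measurable fun ω => ∫⁻ t, f (t, ω) ∂A.pathMeasure ω := by
  have := (Measure.measurable_lintegral hf).comp A.measurable_map_pathMeasure
  convert this using 2 with ω
  rw [Function.comp_apply, lintegral_map hf (by fun_prop)]

end IncreasingProcess

/-! ### Variation of a predictable right-continuous process -/

section Variation

/-- Triangle inequality: skipping points of a sequence only decreases the sum of its steps. -/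
lemma sum_edist_comp_le {E : Type*} [PseudoEMetricSpace E] (F : ℕ → E) {u : ℕ → ℕ}
    (hu : Monotone u) (K : ℕ) :
    ∑ k ∈ Finset.range K, edist (F (u (k + 1))) (F (u k)) ≤
      ∑ i ∈ Finset.Ico (u 0) (u K), edist (F (i + 1)) (F i) := by
  induction K with
  | zero => simp
  | succ K ih =>
    rw [Finset.sum_range_succ, ← Finset.sum_Ico_consecutive _ (hu K.zero_le) (hu K.le_succ)]
    refine add_le_add ih ?_
    rw [edist_comm]
    refine (edist_le_Ico_sum_edist F (hu K.le_succ)).trans_eq ?_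
    exact Finset.sum_congr rfl fun i _ => edist_comm _ _

variable {ι E : Type*} [LinearOrder ι] [OrderBot ι] [OrderTop ι]

lemma RefiningGrid.exists_above_index (g : RefiningGrid ι) (n : ℕ) :
    ∃ φ : ι → ℕ, Monotone φ ∧ (∀ t, φ t ≤ 2 ^ n) ∧ ∀ t, g.above n t = g.pt n (φ t) := by
  have h : ∀ t, ∃ i ≤ 2 ^ n, g.above n t = g.pt n i := by
    intro t
    by_cases ht : t = ⊥
    · exact ⟨0, by simp, by rw [ht, g.above_bot, g.zero]⟩
    · obtain ⟨i, hi, h1, -⟩ := g.above_spec n ht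
      exact ⟨i + 1, hi, h1⟩
  choose φ h1 h2 using h
  refine ⟨φ, fun s t hst => ?_, h1, h2⟩
  by_contra! hc
  have := (g.lt_iff (h1 t) (h1 s)).2 hc
  rw [← h2, ← h2] at this
  exact absurd (g.above_mono n hst) (not_le.2 this)

variable [TopologicalSpace ι] [OrderTopology ι]

/-- By right-continuity the points of an arbitrary partition can be moved up to grid points with an
error tending to `0`. The variation is thus a countable supremum, which is what makes it measurable.
-/
lemma eVariationOn_Icc_bot_eq_iSup [PseudoEMetricSpace E] (g : RefiningGrid ι) {f : ι → E}
    (hf : ∀ t, ContinuousWithinAt f (Ici t) t) (t : ι) :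
    eVariationOn f (univ ∩ Icc ⊥ t) = ⨆ n, ∑ i ∈ Finset.range (2 ^ n),
      edist (f (min (g.pt n (i + 1)) t)) (f (min (g.pt n i) t)) := by
  apply le_antisymm
  · refine iSup_le ?_
    rintro ⟨K, u, hu, hut⟩
    have hlim : ∀ k, Tendsto (fun n => f (min (g.above n (u k)) t)) atTop (𝓝 (f (u k))) := by
      intro k
      have h1 : Tendsto (fun n => min (g.above n (u k)) t) atTop (𝓝[≥] (u k)) := by
        refine tendsto_nhdsWithin_iff.2 ⟨?_, Eventually.of_forall fun n => ?_⟩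
        · have := ((tendsto_nhdsWithin_iff.1 (g.tendsto_above (u k))).1).min
            (tendsto_const_nhds (x := t))
          rwa [min_eq_left (hut k).2.2] at this
        · exact le_min (g.le_above n _) (hut k).2.2
      exact (hf (u k)).tendsto.comp h1
    refine le_of_tendsto (tendsto_finsetSum _ fun k _ => (hlim (k + 1)).edist (hlim k))
      (Eventually.of_forall fun n => ?_)
    refine le_trans ?_ (le_iSup _ n)
    obtain ⟨φ, hφ, hφn, hφg⟩ := g.exists_above_index n
    simp_rw [hφg]
    refine (sum_edist_comp_le (fun i => f (min (g.pt n i) t)) (hφ.comp hu) K).trans ?_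
    refine Finset.sum_le_sum_of_subset fun i hi => ?_
    rw [Finset.mem_Ico] at hi
    exact Finset.mem_range.2 (hi.2.trans_le (hφn _))
  · refine iSup_le fun n => ?_
    refine eVariationOn.sum_le_of_monotoneOn_Iic (u := fun i => min (g.pt n i) t) ?_ ?_
    · intro i hi j hj hij
      exact min_le_min_right _ (g.mono hij hj)
    · exact fun i _ => ⟨mem_univ _, bot_le, min_le_right _ _⟩

/-- The σ-algebra is left arbitrary, here and in the later `_aux` lemmas, so that on `ι × Ω` it can
be the predictable one and not the product. -/
lemma measurable_iSup_sum_edist {α : Type*} {mα : MeasurableSpace α} {X Y : ℕ → ℕ → α → ℝ}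
    (hX : ∀ n i, Measurable (X n i)) (hY : ∀ n i, Measurable (Y n i)) :
    Measurable fun p => (⨆ n, ∑ i ∈ Finset.range (2 ^ n),
      edist (X n i p) (Y n i p)).toReal :=
  Measurable.ennreal_toReal (Measurable.iSup fun n =>
    Finset.measurable_sum _ fun i _ => (hX n i).edist (hY n i))

variable {Ω : Type*} {m : MeasurableSpace Ω} {𝓕 : Filtration ι m} [MeasurableSpace ι]
  [BorelSpace ι]

/-- Each grid sum involves only `D` stopped at deterministic grid times, and these stopped processes
are predictable. -/
lemma measurable_predictable_variation (g : RefiningGrid ι) {D : ι → Ω → ℝ}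
    (hD : Measurable[𝓕.predictable] (Function.uncurry D))
    (hrc : ∀ ω t, ContinuousWithinAt (fun s => D s ω) (Ici t) t) :
    Measurable[𝓕.predictable] (Function.uncurry
      fun t ω => variationOnFromTo (fun s => D s ω) univ ⊥ t) := by
  have : Function.uncurry (fun t ω => variationOnFromTo (fun s => D s ω) univ ⊥ t) =
      fun p : ι × Ω => (⨆ n, ∑ i ∈ Finset.range (2 ^ n),
      edist (D (min (g.pt n (i + 1)) p.1) p.2) (D (min (g.pt n i) p.1) p.2)).toReal := by
    ext ⟨t, ω⟩
    rw [Function.uncurry_apply_pair, variationOnFromTo.eq_of_le _ _ bot_le,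
      eVariationOn_Icc_bot_eq_iSup g (hrc ω)]
  rw [this]
  have key : ∀ q, Measurable[𝓕.predictable] fun p : ι × Ω => D (min q p.1) p.2 := fun q =>
    measurable_predictable_min hD (measurable_of_predictable hD _)
  exact measurable_iSup_sum_edist (fun n i => key _) fun n i => key _

/-- A predictable right-continuous process of bounded variation, null at the initial time, is the
difference of two predictable increasing processes whose sum `v` is its variation. -/
theorem exists_increasing_decomposition (g : RefiningGrid ι) [DenselyOrdered ι] {D : ι → Ω → ℝ}
    (hD : Measurable[𝓕.predictable] (Function.uncurry D))
    (hrc : ∀ ω t, ContinuousWithinAt (fun s => D s ω) (Ici t) t)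
    (hbv : ∀ ω, BoundedVariationOn (fun s => D s ω) univ) (hbot : ∀ ω, D ⊥ ω = 0) :
    ∃ v a b : IncreasingProcess Ω ι,
      Measurable[𝓕.predictable] (Function.uncurry v.toFun) ∧
      Measurable[𝓕.predictable] (Function.uncurry a.toFun) ∧
      Measurable[𝓕.predictable] (Function.uncurry b.toFun) ∧
      (∀ t ω, a.toFun t ω - b.toFun t ω = D t ω) ∧
      (∀ t ω, a.toFun t ω + b.toFun t ω = v.toFun t ω) ∧
      ∀ ω t K, 0 ≤ K → (∀ r < t, v.toFun r ω ≤ K) → v.toFun t ω ≤ 2 * K + |D t ω| := by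
  set V : ι → Ω → ℝ := fun t ω => variationOnFromTo (fun s => D s ω) univ ⊥ t with hV
  have hVm := measurable_predictable_variation g hD hrc
  have hVrc : ∀ ω t, ContinuousWithinAt (fun s => V s ω) (Ici t) t := fun ω t =>
    (hbv ω).continuousWithinAt_variationOnFromTo_Ici (hrc ω t)
  have hloc : ∀ ω, LocallyBoundedVariationOn (fun s => D s ω) univ := fun ω =>
    (hbv ω).locallyBoundedVariationOn
  have hVmono : ∀ ω, Monotone fun t => V t ω := fun ω => by
    rw [← monotoneOn_univ]
    exact variationOnFromTo.monotoneOn (hloc ω) (mem_univ _)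
  have hVbot : ∀ ω, V ⊥ ω = 0 := fun ω => variationOnFromTo.self _ _ _
  have hmeas : ∀ {f : ι → Ω → ℝ}, Measurable[𝓕.predictable] (Function.uncurry f) →
      ∀ t, Measurable (f t) := fun hf t => (measurable_of_predictable hf t).mono (𝓕.le t) le_rfl
  have ham : Measurable[𝓕.predictable] (Function.uncurry fun t ω => (V t ω + D t ω) / 2) :=
    (hVm.add hD).div_const 2
  have hbm : Measurable[𝓕.predictable] (Function.uncurry fun t ω => (V t ω - D t ω) / 2) :=
    (hVm.sub hD).div_const 2
  let v : IncreasingProcess Ω ι := ⟨V, hVmono, hVrc, hmeas hVm, hVbot⟩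
  let a : IncreasingProcess Ω ι := ⟨fun t ω => (V t ω + D t ω) / 2, fun ω s t hst => by
      have := variationOnFromTo.add_self_monotoneOn (hloc ω) (mem_univ ⊥) (mem_univ s)
        (mem_univ t) hst
      simp only [Pi.add_apply] at this
      change (V s ω + D s ω) / 2 ≤ (V t ω + D t ω) / 2
      linarith,
    fun ω t => ((hVrc ω t).add (hrc ω t)).div_const 2, hmeas ham, fun ω => by
      simp [hVbot, hbot]⟩
  let b : IncreasingProcess Ω ι := ⟨fun t ω => (V t ω - D t ω) / 2, fun ω s t hst => by
      have := variationOnFromTo.sub_self_monotoneOn (hloc ω) (mem_univ ⊥) (mem_univ s)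
        (mem_univ t) hst
      simp only [Pi.sub_apply] at this
      change (V s ω - D s ω) / 2 ≤ (V t ω - D t ω) / 2
      linarith,
    fun ω t => ((hVrc ω t).sub (hrc ω t)).div_const 2, hmeas hbm, fun ω => by
      simp [hVbot, hbot]⟩
  have hDv : ∀ t ω, |D t ω| ≤ V t ω := by
    intro t ω
    have h1 := a.nonneg t ω
    have h2 := b.nonneg t ω
    change 0 ≤ (V t ω + D t ω) / 2 at h1
    change 0 ≤ (V t ω - D t ω) / 2 at h2
    rw [abs_le]
    constructor <;> linarith
  refine ⟨v, a, b, hVm, ham, hbm, fun t ω => ?_, fun t ω => ?_, fun ω t K hK h => ?_⟩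
  · change (V t ω + D t ω) / 2 - (V t ω - D t ω) / 2 = _
    ring
  · change (V t ω + D t ω) / 2 + (V t ω - D t ω) / 2 = V t ω
    ring
  · by_cases ht : t = ⊥
    · rw [ht, v.bot]
      positivity
    have : (𝓝[<] t).NeBot := nhdsLT_neBot_of_exists_lt ⟨⊥, bot_lt_iff_ne_bot.2 ht⟩
    -- The variation jumps at `t` by `|D t - D (t-)|`, and `|D (t-)| ≤ v (t-) ≤ K`. Hence `v t ≤ K +
    -- |D t| + K`. This bound will make `v` integrable at the hitting time of a level.
    have h1 := variationOnFromTo.leftLim_eq (a := ⊥) (b := t) (hbv ω)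
    have h2 : Function.leftLim (variationOnFromTo (fun s => D s ω) univ ⊥) t ≤ K := by
      refine le_of_tendsto ((hVmono ω).tendsto_leftLim t) ?_
      filter_upwards [self_mem_nhdsWithin] with r hr using h r hr
    have h3 : |Function.leftLim (fun s => D s ω) t| ≤ K := by
      refine le_of_tendsto ((hbv ω).tendsto_leftLim t).abs ?_
      filter_upwards [self_mem_nhdsWithin] with r hr using (hDv r ω).trans (h r hr)
    rw [Real.dist_eq] at h1
    have h4 := abs_sub (D t ω) (Function.leftLim (fun s => D s ω) t)
    change variationOnFromTo (fun s => D s ω) univ ⊥ t ≤ _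
    linarith

end Variation

/-! ### Optional sampling along decreasing stopping times -/

section OptionalSampling

variable {Ω ι : Type*} {m : MeasurableSpace Ω} {P : Measure Ω} [IsProbabilityMeasure P]
  [LinearOrder ι] [OrderBot ι] [OrderTop ι] [TopologicalSpace ι] [OrderTopology ι]
  [FirstCountableTopology ι] {𝓕 : Filtration ι m}

/-- Optional stopping for countably many values. Of the σ-algebra of events before `τ` only two
facts are retained: it represents the stopped value as a conditional expectation of `D ⊤`, and it
contains `𝓕 s` when `s ≤ τ`. -/
lemma MeasureTheory.Martingale.exists_ae_eq_condExp_stopped {D : ι → Ω → ℝ}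
    (hD : Martingale D 𝓕 P) {τ : Ω → ι} (hτ : ∀ t, MeasurableSet[𝓕 t] {ω | τ ω ≤ t})
    (hc : (range τ).Countable) :
    ∃ mτ ≤ m, (fun ω => D (τ ω) ω) =ᵐ[P] P[D ⊤|mτ] ∧ ∀ s, (∀ ω, s ≤ τ ω) → 𝓕 s ≤ mτ := by
  have : Nonempty ι := ⟨⊥⟩
  have hst : IsStoppingTime 𝓕 (fun ω => (τ ω : WithTop ι)) := by
    intro i
    simpa using hτ i
  refine ⟨hst.measurableSpace, hst.measurableSpace_le, ?_, fun s hs => ?_⟩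
  · have h := hD.stoppedValue_ae_eq_condExp_of_le_const_of_countable_range hst (n := ⊤)
      (fun ω => by simp) (by
        have : range (fun ω => (τ ω : WithTop ι)) = (fun t : ι => (t : WithTop ι)) '' range τ := by
          rw [← range_comp]
          rfl
        rw [this]
        exact hc.image _)
    exact h
  · exact hst.le_measurableSpace_of_const_le fun ω => by simpa using hs ω

/-- The stopped values are conditional expectations of the single variable `D ⊤`, hence uniformly
integrable. Pointwise convergence therefore becomes L¹ convergence, and the sampling identity passes
to the limit without treating the limit time as a stopping time. -/
lemma MeasureTheory.Martingale.setIntegral_limit_stopped {D : ι → Ω → ℝ}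
    (hD : Martingale D 𝓕 P) {τ : ℕ → Ω → ι} (hτ : ∀ n t, MeasurableSet[𝓕 t] {ω | τ n ω ≤ t})
    (hc : ∀ n, (range (τ n)).Countable) {s : ι} (hs : ∀ n ω, s ≤ τ n ω) {S : Ω → ℝ}
    (hS : ∀ ω, Tendsto (fun n => D (τ n ω) ω) atTop (𝓝 (S ω))) :
    Integrable S P ∧ ∀ F, MeasurableSet[𝓕 s] F → ∫ ω in F, S ω ∂P = ∫ ω in F, D s ω ∂P := by
  choose mτ hmτ hae hsm using fun n => hD.exists_ae_eq_condExp_stopped (hτ n) (hc n)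
  have hint : Integrable (D ⊤) P := hD.integrable ⊤
  have hUI := hint.uniformIntegrable_condExp hmτ
  have hlim : ∀ᵐ ω ∂P, Tendsto (fun n => (P[D ⊤|mτ n]) ω) atTop (𝓝 (S ω)) := by
    filter_upwards [ae_all_iff.2 hae] with ω hω
    exact (hS ω).congr hω
  have hSm : AEStronglyMeasurable S P :=
    aestronglyMeasurable_of_tendsto_ae atTop
      (fun n => stronglyMeasurable_condExp.aestronglyMeasurable.mono (hmτ n)) hlim
  have hSL : MemLp S 1 P := by
    obtain ⟨C, hC⟩ := hUI.2.2
    refine ⟨hSm, ?_⟩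
    refine lt_of_le_of_lt (Lp.eLpNorm_lim_le_liminf_eLpNorm
      (fun n => (hUI.1 n)) S hlim) ?_
    refine lt_of_le_of_lt (b := (C : ℝ≥0∞)) ?_ ENNReal.coe_lt_top
    exact liminf_le_of_le (by isBoundedDefault) fun b hb =>
      (hb.exists.choose_spec).trans (hC _)
  have hL1 : Tendsto (fun n => eLpNorm ((P[D ⊤|mτ n]) - S) 1 P) atTop (𝓝 0) :=
    tendsto_Lp_finite_of_tendsto_ae le_rfl (by simp) hUI.1 hSL hUI.2.1 hlim
  refine ⟨memLp_one_iff_integrable.1 hSL, fun F hF => ?_⟩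
  have h1 : Tendsto (fun n => ∫ ω in F, (P[D ⊤|mτ n]) ω ∂P) atTop (𝓝 (∫ ω in F, S ω ∂P)) := by
    refine tendsto_setIntegral_of_L1' S hSm
      (Eventually.of_forall fun n => integrable_condExp) ?_ F
    exact hL1
  have h2 : ∀ n, ∫ ω in F, (P[D ⊤|mτ n]) ω ∂P = ∫ ω in F, D s ω ∂P := by
    intro n
    rw [setIntegral_condExp (hmτ n) hint (hsm n s (hs n) F hF), hD.setIntegral_eq le_top hF]
  simp_rw [h2] at h1
  exact tendsto_nhds_unique h1 tendsto_const_nhds |>.symm ▸ rfl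

end OptionalSampling

/-! ### Hitting times of a level along the grid -/

section GridHitting

variable {Ω ι : Type*} {m : MeasurableSpace Ω} [LinearOrder ι] [OrderBot ι] [OrderTop ι]

/-- The first point of the `n`-th partition at which the process `v` is at least `K`. -/
noncomputable def gridHitting (g : RefiningGrid ι) (v : ι → Ω → ℝ) (K : ℝ) (n : ℕ) (ω : Ω) : ι := by
  classical
  exact g.pt n (Nat.find (p := fun i => i = 2 ^ n ∨ K ≤ v (g.pt n i) ω) ⟨2 ^ n, Or.inl rfl⟩)

variable (g : RefiningGrid ι) (v : ι → Ω → ℝ) (K : ℝ)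

lemma gridHitting_spec (n : ℕ) (ω : Ω) : ∃ j ≤ 2 ^ n, gridHitting g v K n ω = g.pt n j ∧
    (j = 2 ^ n ∨ K ≤ v (g.pt n j) ω) ∧ ∀ i < j, v (g.pt n i) ω < K := by
  classical
  have hex : ∃ i, i = 2 ^ n ∨ K ≤ v (g.pt n i) ω := ⟨2 ^ n, Or.inl rfl⟩
  refine ⟨Nat.find hex, Nat.find_min' hex (Or.inl rfl), ?_, Nat.find_spec hex, fun i hi => ?_⟩
  · unfold gridHitting
    congr!
  · have := Nat.find_min hex hi
    push Not at this
    exact this.2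

/-- Only grid points strictly before `t` are inspected. This strictness is the source of the
predictability of the stochastic interval up to the hitting time. -/
lemma le_gridHitting_iff (n : ℕ) (ω : Ω) (t : ι) : t ≤ gridHitting g v K n ω ↔
    ∀ i ≤ 2 ^ n, g.pt n i < t → v (g.pt n i) ω < K := by
  obtain ⟨j, hj, h1, h2, h3⟩ := gridHitting_spec g v K n ω
  rw [h1]
  constructor
  · intro h i hi hit
    exact h3 i ((g.lt_iff hi hj).1 (hit.trans_le h))
  · intro h
    by_contra! hc
    rcases h2 with rfl | h2
    · rw [g.last] at hc
      exact not_top_lt hc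
    · exact absurd (h j hj hc) (not_lt.2 h2)

/-- A finer partition inspects more points, so the level is met no later. -/
lemma gridHitting_succ_le (n : ℕ) (ω : Ω) :
    gridHitting g v K (n + 1) ω ≤ gridHitting g v K n ω := by
  by_contra! hc
  obtain ⟨j, hj, h1, h2, h3⟩ := gridHitting_spec g v K n ω
  rw [h1, ← g.refine] at hc
  have h4 := (le_gridHitting_iff g v K (n + 1) ω _).1 le_rfl (2 * j) (by rw [pow_succ]; omega) hc
  rcases h2 with rfl | h2
  · rw [g.refine, g.last] at hc
    exact not_top_lt hc
  · rw [g.refine] at h4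
    exact absurd h4 (not_lt.2 h2)

lemma antitone_gridHitting (ω : Ω) : Antitone fun n => gridHitting g v K n ω :=
  antitone_nat_of_succ_le fun n => gridHitting_succ_le g v K n ω

lemma countable_range_gridHitting (n : ℕ) : (range (gridHitting g v K n)).Countable := by
  refine g.countable_points.mono ?_
  rintro _ ⟨ω, rfl⟩
  obtain ⟨j, hj, h1, -⟩ := gridHitting_spec g v K n ω
  exact h1 ▸ g.pt_mem hj

variable {v} {𝓕 : Filtration ι m}

lemma measurableSet_gridHitting_le (hv : ∀ t, Measurable[𝓕 t] (v t)) (n : ℕ) (t : ι) :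
    MeasurableSet[𝓕 t] {ω | gridHitting g v K n ω ≤ t} := by
  by_cases ht : t = ⊤
  · simp [ht]
  -- The last index is left out: it stands for `⊤`, which is also the value when the level is never
  -- met, and `t < ⊤` here.
  have : {ω | gridHitting g v K n ω ≤ t} = ⋃ i ∈ Finset.range (2 ^ n),
      {ω | g.pt n i ≤ t ∧ K ≤ v (g.pt n i) ω} := by
    ext ω
    simp only [mem_ofPred_eq, Finset.mem_range, mem_iUnion, exists_prop]
    obtain ⟨j, hj, h1, h2, h3⟩ := gridHitting_spec g v K n ω
    constructor
    · intro h
      rw [h1] at h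
      have hj' : j ≠ 2 ^ n := by
        rintro rfl
        rw [g.last, top_le_iff] at h
        exact ht h
      exact ⟨j, lt_of_le_of_ne hj hj', h, h2.resolve_left hj'⟩
    · rintro ⟨i, hi, hit, hiK⟩
      refine le_trans ?_ hit
      by_contra! hc
      exact absurd ((le_gridHitting_iff g v K n ω _).1 le_rfl i hi.le hc) (not_lt.2 hiK)
  rw [this]
  refine Finset.measurableSet_biUnion _ fun i _ => ?_
  by_cases hi : g.pt n i ≤ t
  · simp only [hi, true_and]
    exact 𝓕.mono hi _ (measurableSet_le measurable_const (hv _))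
  · simp [hi]

/-- The complement is a finite union of rectangles `(q, ⊤] × {K ≤ v q}` over grid points `q`. -/
lemma measurableSet_predictable_le_gridHitting (hv : ∀ t, Measurable[𝓕 t] (v t)) (n : ℕ) :
    MeasurableSet[𝓕.predictable] {p : ι × Ω | p.1 ≤ gridHitting g v K n p.2} := by
  have : {p : ι × Ω | p.1 ≤ gridHitting g v K n p.2} = (⋃ i ∈ Finset.range (2 ^ n + 1),
      Ioi (g.pt n i) ×ˢ {ω | K ≤ v (g.pt n i) ω})ᶜ := by
    ext ⟨t, ω⟩
    simp only [mem_ofPred_eq, le_gridHitting_iff, mem_compl_iff, mem_iUnion, not_exists, mem_prod,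
      mem_Ioi, not_and, not_le, Finset.mem_range, Nat.lt_succ_iff]
  rw [this]
  refine (Finset.measurableSet_biUnion _ fun i _ => ?_).compl
  exact measurableSet_predictable_Ioi_prod (measurableSet_le measurable_const (hv _))

end GridHitting

/-! ### Predictable martingales of finite variation vanish -/

section PredictableUniqueness

variable {Ω ι : Type*} {m : MeasurableSpace Ω} {P : Measure Ω} [IsProbabilityMeasure P]
  [LinearOrder ι] [OrderBot ι] [OrderTop ι] [TopologicalSpace ι] [OrderTopology ι]
  [MeasurableSpace ι] [BorelSpace ι] [SecondCountableTopology ι] [DenselyOrdered ι]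
  [CompactIccSpace ι] {𝓕 : Filtration ι m}

lemma exists_isGLB_of_compactIcc {S : Set ι} (hS : S.Nonempty) : ∃ τ, IsGLB S τ := by
  have hc : IsCompact (closure S) := (isCompact_Icc (a := (⊥ : ι)) (b := ⊤)).of_isClosed_subset
    isClosed_closure (by simp)
  obtain ⟨τ, hτ⟩ := hc.exists_isLeast hS.closure
  refine ⟨τ, fun s hs => hτ.2 (subset_closure hs), fun b hb => ?_⟩
  exact closure_minimal (fun s hs => hb hs) isClosed_Ici hτ.1

/-- The set is `G = {t ≤ τ}`, where `τ` is the infimum over the partitions of the hitting times of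
`K` by `v`. Before `τ` the process `v` is at most `K`, and the jump bound gives `v τ ≤ 2K + |D τ|`,
which is integrable by optional sampling; so `a` and `b` have finite Doléans mass on `G`. On a
generator `(s, ⊤] × F` the two masses differ by the integral over `F` of `D (max τ s) - D s`, which
is `0`, again by optional sampling. -/
lemma exists_localizing_set (g : RefiningGrid ι) {D : ι → Ω → ℝ} (hD : Martingale D 𝓕 P)
    (hrc : ∀ ω t, ContinuousWithinAt (fun s => D s ω) (Ici t) t)
    {v a b : IncreasingProcess Ω ι}
    (hv : Measurable[𝓕.predictable] (Function.uncurry v.toFun))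
    (ha : Measurable[𝓕.predictable] (Function.uncurry a.toFun))
    (hb : Measurable[𝓕.predictable] (Function.uncurry b.toFun))
    (hab : ∀ t ω, a.toFun t ω - b.toFun t ω = D t ω)
    (hav : ∀ t ω, a.toFun t ω + b.toFun t ω = v.toFun t ω)
    (hjump : ∀ ω t K, 0 ≤ K → (∀ r < t, v.toFun r ω ≤ K) → v.toFun t ω ≤ 2 * K + |D t ω|)
    {K : ℝ} (hK : 0 ≤ K) :
    ∃ G, MeasurableSet[𝓕.predictable] G ∧ (∀ t ω, v.toFun t ω < K → (t, ω) ∈ G) ∧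
      a.doleans P G ≠ ∞ ∧ b.doleans P G ≠ ∞ ∧
      ∀ S, MeasurableSet[𝓕.predictable] S → a.doleans P (S ∩ G) = b.doleans P (S ∩ G) := by
  set σ : ℕ → Ω → ι := gridHitting g v.toFun K with hσ
  have hvad : ∀ t, Measurable[𝓕 t] (v.toFun t) := fun t => measurable_of_predictable hv t
  have hτex : ∀ ω, ∃ τ, IsGLB (range fun n => σ n ω) τ := fun ω =>
    exists_isGLB_of_compactIcc (range_nonempty _)
  choose τ hτ using hτex
  have hle : ∀ t ω, t ≤ τ ω ↔ ∀ n, t ≤ σ n ω := fun t ω => by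
    rw [le_isGLB_iff (hτ ω)]
    simp [lowerBounds]
  have hτm : Measurable τ := by
    refine measurable_of_Ici fun t => ?_
    have : τ ⁻¹' Ici t = ⋂ n, {ω | t ≤ σ n ω} := by
      ext ω
      simp [hle]
    rw [this]
    refine MeasurableSet.iInter fun n => ?_
    have hm := predictable_le_prod _ (measurableSet_predictable_le_gridHitting g K hvad n)
    exact measurable_prodMk_left (x := t) hm
  set G : Set (ι × Ω) := {p | p.1 ≤ τ p.2} with hG
  have hGm : MeasurableSet[𝓕.predictable] G := by
    have : G = ⋂ n, {p : ι × Ω | p.1 ≤ σ n p.2} := by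
      ext p
      simp [hG, hle]
    rw [this]
    exact MeasurableSet.iInter fun n => measurableSet_predictable_le_gridHitting g K hvad n
  have hlim : ∀ ω s, Tendsto (fun n => max (σ n ω) s) atTop (𝓝[≥] (max (τ ω) s)) := by
    intro ω s
    refine tendsto_nhdsWithin_iff.2 ⟨?_, Eventually.of_forall fun n => ?_⟩
    · exact (tendsto_atTop_isGLB (antitone_gridHitting g v.toFun K ω) (hτ ω)).max
        tendsto_const_nhds
    · exact max_le_max_right _ ((hle _ _).1 le_rfl n)
  have hsample : ∀ s, Integrable (fun ω => D (max (τ ω) s) ω) P ∧ ∀ F, MeasurableSet[𝓕 s] F →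
      ∫ ω in F, D (max (τ ω) s) ω ∂P = ∫ ω in F, D s ω ∂P := by
    intro s
    refine hD.setIntegral_limit_stopped (τ := fun n ω => max (σ n ω) s) ?_ ?_ ?_ ?_
    · intro n t
      by_cases hst : s ≤ t
      · simpa [hst] using measurableSet_gridHitting_le g K hvad n t
      · simp [hst]
    · intro n
      refine ((countable_range_gridHitting g v.toFun K n).image (fun t => max t s)).mono ?_
      rintro _ ⟨ω, rfl⟩
      exact ⟨_, ⟨ω, rfl⟩, rfl⟩
    · exact fun n ω => le_max_right _ _
    · exact fun ω => (hrc ω _).tendsto.comp (hlim ω s)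
  -- Any `r < τ` lies below a grid point that is still before `τ`, where `v` has not reached `K`.
  have hτbound : ∀ ω, v.toFun (τ ω) ω ≤ 2 * K + |D (τ ω) ω| := by
    refine fun ω => hjump ω _ K hK fun r hr => ?_
    obtain ⟨n, i, hi, h1, h2⟩ := g.dense r _ hr
    have h3 := (le_gridHitting_iff g v.toFun K n ω _).1 ((hle _ _).1 le_rfl n) i hi h2
    exact (v.mono ω h1.le).trans h3.le
  have hDτ : Integrable (fun ω => D (τ ω) ω) P := by simpa using (hsample ⊥).1
  have hAint : ∀ A : IncreasingProcess Ω ι, Measurable[𝓕.predictable] (Function.uncurry A.toFun) →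
      (∀ t ω, A.toFun t ω ≤ v.toFun t ω) → ∀ s,
      Integrable (fun ω => A.toFun (max (τ ω) s) ω - A.toFun s ω) P := by
    intro A hA hAv s
    have hAm : Measurable (Function.uncurry A.toFun) := hA.mono predictable_le_prod le_rfl
    refine Integrable.mono' ((integrable_const (2 * K)).add hDτ.abs) ?_
      (Eventually.of_forall fun ω => ?_)
    · refine Measurable.aestronglyMeasurable (Measurable.sub ?_ (A.measurable s))
      exact hAm.comp (f := fun ω => (max (τ ω) s, ω)) ((hτm.max measurable_const).prodMk
        measurable_id)
    · rw [Real.norm_of_nonneg (sub_nonneg.2 (A.mono ω (le_max_right _ _)))]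
      refine le_trans ?_ (hτbound ω)
      rcases le_total (τ ω) s with h | h
      · simpa [h] using v.nonneg _ _
      · have h1 := A.nonneg s ω
        have h2 := hAv (τ ω) ω
        rw [max_eq_left h]
        linarith
  have hrect : ∀ A : IncreasingProcess Ω ι, ∀ s F, MeasurableSet F →
      A.doleans P ((Ioi s ×ˢ F) ∩ G) =
        ∫⁻ ω in F, ENNReal.ofReal (A.toFun (max (τ ω) s) ω - A.toFun s ω) ∂P := by
    intro A s F hF
    rw [A.doleans_apply ((measurableSet_Ioi.prod hF).inter (predictable_le_prod _ hGm)),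
      ← lintegral_indicator hF]
    refine lintegral_congr fun ω => ?_
    by_cases hω : ω ∈ F
    · have : {t | (t, ω) ∈ Ioi s ×ˢ F ∩ G} = Ioc s (max (τ ω) s) := by
        ext t
        simp only [mem_ofPred_eq, mem_inter_iff, mem_prod, mem_Ioi, hω, and_true, hG, mem_Ioc,
          le_max_iff]
        constructor
        · exact fun h => ⟨h.1, Or.inl h.2⟩
        · rintro ⟨h1, h2 | h2⟩
          · exact ⟨h1, h2⟩
          · exact absurd h1 (not_lt.2 h2)
      rw [this, A.pathMeasure_Ioc, indicator_of_mem hω]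
    · simp [hω]
  have hav' : ∀ t ω, a.toFun t ω ≤ v.toFun t ω := fun t ω => by
    have := b.nonneg t ω
    have := hav t ω
    linarith
  have hbv' : ∀ t ω, b.toFun t ω ≤ v.toFun t ω := fun t ω => by
    have := a.nonneg t ω
    have := hav t ω
    linarith
  have heq : ∀ s F, MeasurableSet[𝓕 s] F →
      a.doleans P ((Ioi s ×ˢ F) ∩ G) = b.doleans P ((Ioi s ×ˢ F) ∩ G) := by
    intro s F hF
    have hF' := 𝓕.le _ _ hF
    have ia := hAint a ha hav' s
    have ib := hAint b hb hbv' s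
    rw [hrect a s F hF', hrect b s F hF',
      ← ofReal_integral_eq_lintegral_ofReal ia.restrict
        (Eventually.of_forall fun ω => sub_nonneg.2 (a.mono ω (le_max_right _ _))),
      ← ofReal_integral_eq_lintegral_ofReal ib.restrict
        (Eventually.of_forall fun ω => sub_nonneg.2 (b.mono ω (le_max_right _ _)))]
    congr 1
    rw [← sub_eq_zero, ← integral_sub ia.restrict ib.restrict]
    have : (fun ω => a.toFun (max (τ ω) s) ω - a.toFun s ω -
        (b.toFun (max (τ ω) s) ω - b.toFun s ω)) = fun ω => D (max (τ ω) s) ω - D s ω := by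
      ext ω
      rw [← hab, ← hab]
      ring
    rw [this, integral_sub (hsample s).1.restrict (hD.integrable s).restrict, (hsample s).2 F hF,
      sub_self]
  have hbot : ∀ A : IncreasingProcess Ω ι, ∀ S : Set Ω, A.doleans P (({⊥} ×ˢ S) ∩ G) = 0 := by
    intro A S
    refine measure_mono_null (t := {⊥} ×ˢ univ) (fun p hp => ⟨hp.1.1, mem_univ _⟩) ?_
    rw [A.doleans_apply ((measurableSet_singleton _).prod .univ)]
    simp [A.pathMeasure_bot]
  have hfin : ∀ A : IncreasingProcess Ω ι,
      Measurable[𝓕.predictable] (Function.uncurry A.toFun) →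
      (∀ t ω, A.toFun t ω ≤ v.toFun t ω) → A.doleans P ((Ioi ⊥ ×ˢ univ) ∩ G) ≠ ∞ := by
    intro A hA hAv
    rw [hrect A ⊥ univ .univ, ← ofReal_integral_eq_lintegral_ofReal (hAint A hA hAv ⊥).restrict
      (Eventually.of_forall fun ω => sub_nonneg.2 (A.mono ω (le_max_right _ _)))]
    exact ENNReal.ofReal_ne_top
  have hsplit : ∀ A : IncreasingProcess Ω ι,
      A.doleans P (univ ∩ G) = A.doleans P ((Ioi ⊥ ×ˢ univ) ∩ G) := by
    intro A
    apply le_antisymm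
    · have : univ ∩ G ⊆ (({⊥} ×ˢ univ) ∩ G) ∪ ((Ioi ⊥ ×ˢ univ) ∩ G) := by
        rintro ⟨t, ω⟩ ⟨-, h⟩
        by_cases ht : t = ⊥
        · exact Or.inl ⟨⟨ht, mem_univ _⟩, h⟩
        · exact Or.inr ⟨⟨bot_lt_iff_ne_bot.2 ht, mem_univ _⟩, h⟩
      refine (measure_mono this).trans ((measure_union_le _ _).trans ?_)
      rw [hbot, zero_add]
    · exact measure_mono (inter_subset_inter_left _ (subset_univ _))
  refine ⟨G, hGm, fun t ω h => ?_, ?_, ?_, ?_⟩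
  · rw [hG, mem_ofPred_eq, hle]
    intro n
    rw [hσ, le_gridHitting_iff]
    exact fun i hi hit => (v.mono ω hit.le).trans_lt h
  · rw [← univ_inter G, hsplit]
    exact hfin a ha hav'
  · rw [← univ_inter G, hsplit]
    exact hfin b hb hbv'
  -- The generators of the predictable σ-algebra form a π-system, and on `G` the measures are finite
  -- with equal total mass.
  · have key : ((a.doleans P).restrict G).trim (predictable_le_prod (𝓕 := 𝓕)) =
        ((b.doleans P).restrict G).trim (predictable_le_prod (𝓕 := 𝓕)) := by
      have hfa : IsFiniteMeasure ((a.doleans P).restrict G) := ⟨by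
        rw [Measure.restrict_apply .univ, hsplit]
        exact (hfin a ha hav').lt_top⟩
      refine @ext_of_generate_finite _ 𝓕.predictable _ _ _ rfl ?_ _ ?_ ?_
      · rintro _ (⟨A, hA, rfl⟩ | ⟨s, A, hA, rfl⟩) _ (⟨B, hB, rfl⟩ | ⟨t, B, hB, rfl⟩) hne
        · exact Or.inl ⟨A ∩ B, hA.inter hB, by rw [prod_inter_prod, inter_self]⟩
        · obtain ⟨p, hp⟩ := hne
          simp only [mem_inter_iff, mem_prod, mem_singleton_iff, mem_Ioi] at hp
          exact absurd hp.2.1 (by rw [hp.1.1]; exact not_lt_bot)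
        · obtain ⟨p, hp⟩ := hne
          simp only [mem_inter_iff, mem_prod, mem_singleton_iff, mem_Ioi] at hp
          exact absurd hp.1.1 (by rw [hp.2.1]; exact not_lt_bot)
        · refine Or.inr ⟨max s t, A ∩ B, ?_, by rw [prod_inter_prod, Ioi_inter_Ioi]⟩
          exact (𝓕.mono (le_max_left _ _) _ hA).inter (𝓕.mono (le_max_right _ _) _ hB)
      · rintro _ (⟨A, hA, rfl⟩ | ⟨s, A, hA, rfl⟩)
        · have h1 := measurableSet_predictable_singleton_bot_prod hA
          rw [trim_measurableSet_eq _ h1, trim_measurableSet_eq _ h1,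
            Measure.restrict_apply (predictable_le_prod _ h1),
            Measure.restrict_apply (predictable_le_prod _ h1), hbot, hbot]
        · have h1 := measurableSet_predictable_Ioi_prod hA
          rw [trim_measurableSet_eq _ h1, trim_measurableSet_eq _ h1,
            Measure.restrict_apply (predictable_le_prod _ h1),
            Measure.restrict_apply (predictable_le_prod _ h1), heq s A hA]
      · rw [trim_measurableSet_eq _ MeasurableSet.univ, trim_measurableSet_eq _ MeasurableSet.univ,
          Measure.restrict_apply .univ, Measure.restrict_apply .univ, hsplit, hsplit,
          heq ⊥ univ MeasurableSet.univ]
    intro S hS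
    have h2 := congrArg (fun μ => μ S) key
    rwa [trim_measurableSet_eq _ hS, trim_measurableSet_eq _ hS,
      Measure.restrict_apply (predictable_le_prod _ hS),
      Measure.restrict_apply (predictable_le_prod _ hS)] at h2

/-- Integration by parts: Fubini on the two halves of the square, the diagonal being counted in the
`Iic` term only. This asymmetry is why both values and left limits of the processes must be
predictable. -/
lemma lintegral_Iic_add_lintegral_Iio (α β : Measure ι) [IsFiniteMeasure α] [IsFiniteMeasure β] :
    ∫⁻ t, α (Iic t) ∂β + ∫⁻ t, β (Iio t) ∂α = α univ * β univ := by
  have hm : MeasurableSet {p : ι × ι | p.1 ≤ p.2} := measurableSet_le measurable_fst measurable_snd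
  have h := measure_add_measure_compl (μ := α.prod β) hm
  rw [← univ_prod_univ, Measure.prod_prod] at h
  rw [← h, Measure.prod_apply_symm hm, Measure.prod_apply hm.compl]
  congr 1
  · refine lintegral_congr fun s => ?_
    congr 1
    ext t
    simp

end PredictableUniqueness

section PredictableUniqueness

variable {Ω ι : Type*} {m : MeasurableSpace Ω} {P : Measure Ω} [IsProbabilityMeasure P]
  [LinearOrder ι] [OrderBot ι] [OrderTop ι] [TopologicalSpace ι] [OrderTopology ι]
  [MeasurableSpace ι] [BorelSpace ι] [SecondCountableTopology ι] [DenselyOrdered ι]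
  [CompactIccSpace ι] {𝓕 : Filtration ι m}

lemma IncreasingProcess.setLIntegral_pathMeasure_measurable (A : IncreasingProcess Ω ι)
    {f : ι × Ω → ℝ≥0∞} (hf : Measurable f) {S : Set (ι × Ω)} (hS : MeasurableSet S) :
    Measurable fun ω => ∫⁻ t in {t | (t, ω) ∈ S}, f (t, ω) ∂A.pathMeasure ω := by
  convert A.measurable_lintegral_pathMeasure (hf.indicator hS) using 2 with ω
  exact (lintegral_indicator (measurable_prodMk_right hS) _).symm

lemma IncreasingProcess.setLIntegral_doleans (A : IncreasingProcess Ω ι)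
    {f : ι × Ω → ℝ≥0∞} (hf : Measurable f) {S : Set (ι × Ω)} (hS : MeasurableSet S) :
    ∫⁻ p in S, f p ∂A.doleans P = ∫⁻ ω, ∫⁻ t in {t | (t, ω) ∈ S}, f (t, ω) ∂A.pathMeasure ω ∂P := by
  rw [← lintegral_indicator hS, A.lintegral_doleans (hf.indicator hS)]
  refine lintegral_congr fun ω => ?_
  exact lintegral_indicator (measurable_prodMk_right hS) _

lemma lintegral_add_add_add {f₁ f₂ f₃ f₄ : Ω → ℝ≥0∞} (h₁ : Measurable f₁) (h₂ : Measurable f₂)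
    (h₃ : Measurable f₃) : ∫⁻ ω, (f₁ ω + f₂ ω + (f₃ ω + f₄ ω)) ∂P =
      ∫⁻ ω, f₁ ω ∂P + ∫⁻ ω, f₂ ω ∂P + (∫⁻ ω, f₃ ω ∂P + ∫⁻ ω, f₄ ω ∂P) := by
  rw [lintegral_add_left (show Measurable fun ω => f₁ ω + f₂ ω from h₁.add h₂), lintegral_add_left h₁, lintegral_add_left h₃]

lemma setLIntegral_doleans_eq {a b : IncreasingProcess Ω ι} {G G' : Set (ι × Ω)}
    (hG' : MeasurableSet[𝓕.predictable] G') (hsub : G' ⊆ G)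
    (hS : ∀ S, MeasurableSet[𝓕.predictable] S → a.doleans P (S ∩ G) = b.doleans P (S ∩ G))
    {f : ι × Ω → ℝ≥0∞} (hf : Measurable[𝓕.predictable] f) :
    ∫⁻ p in G', f p ∂a.doleans P = ∫⁻ p in G', f p ∂b.doleans P := by
  have hle := predictable_le_prod (𝓕 := 𝓕)
  rw [← lintegral_trim hle hf, ← lintegral_trim hle hf]
  congr 1
  refine @Measure.ext _ 𝓕.predictable _ _ fun S hSm => ?_
  rw [trim_measurableSet_eq _ hSm, trim_measurableSet_eq _ hSm,
    Measure.restrict_apply (hle _ hSm), Measure.restrict_apply (hle _ hSm)]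
  have := hS (S ∩ G') (hSm.inter hG')
  rwa [inter_assoc, inter_eq_left.2 hsub] at this

/-- A predictable martingale with right-continuous paths of bounded variation, null at the initial
time, vanishes almost surely. -/
theorem predictable_martingale_eq_zero_of_forall (g : RefiningGrid ι) {D : ι → Ω → ℝ}
    (hD : Martingale D 𝓕 P) (hDm : Measurable[𝓕.predictable] (Function.uncurry D))
    (hrc : ∀ ω t, ContinuousWithinAt (fun s => D s ω) (Ici t) t)
    (hbv : ∀ ω, BoundedVariationOn (fun s => D s ω) univ) (hbot : ∀ ω, D ⊥ ω = 0) (t : ι) :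
    D t =ᵐ[P] 0 := by
  obtain ⟨v, a, b, hv, ha, hb, hab, hav, hjump⟩ :=
    exists_increasing_decomposition g hDm hrc hbv hbot
  have hmain : ∀ K : ℕ, ∀ᵐ ω ∂P, v.toFun ⊤ ω < K → D ⊤ ω = 0 := by
    intro K
    obtain ⟨G, hG, hGsub, hGa, hGb, hS⟩ := exists_localizing_set (P := P) g hD hrc hv ha hb hab hav hjump
      (K := K) (Nat.cast_nonneg K)
    -- On this smaller predictable set the integrands `a` and `b` are bounded by `K`, which keeps
    -- the second moments below finite.
    set G' : Set (ι × Ω) := {p | v.toFun p.1 p.2 < K} with hG'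
    have hG'm : MeasurableSet[𝓕.predictable] G' := hv measurableSet_Iio
    have hG'M := predictable_le_prod _ hG'm
    have hsub : G' ⊆ G := fun p hp => hGsub p.1 p.2 hp
    let μ : IncreasingProcess Ω ι → Ω → Measure ι := fun A ω =>
      (A.pathMeasure ω).restrict {t | v.toFun t ω < K}
    have hset : ∀ ω, MeasurableSet {t | v.toFun t ω < K} := fun ω => measurable_prodMk_right hG'M
    have hIic : ∀ (A B : IncreasingProcess Ω ι) ω,
        ∫⁻ t, μ A ω (Iic t) ∂μ B ω =
          ∫⁻ t in {t | v.toFun t ω < K}, ENNReal.ofReal (A.toFun t ω) ∂B.pathMeasure ω := by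
      intro A B ω
      refine setLIntegral_congr_fun (hset ω) fun t ht => ?_
      -- Since `v` increases, `{v < K}` is an initial segment of the path. Restricting to it
      -- therefore does not change the mass of `Iic t` when `t` lies in it.
      have hst : Iic t ⊆ {t | v.toFun t ω < K} := fun s hs => lt_of_le_of_lt (v.mono ω hs) ht
      exact (Measure.restrict_eq_self _ hst).trans (A.pathMeasure_Iic ω t)
    have hIio : ∀ (A B : IncreasingProcess Ω ι) ω,
        ∫⁻ t, μ A ω (Iio t) ∂μ B ω = ∫⁻ t in {t | v.toFun t ω < K},
          ENNReal.ofReal (Function.leftLim (fun s => A.toFun s ω) t) ∂B.pathMeasure ω := by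
      intro A B ω
      refine setLIntegral_congr_fun (hset ω) fun t ht => ?_
      have hst : Iio t ⊆ {t | v.toFun t ω < K} := fun s hs =>
        lt_of_le_of_lt (v.mono ω (le_of_lt hs)) ht
      exact (Measure.restrict_eq_self _ hst).trans (A.pathMeasure_Iio ω t)
    have hleft : ∀ A : IncreasingProcess Ω ι,
        Measurable[𝓕.predictable] (Function.uncurry A.toFun) → Measurable[𝓕.predictable]
          fun p : ι × Ω => ENNReal.ofReal (Function.leftLim (fun s => A.toFun s p.2) p.1) := by
      intro A hA
      refine Measurable.ennreal_ofReal ?_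
      refine measurable_predictable_leftLim g (f := A.toFun)
        (L := fun t ω => Function.leftLim (fun s => A.toFun s ω) t)
        (fun t => measurable_of_predictable hA t) ?_ ?_
      · ext ω
        rw [A.leftLim_bot, A.bot]
      · exact fun t ω _ => (A.mono ω).tendsto_leftLim t
    have hmI : ∀ A B : IncreasingProcess Ω ι,
        Measurable[𝓕.predictable] (Function.uncurry A.toFun) →
        Measurable fun ω => ∫⁻ t, μ A ω (Iic t) ∂μ B ω := by
      intro A B hA
      simp_rw [hIic]
      exact B.setLIntegral_pathMeasure_measurable
        (f := fun p => ENNReal.ofReal (A.toFun p.1 p.2))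
        (hA.mono predictable_le_prod le_rfl).ennreal_ofReal hG'M
    have hmJ : ∀ A B : IncreasingProcess Ω ι,
        Measurable[𝓕.predictable] (Function.uncurry A.toFun) →
        Measurable fun ω => ∫⁻ t, μ A ω (Iio t) ∂μ B ω := by
      intro A B hA
      simp_rw [hIio]
      exact B.setLIntegral_pathMeasure_measurable
        (f := fun p => ENNReal.ofReal (Function.leftLim (fun s => A.toFun s p.2) p.1))
        ((hleft A hA).mono predictable_le_prod le_rfl) hG'M
    have hI : ∀ A : IncreasingProcess Ω ι,
        Measurable[𝓕.predictable] (Function.uncurry A.toFun) →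
        ∫⁻ ω, ∫⁻ t, μ A ω (Iic t) ∂μ a ω ∂P = ∫⁻ ω, ∫⁻ t, μ A ω (Iic t) ∂μ b ω ∂P := by
      intro A hA
      have h1 : Measurable[𝓕.predictable] fun p : ι × Ω => ENNReal.ofReal (A.toFun p.1 p.2) :=
        hA.ennreal_ofReal
      have h2 := setLIntegral_doleans_eq hG'm hsub hS h1
      rw [a.setLIntegral_doleans (h1.mono predictable_le_prod le_rfl) hG'M,
        b.setLIntegral_doleans (h1.mono predictable_le_prod le_rfl) hG'M] at h2
      simp_rw [hIic]
      exact h2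
    have hJ : ∀ A : IncreasingProcess Ω ι,
        Measurable[𝓕.predictable] (Function.uncurry A.toFun) →
        ∫⁻ ω, ∫⁻ t, μ A ω (Iio t) ∂μ a ω ∂P = ∫⁻ ω, ∫⁻ t, μ A ω (Iio t) ∂μ b ω ∂P := by
      intro A hA
      have h1 := hleft A hA
      have h2 := setLIntegral_doleans_eq hG'm hsub hS h1
      rw [a.setLIntegral_doleans (h1.mono predictable_le_prod le_rfl) hG'M,
        b.setLIntegral_doleans (h1.mono predictable_le_prod le_rfl) hG'M] at h2
      simp_rw [hIio]
      exact h2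
    set x : Ω → ℝ≥0∞ := fun ω => μ a ω univ with hx
    set y : Ω → ℝ≥0∞ := fun ω => μ b ω univ with hy
    have hpp : ∀ (A B : IncreasingProcess Ω ι) ω, μ A ω univ * μ B ω univ =
        ∫⁻ t, μ A ω (Iic t) ∂μ B ω + ∫⁻ t, μ B ω (Iio t) ∂μ A ω := fun A B ω =>
      (lintegral_Iic_add_lintegral_Iio _ _).symm
    have hIfin : ∀ A : IncreasingProcess Ω ι, (∀ t ω, A.toFun t ω ≤ v.toFun t ω) →
        A.doleans P G ≠ ∞ → ∫⁻ ω, ∫⁻ t, μ A ω (Iic t) ∂μ A ω ∂P ≠ ∞ := by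
      intro A hA hAG
      have h1 : ∫⁻ ω, ∫⁻ t, μ A ω (Iic t) ∂μ A ω ∂P ≤
          ∫⁻ ω, ∫⁻ t in {t | (t, ω) ∈ G'}, (K : ℝ≥0∞) ∂A.pathMeasure ω ∂P := by
        refine lintegral_mono fun ω => ?_
        rw [hIic]
        refine setLIntegral_mono' (hset ω) fun t ht => ?_
        refine ENNReal.ofReal_le_of_le_toReal ?_
        simpa using (hA t ω).trans (le_of_lt ht)
      rw [← A.setLIntegral_doleans (f := fun _ => (K : ℝ≥0∞)) measurable_const hG'M,
        setLIntegral_const] at h1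
      refine ne_top_of_le_ne_top (ENNReal.mul_ne_top (by simp) ?_) h1
      exact ne_top_of_le_ne_top hAG (measure_mono hsub)
    have hJI : ∀ A ω, ∫⁻ t, μ A ω (Iio t) ∂μ A ω ≤ ∫⁻ t, μ A ω (Iic t) ∂μ A ω := fun A ω =>
      lintegral_mono fun t => measure_mono Iio_subset_Iic_self
    -- Each of the four products splits by integration by parts into integrals of predictable
    -- integrands. Against such integrands `da` and `db` are interchangeable in expectation, so the
    -- terms of `x² + y²` match those of `2xy`.
    have hsum : ∫⁻ ω, (x ω * x ω + y ω * y ω) ∂P = ∫⁻ ω, (x ω * y ω + y ω * x ω) ∂P := by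
      simp only [hx, hy, hpp]
      rw [lintegral_add_add_add (hmI a a ha) (hmJ a a ha) (hmI b b hb),
        lintegral_add_add_add (hmI a b ha) (hmJ b a hb) (hmI b a hb),
        hI a ha, hJ a ha, hI b hb, hJ b hb]
      abel
    have hav' : ∀ t ω, a.toFun t ω ≤ v.toFun t ω := fun t ω => by
      have := b.nonneg t ω
      have := hav t ω
      linarith
    have hbv' : ∀ t ω, b.toFun t ω ≤ v.toFun t ω := fun t ω => by
      have := a.nonneg t ω
      have := hav t ω
      linarith
    have hfin : ∀ A : IncreasingProcess Ω ι,
        Measurable[𝓕.predictable] (Function.uncurry A.toFun) →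
        (∀ t ω, A.toFun t ω ≤ v.toFun t ω) → A.doleans P G ≠ ∞ →
        ∫⁻ ω, μ A ω univ * μ A ω univ ∂P ≠ ∞ := by
      intro A hA hAv hAG
      simp only [hpp]
      rw [lintegral_add_left (hmI A A hA)]
      have h1 := hIfin A hAv hAG
      exact ENNReal.add_ne_top.2 ⟨h1, ne_top_of_le_ne_top h1 (lintegral_mono (hJI A))⟩
    have hmuniv : ∀ A : IncreasingProcess Ω ι, Measurable fun ω => μ A ω univ := by
      intro A
      have := A.setLIntegral_pathMeasure_measurable (f := fun _ => 1) measurable_const hG'M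
      convert this using 2 with ω
      rw [setLIntegral_one]
      exact Measure.restrict_apply_univ _
    have hxt : ∀ ω, x ω ≠ ∞ := fun ω => measure_ne_top ((a.pathMeasure ω).restrict _) _
    have hyt : ∀ ω, y ω ≠ ∞ := fun ω => measure_ne_top ((b.pathMeasure ω).restrict _) _
    have hle : ∀ ω, x ω * y ω + y ω * x ω ≤ x ω * x ω + y ω * y ω := by
      intro ω
      lift x ω to ℝ≥0 using hxt ω with p
      lift y ω to ℝ≥0 using hyt ω with q
      norm_cast
      rw [← NNReal.coe_le_coe]
      push_cast
      nlinarith [sq_nonneg ((p : ℝ) - q)]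
    -- The pointwise inequality `2xy ≤ x² + y²` with equal finite integrals is almost surely an
    -- equality, so `x = y`.
    have hae : (fun ω => x ω * y ω + y ω * x ω) =ᵐ[P] fun ω => x ω * x ω + y ω * y ω := by
      refine ae_eq_of_ae_le_of_lintegral_le (Eventually.of_forall hle) ?_ ?_ hsum.le
      · rw [← hsum, lintegral_add_left (show Measurable fun ω => x ω * x ω from
          (hmuniv a).mul (hmuniv a))]
        exact ENNReal.add_ne_top.2 ⟨hfin a ha hav' hGa, hfin b hb hbv' hGb⟩
      · exact (((hmuniv a).mul (hmuniv a)).add ((hmuniv b).mul (hmuniv b))).aemeasurable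
    filter_upwards [hae] with ω hω hvK
    have hall : {t | v.toFun t ω < K} = univ :=
      eq_univ_of_forall fun t => lt_of_le_of_lt (v.mono ω le_top) hvK
    have h1 : x ω = ENNReal.ofReal (a.toFun ⊤ ω) := by
      change (a.pathMeasure ω).restrict _ univ = _
      rw [hall, Measure.restrict_univ, a.pathMeasure_univ]
    have h2 : y ω = ENNReal.ofReal (b.toFun ⊤ ω) := by
      change (b.pathMeasure ω).restrict _ univ = _
      rw [hall, Measure.restrict_univ, b.pathMeasure_univ]
    have ha0 := a.nonneg ⊤ ω
    have hb0 := b.nonneg ⊤ ω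
    simp only [h1, h2] at hω
    rw [← ENNReal.ofReal_mul ha0, ← ENNReal.ofReal_mul hb0, ← ENNReal.ofReal_mul ha0,
      ← ENNReal.ofReal_mul hb0, ← ENNReal.ofReal_add (by positivity) (by positivity),
      ← ENNReal.ofReal_add (by positivity) (by positivity),
      ENNReal.ofReal_eq_ofReal_iff (by positivity) (by positivity)] at hω
    rw [← hab]
    have : (a.toFun ⊤ ω - b.toFun ⊤ ω) ^ 2 = 0 := by linarith
    exact pow_eq_zero_iff two_ne_zero |>.1 this
  have htop : D ⊤ =ᵐ[P] 0 := by
    filter_upwards [ae_all_iff.2 hmain] with ω hω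
    obtain ⟨K, hK⟩ := exists_nat_gt (v.toFun ⊤ ω)
    exact hω K hK
  have h1 := hD.condExp_ae_eq (le_top (a := t))
  refine h1.symm.trans ((condExp_congr_ae htop).trans ?_)
  rw [condExp_zero]

end PredictableUniqueness

/-! ### Modification on null sets under the usual conditions -/

section UsualConditions

variable {Ω ι : Type*} {m : MeasurableSpace Ω} {P : Measure Ω}
  [LinearOrder ι] [OrderBot ι] {𝓕 : Filtration ι m}

lemma UsualConditions.measurableSet_of_null (h : UsualConditions 𝓕 P) {N : Set Ω} (hN : P N = 0)
    (t : ι) : MeasurableSet[𝓕 t] N := 𝓕.mono bot_le _ (h.null_mem N hN)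

lemma UsualConditions.measurable_of_ae_eq (h : UsualConditions 𝓕 P) {E : Type*}
    [MeasurableSpace E] {t : ι} {f f' : Ω → E} (hf : Measurable[𝓕 t] f) (hff' : f =ᵐ[P] f') :
    Measurable[𝓕 t] f' := by
  intro B hB
  set N : Set Ω := {ω | ¬ f ω = f' ω} with hN
  have hN0 : P N = 0 := hff'
  have hsub : f' ⁻¹' B = (f ⁻¹' B ∩ Nᶜ) ∪ (f' ⁻¹' B ∩ N) := by
    ext ω
    by_cases hω : f ω = f' ω
    · simp [hN, hω]
    · simp [hN, hω]
  rw [hsub]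
  refine ((hf hB).inter (h.measurableSet_of_null hN0 t).compl).union ?_
  exact h.measurableSet_of_null (measure_mono_null inter_subset_right hN0) t

lemma measurable_predictable_indicator {E : Type*} [MeasurableSpace E] [Zero E] {f : ι → Ω → E}
    (hf : Measurable[𝓕.predictable] (Function.uncurry f)) {N : Set Ω} (hN : MeasurableSet[𝓕 ⊥] N) :
    Measurable[𝓕.predictable] (Function.uncurry fun t => N.indicator (f t)) := by
  have : (Function.uncurry fun t => N.indicator (f t)) =
      ((univ : Set ι) ×ˢ N).indicator (Function.uncurry f) := by
    ext ⟨t, ω⟩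
    by_cases h : ω ∈ N <;> simp [h]
  rw [this]
  exact hf.indicator (measurableSet_predictable_univ_prod hN)

lemma MeasureTheory.Martingale.congr_ae {E : Type*} [NormedAddCommGroup E] [NormedSpace ℝ E]
    [CompleteSpace E] {f f' : ι → Ω → E} (hf : Martingale f 𝓕 P) (hff' : ∀ t, f t =ᵐ[P] f' t)
    (hf' : ∀ t, StronglyMeasurable[𝓕 t] (f' t)) : Martingale f' 𝓕 P :=
  ⟨hf', fun s t hst => (condExp_congr_ae (hff' t).symm).trans ((hf.2 s t hst).trans (hff' s))⟩

end UsualConditions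

/-! ### Uniqueness of the predictable covariation -/

section Uniqueness

variable {Ω ι H : Type*} {m : MeasurableSpace Ω} {P : Measure Ω} [IsProbabilityMeasure P]
  [LinearOrder ι] [OrderBot ι] [OrderTop ι] [TopologicalSpace ι] [OrderTopology ι]
  [MeasurableSpace ι] [BorelSpace ι] [SecondCountableTopology ι] [DenselyOrdered ι]
  [CompactIccSpace ι] {𝓕 : Filtration ι m}

omit [SecondCountableTopology ι] [DenselyOrdered ι] [CompactIccSpace ι] in
lemma RefiningGrid.eq_of_eqOn_points {E : Type*} [TopologicalSpace E] [T2Space E]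
    (g : RefiningGrid ι) {f f' : ι → E} (hf : ∀ t, ContinuousWithinAt f (Ici t) t)
    (hf' : ∀ t, ContinuousWithinAt f' (Ici t) t) (h : ∀ q ∈ g.points, f q = f' q) (t : ι) :
    f t = f' t := by
  have hmem : ∀ n, g.above n t ∈ g.points := by
    intro n
    obtain ⟨φ, -, h1, h2⟩ := g.exists_above_index n
    exact h2 t ▸ g.pt_mem (h1 t)
  have h1 := (hf t).tendsto.comp (g.tendsto_above t)
  have h2 := (hf' t).tendsto.comp (g.tendsto_above t)
  refine tendsto_nhds_unique h1 (h2.congr fun n => ?_)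
  exact (h _ (hmem n)).symm

/-- A predictable martingale whose paths are almost surely right-continuous and of finite
variation, null at the initial time, vanishes almost surely. -/
theorem predictable_martingale_eq_zero (g : RefiningGrid ι) (h𝓕 : UsualConditions 𝓕 P)
    {D : ι → Ω → ℝ} (hD : Martingale D 𝓕 P) (hDp : IsStronglyPredictable 𝓕 D)
    (hrc : ∀ᵐ ω ∂P, ∀ t, ContinuousWithinAt (fun s => D s ω) (Ici t) t)
    (hbv : ∀ᵐ ω ∂P, LocallyBoundedVariationOn (fun s => D s ω) univ)
    (hbot : ∀ᵐ ω ∂P, D ⊥ ω = 0) (t : ι) : D t =ᵐ[P] 0 := by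
  -- Paths outside `N` are replaced by `0`. The complement of `N` is null, so `N` belongs to `𝓕 ⊥`,
  -- and predictability, adaptedness and the martingale property all survive.
  set N : Set Ω := {ω | (∀ t, ContinuousWithinAt (fun s => D s ω) (Ici t) t) ∧
    LocallyBoundedVariationOn (fun s => D s ω) univ ∧ D ⊥ ω = 0} with hN
  have hNae : ∀ᵐ ω ∂P, ω ∈ N := by
    filter_upwards [hrc, hbv, hbot] with ω h1 h2 h3 using ⟨h1, h2, h3⟩
  have hN0 : P Nᶜ = 0 := hNae
  have hNm : ∀ t, MeasurableSet[𝓕 t] N := fun t =>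
    compl_compl N ▸ (h𝓕.measurableSet_of_null hN0 t).compl
  have hae : ∀ t, D t =ᵐ[P] N.indicator (D t) := fun t => by
    filter_upwards [hNae] with ω hω using (indicator_of_mem hω _).symm
  have hDm : Measurable[𝓕.predictable] (Function.uncurry D) := hDp.measurable
  have hD'm := measurable_predictable_indicator hDm (hNm ⊥)
  have hD' : Martingale (fun t => N.indicator (D t)) 𝓕 P :=
    hD.congr_ae hae fun t => (hD.1 t).indicator (hNm t)
  have key : ∀ ω, (ω ∈ N ∧ (fun s => N.indicator (D s) ω) = fun s => D s ω) ∨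
      (fun s => N.indicator (D s) ω) = fun _ => 0 := by
    intro ω
    by_cases hω : ω ∈ N
    · left
      refine ⟨hω, ?_⟩
      ext s
      exact indicator_of_mem hω _
    · right
      ext s
      exact indicator_of_notMem hω _
  refine (hae t).trans (predictable_martingale_eq_zero_of_forall g hD' hD'm ?_ ?_ ?_ t)
  · intro ω t
    rcases key ω with ⟨hω, h⟩ | h
    · rw [h]
      exact hω.1 t
    · rw [h]
      exact continuousWithinAt_const
  · intro ω
    rcases key ω with ⟨hω, h⟩ | h
    · rw [h]
      have := hω.2.1 ⊥ ⊤ (mem_univ _) (mem_univ _)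
      rwa [univ_inter, Icc_bot, Iic_top] at this
    · rw [h]
      have : eVariationOn (fun _ : ι => (0 : ℝ)) univ = 0 :=
        eVariationOn.constant_on (by
          rintro _ ⟨x, -, rfl⟩ _ ⟨y, -, rfl⟩
          rfl)
      rw [BoundedVariationOn, this]
      exact ENNReal.zero_ne_top
  · intro ω
    rcases key ω with ⟨hω, h⟩ | h
    · exact (congrFun h ⊥).trans hω.2.2
    · exact congrFun h ⊥

omit [OrderBot ι] [OrderTop ι] [TopologicalSpace ι] [OrderTopology ι] [MeasurableSpace ι]
  [BorelSpace ι] [SecondCountableTopology ι] [DenselyOrdered ι] [CompactIccSpace ι] in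
lemma LocallyBoundedVariationOn.sub_real {f f' : ι → ℝ} {s : Set ι}
    (hf : LocallyBoundedVariationOn f s) (hf' : LocallyBoundedVariationOn f' s) :
    LocallyBoundedVariationOn (fun t => f t - f' t) s := by
  intro a b ha hb
  have : eVariationOn (fun t => f t - f' t) (s ∩ Icc a b) ≤
      eVariationOn f (s ∩ Icc a b) + eVariationOn f' (s ∩ Icc a b) := by
    refine iSup_le fun ⟨n, u, hu, hus⟩ => ?_
    refine le_trans (Finset.sum_le_sum fun i _ => ?_) ((Finset.sum_add_distrib).le.trans
      (add_le_add (eVariationOn.sum_le hu hus) (eVariationOn.sum_le hu hus)))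
    refine (edist_triangle _ (f (u i) - f' (u (i + 1))) _).trans_eq ?_
    rw [edist_sub_right, edist_sub_left]
  exact ne_top_of_le_ne_top (ENNReal.add_ne_top.2 ⟨hf a b ha hb, hf' a b ha hb⟩) this

variable [NormedAddCommGroup H] [InnerProductSpace ℝ H] [CompleteSpace H]

/-- Only the process of inner products enters: `V - V'` is the difference of two martingales, and it
is predictable, of finite variation and null at the start. -/
theorem IsPredictableCovariation.ae_eq (g : RefiningGrid ι) (h𝓕 : UsualConditions 𝓕 P)
    {Y Z Y' Z' : ι → Ω → H} {V V' : ι → Ω → ℝ} (hV : IsPredictableCovariation 𝓕 P Y Z V)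
    (hV' : IsPredictableCovariation 𝓕 P Y' Z' V')
    (hYZ : ∀ t ω, (inner ℝ (Y t ω) (Z t ω) : ℝ) = inner ℝ (Y' t ω) (Z' t ω)) (t : ι) :
    V t =ᵐ[P] V' t := by
  have h := predictable_martingale_eq_zero g h𝓕 (D := fun t ω => V t ω - V' t ω) ?_ ?_ ?_ ?_ ?_ t
  · filter_upwards [h] with ω hω using sub_eq_zero.1 hω
  · convert hV'.martingale.sub hV.martingale using 1
    ext t ω
    simp only [Pi.sub_apply, hYZ]
    ring
  · exact hV.predictable.sub hV'.predictable
  · filter_upwards [hV.rightCont, hV'.rightCont] with ω h1 h2 t using (h1 t).sub (h2 t)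
  · filter_upwards [hV.finiteVariation, hV'.finiteVariation] with ω h1 h2
    exact h1.sub_real h2
  · filter_upwards [hV.initial, hV'.initial] with ω h1 h2
    rw [h1, h2, sub_zero]

end Uniqueness

/-! ### Square integrable Hilbert space valued martingales -/

section SquareIntegrable

variable {Ω ι H : Type*} {m : MeasurableSpace Ω} {P : Measure Ω} [IsProbabilityMeasure P]
  [LinearOrder ι] [OrderBot ι] {𝓕 : Filtration ι m}
  [NormedAddCommGroup H] [InnerProductSpace ℝ H] [CompleteSpace H]

omit [CompleteSpace H] [IsProbabilityMeasure P] in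
lemma MeasureTheory.MemLp.integrable_inner_real {f f' : Ω → H} (hf : MemLp f 2 P)
    (hf' : MemLp f' 2 P) :
    Integrable (fun ω => (inner ℝ (f ω) (f' ω) : ℝ)) P := by
  have h : Integrable (fun ω => ‖f ω‖ * ‖f' ω‖) P := hf.norm.integrable_mul hf'.norm
  refine h.mono' (hf.1.inner hf'.1) (Eventually.of_forall fun ω => ?_)
  exact norm_inner_le_norm _ _

omit [CompleteSpace H] [IsProbabilityMeasure P] in
lemma MeasureTheory.MemLp.integrable_sq_norm {f : Ω → H} (hf : MemLp f 2 P) :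
    Integrable (fun ω => ‖f ω‖ ^ 2) P := by
  simpa using hf.integrable_norm_pow (by norm_num)

omit [IsProbabilityMeasure P] in
lemma condExp_inner_left [IsFiniteMeasure P] {m' : MeasurableSpace Ω} {f Z : Ω → H}
    (hfm : StronglyMeasurable[m'] f) (hf : MemLp f 2 P) (hZ : MemLp Z 2 P) :
    P[fun ω => (inner ℝ (f ω) (Z ω) : ℝ)|m'] =ᵐ[P] fun ω => inner ℝ (f ω) ((P[Z|m']) ω) :=
  condExp_bilin_of_stronglyMeasurable_left (innerSL ℝ) hfm (hf.integrable_inner_real hZ)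
    (hZ.integrable (by norm_num))

lemma setIntegral_inner_martingale {Y Z : ι → Ω → H} (hY : StronglyAdapted 𝓕 Y)
    (hY2 : ∀ t, MemLp (Y t) 2 P) (hZ : Martingale Z 𝓕 P) (hZ2 : ∀ t, MemLp (Z t) 2 P) {s t : ι}
    (hst : s ≤ t) {F : Set Ω} (hF : MeasurableSet[𝓕 s] F) :
    ∫ ω in F, (inner ℝ (Y s ω) (Z t ω) : ℝ) ∂P = ∫ ω in F, inner ℝ (Y s ω) (Z s ω) ∂P := by
  rw [← setIntegral_condExp (𝓕.le s) ((hY2 s).integrable_inner_real (hZ2 t)) hF]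
  refine setIntegral_congr_ae (𝓕.le _ _ hF) ?_
  filter_upwards [condExp_inner_left (hY s) (hY2 s) (hZ2 t), hZ.2 s t hst] with ω h1 h2 _
  rw [h1, h2]

/-- Pythagoras: the increment after `s` is orthogonal to `Y s`, also on every event of `𝓕 s`. -/
lemma setIntegral_sq_norm_martingale {Y : ι → Ω → H} (hY : Martingale Y 𝓕 P)
    (hY2 : ∀ t, MemLp (Y t) 2 P) {s t : ι} (hst : s ≤ t) {F : Set Ω} (hF : MeasurableSet[𝓕 s] F) :
    ∫ ω in F, ‖Y t ω‖ ^ 2 ∂P =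
      ∫ ω in F, ‖Y s ω‖ ^ 2 ∂P + ∫ ω in F, ‖Y t ω - Y s ω‖ ^ 2 ∂P := by
  have h1 := setIntegral_inner_martingale hY.1 hY2 hY hY2 hst hF
  have i1 := ((hY2 s).integrable_inner_real (hY2 t)).restrict (s := F)
  have i2 := ((hY2 s).integrable_inner_real (hY2 s)).restrict (s := F)
  have i3 := ((hY2 t).sub (hY2 s)).integrable_sq_norm.restrict (s := F)
  have i4 := (hY2 s).integrable_sq_norm.restrict (s := F)
  have : ∀ ω, ‖Y t ω‖ ^ 2 = ‖Y s ω‖ ^ 2 + ‖Y t ω - Y s ω‖ ^ 2 +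
      2 * (inner ℝ (Y s ω) (Y t ω) - inner ℝ (Y s ω) (Y s ω)) := by
    intro ω
    rw [norm_sub_sq_real, real_inner_self_eq_norm_sq, real_inner_comm]
    ring
  simp_rw [this]
  have i5 : Integrable (fun ω => ‖Y s ω‖ ^ 2 + ‖Y t ω - Y s ω‖ ^ 2) (P.restrict F) := i4.add i3
  have i6 : Integrable (fun ω => (2 : ℝ) * (inner ℝ (Y s ω) (Y t ω) - inner ℝ (Y s ω) (Y s ω)))
    (P.restrict F) := (i1.sub i2).const_mul 2
  have i7 : Integrable (fun ω => ‖Y t ω - Y s ω‖ ^ 2) (P.restrict F) := i3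
  rw [integral_add i5 i6, integral_add i4 i7, integral_const_mul,
    integral_sub i1 i2, h1, sub_self, mul_zero, add_zero]

lemma integral_sq_norm_martingale {Y : ι → Ω → H} (hY : Martingale Y 𝓕 P)
    (hY2 : ∀ t, MemLp (Y t) 2 P) {s t : ι} (hst : s ≤ t) :
    ∫ ω, ‖Y t ω‖ ^ 2 ∂P = ∫ ω, ‖Y s ω‖ ^ 2 ∂P + ∫ ω, ‖Y t ω - Y s ω‖ ^ 2 ∂P := by
  simpa using setIntegral_sq_norm_martingale hY hY2 hst (MeasurableSet.univ)

lemma submartingale_sq_norm {Y : ι → Ω → H} (hY : Martingale Y 𝓕 P)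
    (hY2 : ∀ t, MemLp (Y t) 2 P) : Submartingale (fun t ω => ‖Y t ω‖ ^ 2) 𝓕 P := by
  refine submartingale_of_setIntegral_le (fun t => (hY.1 t).norm.pow 2)
    (fun t => (hY2 t).integrable_sq_norm) fun s t hst F hF => ?_
  rw [setIntegral_sq_norm_martingale hY hY2 hst hF]
  exact le_add_of_nonneg_right (integral_nonneg fun ω => by positivity)

lemma memLp_of_martingale [OrderTop ι] {Y : ι → Ω → H} (hY : Martingale Y 𝓕 P)
    (h : MemLp (Y ⊤) 2 P) (t : ι) : MemLp (Y t) 2 P :=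
  (h.condExp (m := 𝓕 t) (by norm_num)).ae_eq (hY.2 t ⊤ le_top)

lemma sq_norm_toLp {f : Ω → H} (hf : MemLp f 2 P) : ‖hf.toLp f‖ ^ 2 = ∫ ω, ‖f ω‖ ^ 2 ∂P := by
  rw [← real_inner_self_eq_norm_sq, L2.inner_def]
  refine integral_congr_ae ?_
  filter_upwards [hf.coeFn_toLp] with ω hω
  rw [hω, real_inner_self_eq_norm_sq]

/-- Right-continuity of the filtration. At a maximal time there are no later σ-algebras to
intersect, so that case is excluded. -/
lemma UsualConditions.measurable_of_forall_gt [TopologicalSpace ι] [OrderTopology ι]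
    [DenselyOrdered ι] {E : Type*} [MeasurableSpace E] (h𝓕 : UsualConditions 𝓕 P) {t : ι}
    (ht : ¬ IsMax t) {q : ℕ → ι} (hq : Tendsto q atTop (𝓝 t)) {f : Ω → E}
    (hf : ∀ n, Measurable[𝓕 (q n)] f) : Measurable[𝓕 t] f := by
  intro B hB
  have := h𝓕.rightCont
  refine Filtration.IsRightContinuous.measurableSet ?_
  rw [Filtration.rightCont_eq_of_not_isMax _ ht, MeasurableSpace.measurableSet_iInf]
  intro j
  rw [MeasurableSpace.measurableSet_iInf]
  intro hj
  obtain ⟨n, hn⟩ := (hq.eventually_lt_const hj).exists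
  exact 𝓕.mono hn.le _ (hf n hB)

/-- The exceptional null set belongs to `𝓕 t`, so the functions can be made constant on it and the
limit becomes pointwise. -/
lemma UsualConditions.measurable_of_tendsto_ae {E : Type*} [TopologicalSpace E]
    [TopologicalSpace.PseudoMetrizableSpace E] [MeasurableSpace E] [BorelSpace E] [Nonempty E]
    (h𝓕 : UsualConditions 𝓕 P) {t : ι} {f : ℕ → Ω → E} {z : Ω → E}
    (hf : ∀ n, Measurable[𝓕 t] (f n)) (hz : ∀ᵐ ω ∂P, Tendsto (fun n => f n ω) atTop (𝓝 (z ω))) :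
    Measurable[𝓕 t] z := by
  classical
  obtain ⟨x⟩ := ‹Nonempty E›
  set N := {ω | ¬ Tendsto (fun n => f n ω) atTop (𝓝 (z ω))} with hN
  have hNm : MeasurableSet[𝓕 t] N := h𝓕.measurableSet_of_null hz t
  have h1 : Measurable[𝓕 t] (N.piecewise (fun _ => x) z) := by
    refine @measurable_of_tendsto_metrizable _ _ (𝓕 t) _ _ _ _
      (fun n => N.piecewise (fun _ => x) (f n)) _
      (fun n => ?_) ?_
    · have := hf n
      generalize 𝓕 t = m' at this hNm
      exact Measurable.piecewise hNm measurable_const this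
    · rw [tendsto_pi_nhds]
      intro ω
      by_cases h : ω ∈ N
      · simpa [h] using tendsto_const_nhds
      · simpa [h] using not_not.1 h
  refine h𝓕.measurable_of_ae_eq h1 ?_
  filter_upwards [hz] with ω hω
  have : ω ∉ N := not_not.2 hω
  simp [this]

/-- The second moment of a square integrable martingale is right-continuous along decreasing
sequences, for a filtration satisfying the usual conditions. -/
lemma tendsto_integral_sq_norm [TopologicalSpace ι] [OrderTopology ι] [DenselyOrdered ι]
    [TopologicalSpace.SeparableSpace H] (h𝓕 : UsualConditions 𝓕 P) {Y : ι → Ω → H}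
    (hY : Martingale Y 𝓕 P) (hY2 : ∀ t, MemLp (Y t) 2 P) {t : ι} {q : ℕ → ι}
    (hqa : StrictAnti q) (hqt : ∀ n, t < q n) (hq : Tendsto q atTop (𝓝 t)) :
    Tendsto (fun n => ∫ ω, ‖Y (q n) ω‖ ^ 2 ∂P) atTop (𝓝 (∫ ω, ‖Y t ω‖ ^ 2 ∂P)) := by
  have ht : ¬ IsMax t := fun h => (h.isTop (q 0)).not_gt (hqt 0)
  set e : ℕ → ℝ := fun n => ∫ ω, ‖Y (q n) ω‖ ^ 2 ∂P with he
  have heanti : Antitone e := by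
    intro n k hnk
    have := integral_sq_norm_martingale hY hY2 (hqa.antitone hnk)
    simp only [he]
    rw [this]
    exact le_add_of_nonneg_right (integral_nonneg fun ω => by positivity)
  have hebdd : BddBelow (range e) := by
    refine ⟨0, ?_⟩
    rintro _ ⟨n, rfl⟩
    exact integral_nonneg fun ω => by positivity
  have hec : CauchySeq e := (tendsto_atTop_ciInf heanti hebdd).cauchySeq
  set y : ℕ → Lp H 2 P := fun n => (hY2 (q n)).toLp (Y (q n)) with hy
  -- By Pythagoras the distances are differences of the decreasing second moments, so the sequence
  -- is Cauchy in L² although no path regularity is available.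
  have hdist : ∀ n k, n ≤ k → ‖y n - y k‖ ^ 2 = e n - e k := by
    intro n k hnk
    simp only [hy, he]
    rw [← MemLp.toLp_sub, sq_norm_toLp,
      integral_sq_norm_martingale hY hY2 (hqa.antitone hnk)]
    simp
  have hyc : CauchySeq y := by
    rw [Metric.cauchySeq_iff'] at hec ⊢
    intro ε hε
    obtain ⟨N, hN⟩ := hec (ε ^ 2) (by positivity)
    refine ⟨N, fun n hn => ?_⟩
    have h1 := hdist N n hn
    have h2 := hN n hn
    rw [Real.dist_eq, abs_sub_comm] at h2
    rw [dist_comm, dist_eq_norm]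
    refine lt_of_pow_lt_pow_left₀ 2 hε.le ?_
    rw [h1]
    exact (le_abs_self _).trans_lt h2
  obtain ⟨z, hz⟩ := cauchySeq_tendsto_of_complete hyc
  have hL2 : Tendsto (fun n => eLpNorm (Y (q n) - (z : Ω → H)) 2 P) atTop (𝓝 0) := by
    have := (Lp.tendsto_Lp_iff_tendsto_eLpNorm' y z).1 hz
    refine this.congr fun n => eLpNorm_congr_ae ?_
    filter_upwards [(hY2 (q n)).coeFn_toLp] with ω hω
    simp [hy, hω]
  have hzm : MemLp (z : Ω → H) 2 P := Lp.memLp z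
  let _ : MeasurableSpace H := borel H
  have : BorelSpace H := ⟨rfl⟩
  have : SecondCountableTopology H := UniformSpace.secondCountable_of_separable H
  -- For each `j` a tail of an almost surely convergent subsequence is `𝓕 (q j)`-measurable, so `z`
  -- is measurable for every `𝓕 (q j)`, hence for `𝓕 t`.
  have hzmeas : Measurable[𝓕 t] (z : Ω → H) := by
    refine h𝓕.measurable_of_forall_gt ht hq fun j => ?_
    obtain ⟨ns, hns, hlim⟩ := (tendstoInMeasure_of_tendsto_eLpNorm (by norm_num)
      (fun n => (hY2 (q n)).1) hzm.1 hL2).exists_seq_tendsto_ae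
    refine h𝓕.measurable_of_tendsto_ae (f := fun k => Y (q (ns (k + j)))) (fun k => ?_) ?_
    · have h1 : j ≤ ns (k + j) := (Nat.le_add_left j k).trans (hns.id_le (k + j))
      exact ((hY.1 _).mono (𝓕.mono (hqa.antitone h1))).measurable
    · filter_upwards [hlim] with ω hω
      exact hω.comp (tendsto_add_atTop_nat j)
  -- Since `z` is `𝓕 t`-measurable, `Y t - z` is the conditional expectation of `Y (q n) - z`.
  -- Contractivity then forces `Y t = z`.
  have hL1 : ∀ n, eLpNorm (Y t - (z : Ω → H)) 1 P ≤ eLpNorm (Y (q n) - (z : Ω → H)) 2 P := by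
    intro n
    have h1 : P[Y (q n) - (z : Ω → H)|𝓕 t] =ᵐ[P] Y t - (z : Ω → H) := by
      refine (condExp_sub ((hY2 _).integrable (by norm_num)) (hzm.integrable (by norm_num)) _).trans
        ?_
      have h2 : P[(z : Ω → H)|𝓕 t] = z := condExp_of_stronglyMeasurable (𝓕.le t)
        hzmeas.stronglyMeasurable (hzm.integrable (by norm_num))
      rw [h2]
      exact (hY.2 t (q n) (hqt n).le).sub (ae_eq_refl _)
    rw [← eLpNorm_congr_ae h1]
    have h3 := eLpNorm_condExp_le_eLpNorm (m := 𝓕 t) (μ := P) (Y (q n) - (z : Ω → H))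
      (le_refl (1 : ℝ≥0∞))
    refine h3.trans ?_
    exact eLpNorm_le_eLpNorm_of_exponent_le (by norm_num) ((hY2 _).1.sub hzm.1)
  have hzero : eLpNorm (Y t - (z : Ω → H)) 1 P = 0 :=
    le_antisymm (ge_of_tendsto' hL2 hL1) bot_le
  have hYz : Y t =ᵐ[P] z := by
    rw [eLpNorm_eq_zero_iff ((hY2 t).1.sub hzm.1) (by norm_num)] at hzero
    filter_upwards [hzero] with ω hω
    exact sub_eq_zero.1 hω
  have h1 : Tendsto (fun n => ‖y n‖ ^ 2) atTop (𝓝 (‖z‖ ^ 2)) := (hz.norm).pow 2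
  have h2 : ‖z‖ ^ 2 = ∫ ω, ‖Y t ω‖ ^ 2 ∂P := by
    rw [← sq_norm_toLp (hY2 t)]
    congr 2
    exact (Lp.ext (((hY2 t).coeFn_toLp).trans hYz)).symm
  rw [← h2]
  refine h1.congr fun n => ?_
  simp only [hy, he]
  exact sq_norm_toLp _

end SquareIntegrable

lemma RefiningGrid.exists_strictAnti_tendsto {ι : Type*} [LinearOrder ι] [OrderBot ι] [OrderTop ι]
    [TopologicalSpace ι] [OrderTopology ι] [DenselyOrdered ι] [FirstCountableTopology ι]
    (g : RefiningGrid ι) {t : ι} (ht : t < ⊤) :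
    ∃ q : ℕ → ι, StrictAnti q ∧ (∀ n, q n ∈ g.points) ∧ (∀ n, t < q n) ∧
      Tendsto q atTop (𝓝 t) := by
  obtain ⟨u, hu, hut, hlim⟩ := exists_seq_strictAnti_tendsto' ht
  choose q hq1 hq2 hq3 using fun n => g.exists_between (hu (Nat.lt_succ_self n))
  refine ⟨q, strictAnti_nat_of_succ_lt fun n => (hq3 (n + 1)).trans (hq2 n), hq1, fun n =>
    ((hut (n + 1)).1).trans (hq2 n), ?_⟩
  refine tendsto_of_tendsto_of_tendsto_of_le_of_le (hlim.comp (tendsto_add_atTop_nat 1)) hlim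
    (fun n => (hq2 n).le) fun n => (hq3 n).le

/-! ### Discrete compensators and their L² bound -/

section ConditionalProducts

variable {Ω : Type*} {m' m : MeasurableSpace Ω} {P : Measure Ω} [IsProbabilityMeasure P]

lemma condExp_ae_eq_of_setIntegral_eq (hm : m' ≤ m) {f f' : Ω → ℝ} (hf : Integrable f P)
    (hf' : Integrable f' P)
    (h : ∀ F, MeasurableSet[m'] F → ∫ ω in F, f ω ∂P = ∫ ω in F, f' ω ∂P) :
    P[f|m'] =ᵐ[P] P[f'|m'] := by
  refine ae_eq_condExp_of_forall_setIntegral_eq hm hf' (fun _ _ _ => integrable_condExp.integrableOn)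
    (fun F hF _ => ?_) stronglyMeasurable_condExp.aestronglyMeasurable
  rw [setIntegral_condExp hm hf hF, h F hF]

lemma integral_mul_eq_of_setIntegral_eq (hm : m' ≤ m) {f f' Z : Ω → ℝ} (hf : Integrable f P)
    (hf' : Integrable f' P)
    (h : ∀ F, MeasurableSet[m'] F → ∫ ω in F, f ω ∂P = ∫ ω in F, f' ω ∂P)
    (hZ : StronglyMeasurable[m'] Z) (hZf : Integrable (Z * f) P) (hZf' : Integrable (Z * f') P) :
    ∫ ω, Z ω * f ω ∂P = ∫ ω, Z ω * f' ω ∂P := by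
  have h1 := condExp_mul_of_stronglyMeasurable_left hZ hZf hf
  have h2 := condExp_mul_of_stronglyMeasurable_left hZ hZf' hf'
  have h3 := condExp_ae_eq_of_setIntegral_eq hm hf hf' h
  have e1 : ∫ ω, (Z * f) ω ∂P = ∫ ω, (P[Z * f|m']) ω ∂P := (integral_condExp hm).symm
  have e2 : ∫ ω, (Z * f') ω ∂P = ∫ ω, (P[Z * f'|m']) ω ∂P := (integral_condExp hm).symm
  simp only [Pi.mul_apply] at e1 e2
  rw [e1, e2]
  refine integral_congr_ae ?_
  filter_upwards [h1, h2, h3] with ω a b c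
  rw [a, b, Pi.mul_apply, Pi.mul_apply, c]

end ConditionalProducts

/-- The right side is twice the sum of `B i * B j` over `i ≤ j`, which exceeds the square of the sum
by the sum of the `B i ^ 2`. -/
lemma sq_sum_le_two_mul_sum (B : ℕ → ℝ) (N : ℕ) :
    (∑ i ∈ Finset.range N, B i) ^ 2 ≤
      2 * ∑ i ∈ Finset.range N, B i * (∑ j ∈ Finset.range N, B j - ∑ j ∈ Finset.range i, B j) := by
  induction N with
  | zero => simp
  | succ N ih =>
    have h : ∀ i, B i * (∑ j ∈ Finset.range (N + 1), B j - ∑ j ∈ Finset.range i, B j) =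
        B i * (∑ j ∈ Finset.range N, B j - ∑ j ∈ Finset.range i, B j) + B i * B N := by
      intro i
      rw [Finset.sum_range_succ]
      ring
    rw [Finset.sum_range_succ (fun i => B i * _), Finset.sum_congr rfl fun i _ => h i,
      Finset.sum_add_distrib, ← Finset.sum_mul]
    rw [Finset.sum_range_succ]
    nlinarith [sq_nonneg (B N)]

section GridCompensator

variable {Ω ι : Type*} {m : MeasurableSpace Ω} [LinearOrder ι] [OrderBot ι] [OrderTop ι]

/-- The increments of the discrete compensator of `X` along a grid. -/
noncomputable def gridIncrement (g : RefiningGrid ι) (𝓕 : Filtration ι m) (P : Measure Ω)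
    (X : ι → Ω → ℝ) (n i : ℕ) (ω : Ω) : ℝ :=
  -- For a submartingale this conditional expectation is nonnegative only almost surely. The maximum
  -- makes every path of the compensator increasing.
  max ((P[X (g.pt n (i + 1)) - X (g.pt n i)|𝓕 (g.pt n i)]) ω) 0

/-- The discrete compensator of `X` along a grid, as a left-continuous step process. -/
noncomputable def gridCompensator (g : RefiningGrid ι) (𝓕 : Filtration ι m) (P : Measure Ω)
    (X : ι → Ω → ℝ) (n : ℕ) (t : ι) (ω : Ω) : ℝ :=
  ∑ i ∈ Finset.range (2 ^ n), (Ioi (g.pt n i)).indicator (fun _ => gridIncrement g 𝓕 P X n i ω) t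

variable {g : RefiningGrid ι} {𝓕 : Filtration ι m} {P : Measure Ω} {X : ι → Ω → ℝ} {c : ℝ}

lemma gridIncrement_nonneg (n i : ℕ) (ω : Ω) : 0 ≤ gridIncrement g 𝓕 P X n i ω := le_max_right _ _

lemma stronglyMeasurable_gridIncrement (n i : ℕ) :
    StronglyMeasurable[𝓕 (g.pt n i)] (gridIncrement g 𝓕 P X n i) := by
  have h := stronglyMeasurable_condExp (m := 𝓕 (g.pt n i)) (μ := P)
    (f := X (g.pt n (i + 1)) - X (g.pt n i))
  exact (h.measurable.max measurable_const).stronglyMeasurable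

lemma gridCompensator_bot (n : ℕ) (ω : Ω) : gridCompensator g 𝓕 P X n ⊥ ω = 0 := by
  simp [gridCompensator]

lemma monotone_gridCompensator (n : ℕ) (ω : Ω) :
    Monotone fun t => gridCompensator g 𝓕 P X n t ω := by
  intro s t hst
  refine Finset.sum_le_sum fun i _ => ?_
  by_cases h : g.pt n i < s
  · simp [h, h.trans_le hst]
  · rw [indicator_of_notMem (by simpa using h)]
    exact indicator_nonneg (fun _ _ => gridIncrement_nonneg _ _ _) _

lemma gridCompensator_pt {n j : ℕ} (hj : j ≤ 2 ^ n) (ω : Ω) :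
    gridCompensator g 𝓕 P X n (g.pt n j) ω =
      ∑ i ∈ Finset.range j, gridIncrement g 𝓕 P X n i ω := by
  rw [gridCompensator, ← Finset.sum_subset (Finset.range_mono hj)]
  · refine Finset.sum_congr rfl fun i hi => ?_
    have hi' := Finset.mem_range.1 hi
    rw [indicator_of_mem]
    exact (g.lt_iff (hi'.le.trans hj) hj).2 hi'
  · intro i hi hij
    rw [indicator_of_notMem]
    rw [mem_Ioi, g.lt_iff (Finset.mem_range.1 hi).le hj]
    simpa using hij

lemma gridCompensator_top (n : ℕ) (ω : Ω) :
    gridCompensator g 𝓕 P X n ⊤ ω =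
      ∑ i ∈ Finset.range (2 ^ n), gridIncrement g 𝓕 P X n i ω := by
  rw [← g.last n, gridCompensator_pt le_rfl]

lemma measurable_finset_sum_aux {α : Type*} {mα : MeasurableSpace α} (s : Finset ℕ)
    {f : ℕ → α → ℝ} (hf : ∀ i ∈ s, Measurable (f i)) : Measurable fun a => ∑ i ∈ s, f i a :=
  Finset.measurable_sum s hf

lemma measurable_predictable_gridCompensator (n : ℕ) :
    Measurable[𝓕.predictable] (Function.uncurry (gridCompensator g 𝓕 P X n)) := by
  refine measurable_finset_sum_aux (mα := 𝓕.predictable) (Finset.range (2 ^ n))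
    (f := fun i p => (Ioi (g.pt n i)).indicator (fun _ => gridIncrement g 𝓕 P X n i p.2) p.1)
    fun i _ => ?_
  exact measurable_predictable_indicator_Ioi (stronglyMeasurable_gridIncrement n i).measurable

variable [IsProbabilityMeasure P]

lemma gridIncrement_ae_eq (hX : Submartingale X 𝓕 P) {n i : ℕ} (hi : i < 2 ^ n) :
    gridIncrement g 𝓕 P X n i =ᵐ[P]
      P[X (g.pt n (i + 1)) - X (g.pt n i)|𝓕 (g.pt n i)] := by
  have h := hX.condExp_sub_nonneg (g.mono (Nat.le_succ i) hi)
  filter_upwards [h] with ω hω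
  exact max_eq_left hω

lemma gridIncrement_le (hX : Submartingale X 𝓕 P) (hXc : ∀ t, ∀ᵐ ω ∂P, X t ω ∈ Icc 0 c)
    {n i : ℕ} (hi : i < 2 ^ n) : ∀ᵐ ω ∂P, gridIncrement g 𝓕 P X n i ω ≤ c := by
  have h1 : P[X (g.pt n (i + 1)) - X (g.pt n i)|𝓕 (g.pt n i)] ≤ᵐ[P]
      P[fun _ => c|𝓕 (g.pt n i)] := by
    refine condExp_mono ((hX.integrable _).sub (hX.integrable _)) (integrable_const _) ?_
    filter_upwards [hXc (g.pt n (i + 1)), hXc (g.pt n i)] with ω a b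
    simp only [Pi.sub_apply]
    linarith [a.2, b.1]
  rw [condExp_const (𝓕.le _)] at h1
  filter_upwards [h1, gridIncrement_ae_eq hX hi] with ω a b
  rw [b]
  exact a

lemma memLp_top_gridIncrement (hX : Submartingale X 𝓕 P)
    (hXc : ∀ t, ∀ᵐ ω ∂P, X t ω ∈ Icc 0 c) {n i : ℕ} (hi : i < 2 ^ n) :
    MemLp (gridIncrement g 𝓕 P X n i) ∞ P := by
  refine memLp_top_of_bound
    ((stronglyMeasurable_gridIncrement n i).mono (𝓕.le _)).aestronglyMeasurable c ?_
  filter_upwards [gridIncrement_le (g := g) hX hXc hi] with ω hω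
  rwa [Real.norm_of_nonneg (gridIncrement_nonneg _ _ _)]

lemma integrable_gridIncrement (hX : Submartingale X 𝓕 P)
    {n i : ℕ} (hi : i < 2 ^ n) :
    Integrable (gridIncrement g 𝓕 P X n i) P :=
  (integrable_congr (gridIncrement_ae_eq hX hi)).2 integrable_condExp

lemma setIntegral_gridIncrement (hX : Submartingale X 𝓕 P)
    {n i : ℕ} (hi : i < 2 ^ n) {F : Set Ω} (hF : MeasurableSet[𝓕 (g.pt n i)] F) :
    ∫ ω in F, gridIncrement g 𝓕 P X n i ω ∂P =
      ∫ ω in F, (X (g.pt n (i + 1)) ω - X (g.pt n i) ω) ∂P := by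
  have h := setIntegral_condExp (𝓕.le (g.pt n i))
    ((hX.integrable (g.pt n (i + 1))).sub (hX.integrable (g.pt n i))) hF
  simp only [Pi.sub_apply] at h
  rw [← h]
  exact integral_congr_ae (ae_restrict_of_ae (gridIncrement_ae_eq hX hi))

/-- The one-step identities telescope over the cells after `pt n j`, because `F` remains an event of
each later σ-algebra. -/
lemma setIntegral_gridCompensator (hX : Submartingale X 𝓕 P)
    {n j : ℕ} (hj : j ≤ 2 ^ n) {F : Set Ω} (hF : MeasurableSet[𝓕 (g.pt n j)] F) :
    ∫ ω in F, (gridCompensator g 𝓕 P X n ⊤ ω - gridCompensator g 𝓕 P X n (g.pt n j) ω) ∂P =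
      ∫ ω in F, (X ⊤ ω - X (g.pt n j) ω) ∂P := by
  have h1 : ∀ ω, gridCompensator g 𝓕 P X n ⊤ ω - gridCompensator g 𝓕 P X n (g.pt n j) ω =
      ∑ i ∈ Finset.Ico j (2 ^ n), gridIncrement g 𝓕 P X n i ω := by
    intro ω
    rw [gridCompensator_top, gridCompensator_pt hj, Finset.sum_Ico_eq_sub _ hj]
  have h2 : ∀ ω, X ⊤ ω - X (g.pt n j) ω =
      ∑ i ∈ Finset.Ico j (2 ^ n), (X (g.pt n (i + 1)) ω - X (g.pt n i) ω) := by
    intro ω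
    rw [Finset.sum_Ico_sub (fun i => X (g.pt n i) ω) hj, g.last]
  simp_rw [h1, h2]
  rw [integral_finsetSum, integral_finsetSum]
  · refine Finset.sum_congr rfl fun i hi => ?_
    rw [Finset.mem_Ico] at hi
    exact setIntegral_gridIncrement hX hi.2 (𝓕.mono (g.mono hi.1 hi.2.le) _ hF)
  · exact fun i _ => ((hX.integrable _).sub (hX.integrable _)).restrict
  · exact fun i hi => (integrable_gridIncrement hX (Finset.mem_Ico.1 hi).2).restrict

lemma memLp_gridCompensator (hX : Submartingale X 𝓕 P)
    (hXc : ∀ t, ∀ᵐ ω ∂P, X t ω ∈ Icc 0 c) (n : ℕ) (t : ι) :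
    MemLp (gridCompensator g 𝓕 P X n t) ∞ P := by
  refine memLp_finsetSum _ fun i hi => ?_
  by_cases h : t ∈ Ioi (g.pt n i)
  · simpa [h] using memLp_top_gridIncrement hX hXc (Finset.mem_range.1 hi)
  · simp only [indicator_of_notMem h]
    exact MemLp.zero'

/-- Expand `A ⊤ ^ 2` by `sq_sum_le_two_mul_sum`. In expectation the remaining increment `A ⊤ - A (pt
n i)` may be replaced by that of `X`, which is at most `c`, and the increments `B i` have total mean
at most `c`. The bound does not depend on the partition. -/
lemma integral_sq_gridCompensator_le (hX : Submartingale X 𝓕 P)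
    (hXc : ∀ t, ∀ᵐ ω ∂P, X t ω ∈ Icc 0 c) (n : ℕ) :
    ∫ ω, gridCompensator g 𝓕 P X n ⊤ ω ^ 2 ∂P ≤ 2 * c ^ 2 := by
  set A := gridCompensator g 𝓕 P X n with hA
  set B := gridIncrement g 𝓕 P X n with hB
  have hBm : ∀ i, i < 2 ^ n → MemLp (B i) ∞ P := fun i hi => memLp_top_gridIncrement hX hXc hi
  have hAm : ∀ t, MemLp (A t) ∞ P := fun t => memLp_gridCompensator hX hXc n t
  have hXm : ∀ t, MemLp (X t) ∞ P := fun t => by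
    refine memLp_top_of_bound (hX.integrable t).1 c ?_
    filter_upwards [hXc t] with ω hω
    rw [Real.norm_of_nonneg hω.1]
    exact hω.2
  have hmul : ∀ {f f' : Ω → ℝ}, MemLp f ∞ P → MemLp f' ∞ P → Integrable (f * f') P :=
    fun h h' => (h'.mul h (r := ∞)).integrable le_top
  have hprod : ∀ i, i < 2 ^ n → Integrable (fun ω => B i ω * (A ⊤ ω - A (g.pt n i) ω)) P :=
    fun i hi => hmul (hBm i hi) ((hAm _).sub (hAm _))
  have hstep : ∀ i, i < 2 ^ n →
      ∫ ω, B i ω * (A ⊤ ω - A (g.pt n i) ω) ∂P ≤ c * ∫ ω, B i ω ∂P := by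
    intro i hi
    have h1 : ∫ ω, B i ω * (A ⊤ ω - A (g.pt n i) ω) ∂P =
        ∫ ω, B i ω * (X ⊤ ω - X (g.pt n i) ω) ∂P :=
      integral_mul_eq_of_setIntegral_eq (Z := B i) (f := A ⊤ - A (g.pt n i))
        (f' := X ⊤ - X (g.pt n i)) (𝓕.le (g.pt n i))
        (((hAm ⊤).sub (hAm _)).integrable le_top) (((hXm ⊤).sub (hXm _)).integrable le_top)
        (fun F hF => setIntegral_gridCompensator hX hi.le hF)
        (stronglyMeasurable_gridIncrement n i) (hmul (hBm i hi) ((hAm _).sub (hAm _)))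
        (hmul (hBm i hi) ((hXm _).sub (hXm _)))
    rw [h1, ← integral_const_mul]
    refine integral_mono_ae (hmul (hBm i hi) ((hXm _).sub (hXm _)))
      (((hBm i hi).integrable le_top).const_mul c) ?_
    filter_upwards [hXc ⊤, hXc (g.pt n i)] with ω a b
    have := gridIncrement_nonneg (g := g) (𝓕 := 𝓕) (P := P) (X := X) n i ω
    rw [mul_comm c]
    exact mul_le_mul_of_nonneg_left (by linarith [a.2, b.1]) this
  have hsum : ∑ i ∈ Finset.range (2 ^ n), ∫ ω, B i ω ∂P = ∫ ω, (X ⊤ ω - X ⊥ ω) ∂P := by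
    have := setIntegral_gridCompensator (g := g) (n := n) hX (Nat.zero_le _) MeasurableSet.univ
    simp only [g.zero, gridCompensator_bot, sub_zero, Measure.restrict_univ, gridCompensator_top]
      at this
    rw [← this, integral_finsetSum]
    exact fun i hi => (hBm i (Finset.mem_range.1 hi)).integrable le_top
  have hc : 0 ≤ c := by
    obtain ⟨ω, hω⟩ := (hXc ⊤).exists
    exact hω.1.trans hω.2
  have hX1 : ∫ ω, (X ⊤ ω - X ⊥ ω) ∂P ≤ c := by
    have : ∫ ω, (X ⊤ ω - X ⊥ ω) ∂P ≤ ∫ _, c ∂P := by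
      refine integral_mono_ae ((hX.integrable _).sub (hX.integrable _)) (integrable_const _) ?_
      filter_upwards [hXc ⊤, hXc ⊥] with ω a b
      linarith [a.2, b.1]
    simpa using this
  calc ∫ ω, A ⊤ ω ^ 2 ∂P
      ≤ ∫ ω, 2 * ∑ i ∈ Finset.range (2 ^ n), B i ω * (A ⊤ ω - A (g.pt n i) ω) ∂P := by
        refine integral_mono_ae ?_ ?_ (Eventually.of_forall fun ω => ?_)
        · simp_rw [sq]
          exact hmul (hAm ⊤) (hAm ⊤)
        · exact (integrable_finsetSum _ fun i hi => hprod i (Finset.mem_range.1 hi)).const_mul 2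
        · simp only [hA]
          rw [gridCompensator_top]
          refine (sq_sum_le_two_mul_sum _ _).trans_eq ?_
          congr 1
          refine Finset.sum_congr rfl fun i hi => ?_
          rw [gridCompensator_pt (Finset.mem_range.1 hi).le]
    _ = 2 * ∑ i ∈ Finset.range (2 ^ n), ∫ ω, B i ω * (A ⊤ ω - A (g.pt n i) ω) ∂P := by
        rw [integral_const_mul, integral_finsetSum]
        exact fun i hi => hprod i (Finset.mem_range.1 hi)
    _ ≤ 2 * ∑ i ∈ Finset.range (2 ^ n), c * ∫ ω, B i ω ∂P := by
        gcongr with i hi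
        exact hstep i (Finset.mem_range.1 hi)
    _ ≤ 2 * c ^ 2 := by
        rw [← Finset.mul_sum, hsum, sq]
        gcongr

end GridCompensator

/-! ### The energy inequality -/

section Energy

variable {Ω ι : Type*} {m : MeasurableSpace Ω} [LinearOrder ι] [OrderBot ι] [OrderTop ι]
  [TopologicalSpace ι] [OrderTopology ι] [MeasurableSpace ι] [BorelSpace ι]
  [SecondCountableTopology ι] [DenselyOrdered ι] [CompactIccSpace ι]

/-- Either side is what remains of the squared total mass after the finite integral of `μ (Iic t)`
is removed. -/
lemma lintegral_measure_Iio_eq (μ : Measure ι) [IsFiniteMeasure μ] :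
    ∫⁻ t, μ (Iio t) ∂μ = ∫⁻ t, μ (Ioi t) ∂μ := by
  have h1 := lintegral_Iic_add_lintegral_Iio μ μ
  have h2 : ∫⁻ t, μ (Iic t) ∂μ + ∫⁻ t, μ (Ioi t) ∂μ = μ univ * μ univ := by
    rw [← lintegral_add_left, ← lintegral_const]
    · refine lintegral_congr fun t => ?_
      rw [← measure_union (Iic_disjoint_Ioi le_rfl) measurableSet_Ioi, Iic_union_Ioi]
    · have : Monotone fun t => μ (Iic t) := fun s t hst => measure_mono (Iic_subset_Iic.2 hst)
      exact this.measurable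
  have hfin : ∫⁻ t, μ (Iic t) ∂μ ≠ ∞ := by
    refine ne_top_of_le_ne_top (ENNReal.mul_ne_top (measure_ne_top μ univ) (measure_ne_top μ univ))
      (h2 ▸ le_self_add)
  exact (ENNReal.add_right_inj hfin).1 (h1.trans h2.symm)

/-- A lower Riemann sum: on the cell following `pt n i` the integrand `μ (Iio t)` is at least `μ
(Iic (pt n i))`. -/
lemma RefiningGrid.sum_measure_mul_le (g : RefiningGrid ι) (μ : Measure ι) (n : ℕ) :
    ∑ i ∈ Finset.range (2 ^ n), μ (Iic (g.pt n i)) * μ (Ioc (g.pt n i) (g.pt n (i + 1))) ≤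
      ∫⁻ t, μ (Iio t) ∂μ := by
  have key : ∀ j ≤ 2 ^ n,
      ∑ i ∈ Finset.range j, μ (Iic (g.pt n i)) * μ (Ioc (g.pt n i) (g.pt n (i + 1))) ≤
        ∫⁻ t in Iic (g.pt n j), μ (Iio t) ∂μ := by
    intro j
    induction j with
    | zero => intro _; simp
    | succ j ih =>
      intro hj
      have hle : g.pt n j ≤ g.pt n (j + 1) := g.mono (Nat.le_succ j) hj
      rw [Finset.sum_range_succ, ← Iic_union_Ioc_eq_Iic hle,
        lintegral_union measurableSet_Ioc (Iic_disjoint_Ioc le_rfl)]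
      refine add_le_add (ih (Nat.le_of_succ_le hj)) ?_
      rw [← setLIntegral_const]
      refine setLIntegral_mono' measurableSet_Ioc fun t ht => ?_
      exact measure_mono fun s hs => lt_of_le_of_lt hs ht.1
  refine (key _ le_rfl).trans ?_
  exact setLIntegral_le_lintegral _ _

variable {g : RefiningGrid ι} {𝓕 : Filtration ι m} {P : Measure Ω} {X : ι → Ω → ℝ} {c : ℝ}

lemma ofReal_gridCompensator_top_sub (n : ℕ) (t : ι) (ω : Ω) :
    ENNReal.ofReal (gridCompensator g 𝓕 P X n ⊤ ω - gridCompensator g 𝓕 P X n t ω) =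
      ∑ i ∈ Finset.range (2 ^ n), (Iic (g.pt n i)).indicator
        (fun _ => ENNReal.ofReal (gridIncrement g 𝓕 P X n i ω)) t := by
  have h : gridCompensator g 𝓕 P X n ⊤ ω - gridCompensator g 𝓕 P X n t ω =
      ∑ i ∈ Finset.range (2 ^ n), (Iic (g.pt n i)).indicator
        (fun _ => gridIncrement g 𝓕 P X n i ω) t := by
    rw [gridCompensator_top, gridCompensator, ← Finset.sum_sub_distrib]
    refine Finset.sum_congr rfl fun i _ => ?_
    by_cases h : g.pt n i < t
    · simp [h]
    · simp [not_lt.1 h]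
  rw [h, ENNReal.ofReal_sum_of_nonneg]
  · refine Finset.sum_congr rfl fun i _ => ?_
    by_cases h : t ∈ Iic (g.pt n i)
    · simp only [indicator_of_mem h]
    · simp only [indicator_of_notMem h, ENNReal.ofReal_zero]
  · exact fun i _ => indicator_nonneg (fun _ _ => gridIncrement_nonneg _ _ _) _

lemma lintegral_gridCompensator_top_sub (n : ℕ) (ω : Ω) (μ : Measure ι) :
    ∫⁻ t, ENNReal.ofReal (gridCompensator g 𝓕 P X n ⊤ ω - gridCompensator g 𝓕 P X n t ω) ∂μ =
      ∑ i ∈ Finset.range (2 ^ n), ENNReal.ofReal (gridIncrement g 𝓕 P X n i ω) *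
        μ (Iic (g.pt n i)) := by
  simp_rw [ofReal_gridCompensator_top_sub]
  rw [lintegral_finsetSum]
  · refine Finset.sum_congr rfl fun i _ => ?_
    rw [lintegral_indicator_const measurableSet_Iic]
  · exact fun i _ => measurable_const.indicator measurableSet_Iic

variable [IsProbabilityMeasure P]

lemma IncreasingProcess.memLp (V : IncreasingProcess Ω ι) (hV2 : MemLp (V.toFun ⊤) 2 P) (t : ι) :
    MemLp (V.toFun t) 2 P := by
  refine hV2.mono (V.measurable t).aestronglyMeasurable (Eventually.of_forall fun ω => ?_)
  rw [Real.norm_of_nonneg (V.nonneg t ω), Real.norm_of_nonneg (V.nonneg ⊤ ω)]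
  exact V.mono ω le_top

/-- Integrating the remaining discrete compensator against `dV` gives the sum of `V (pt n i) * B i`.
As `V` and the discrete compensator both compensate `X` at grid points, in expectation `B i` may be
replaced by the increment of `V` over the cell. The result is a lower Riemann sum for the integral
of the left limits of `V` against `dV`, which equals that of `V ⊤ - V t`. The inequality later
forces the approximations to have the right upper limit at the jumps of `V`. -/
lemma lintegral_doleans_gridCompensator_le (hX : Submartingale X 𝓕 P)
    (hXc : ∀ t, ∀ᵐ ω ∂P, X t ω ∈ Icc 0 c) (V : IncreasingProcess Ω ι)
    (hVm : ∀ t, Measurable[𝓕 t] (V.toFun t)) (hV2 : MemLp (V.toFun ⊤) 2 P)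
    (hXV : ∀ s ∈ g.points, ∀ t ∈ g.points, s ≤ t → ∀ F, MeasurableSet[𝓕 s] F →
      ∫ ω in F, (V.toFun t ω - V.toFun s ω) ∂P = ∫ ω in F, (X t ω - X s ω) ∂P) (n : ℕ) :
    ∫⁻ p, ENNReal.ofReal (gridCompensator g 𝓕 P X n ⊤ p.2 - gridCompensator g 𝓕 P X n p.1 p.2)
      ∂V.doleans P ≤ ∫⁻ ω, ∫⁻ t, ENNReal.ofReal (V.toFun ⊤ ω - V.toFun t ω) ∂V.pathMeasure ω ∂P := by
  set B := gridIncrement g 𝓕 P X n with hB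
  have hVL := V.memLp hV2
  have hBm : ∀ i, i < 2 ^ n → MemLp (B i) ∞ P := fun i hi => memLp_top_gridIncrement hX hXc hi
  have hXm : ∀ t, MemLp (X t) ∞ P := fun t => by
    refine memLp_top_of_bound (hX.integrable t).1 c ?_
    filter_upwards [hXc t] with ω hω
    rw [Real.norm_of_nonneg hω.1]
    exact hω.2
  have hmeas : Measurable fun p : ι × Ω => ENNReal.ofReal
      (gridCompensator g 𝓕 P X n ⊤ p.2 - gridCompensator g 𝓕 P X n p.1 p.2) := by
    have h1 : Measurable (Function.uncurry (gridCompensator g 𝓕 P X n)) :=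
      (measurable_predictable_gridCompensator n).mono predictable_le_prod le_rfl
    exact ((h1.comp (measurable_const.prodMk measurable_snd)).sub h1).ennreal_ofReal
  have i1 : ∀ i, i < 2 ^ n → Integrable (fun ω => V.toFun (g.pt n i) ω * B i ω) P := by
    intro i hi
    exact ((hBm i hi).mul (hVL _) (r := 2)).integrable (by norm_num)
  have i2 : ∀ i, Integrable
      (fun ω => V.toFun (g.pt n i) ω * (V.toFun (g.pt n (i + 1)) ω - V.toFun (g.pt n i) ω)) P := by
    intro i
    exact (hVL _).integrable_mul ((hVL _).sub (hVL _))
  have i3 : ∀ i, Integrable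
      (fun ω => V.toFun (g.pt n i) ω * (X (g.pt n (i + 1)) ω - X (g.pt n i) ω)) P := by
    intro i
    exact (((hXm _).sub (hXm _)).mul (hVL _) (r := 2)).integrable (by norm_num)
  have hstep : ∀ i, i < 2 ^ n → ∫ ω, V.toFun (g.pt n i) ω * B i ω ∂P =
      ∫ ω, V.toFun (g.pt n i) ω * (V.toFun (g.pt n (i + 1)) ω - V.toFun (g.pt n i) ω) ∂P := by
    intro i hi
    refine integral_mul_eq_of_setIntegral_eq (𝓕.le (g.pt n i))
      (f' := fun ω => V.toFun (g.pt n (i + 1)) ω - V.toFun (g.pt n i) ω)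
      ((hBm i hi).integrable le_top) (((hVL _).sub (hVL _)).integrable (by norm_num))
      (fun F hF => ?_) (hVm _).stronglyMeasurable (i1 i hi) (i2 i)
    rw [setIntegral_gridIncrement hX hi hF, hXV _ (g.pt_mem hi.le) _ (g.pt_mem hi)
      (g.mono (Nat.le_succ i) hi) F hF]
  have hnn : ∀ i ω, 0 ≤ V.toFun (g.pt n i) ω * B i ω :=
    fun i ω => mul_nonneg (V.nonneg _ _) (gridIncrement_nonneg _ _ _)
  rw [V.lintegral_doleans hmeas]
  simp only [lintegral_gridCompensator_top_sub, V.pathMeasure_Iic]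
  calc ∫⁻ ω, ∑ i ∈ Finset.range (2 ^ n), ENNReal.ofReal (B i ω) *
        ENNReal.ofReal (V.toFun (g.pt n i) ω) ∂P
      = ∑ i ∈ Finset.range (2 ^ n), ∫⁻ ω, ENNReal.ofReal (B i ω) *
        ENNReal.ofReal (V.toFun (g.pt n i) ω) ∂P := by
        rw [lintegral_finsetSum]
        intro i _
        exact (((stronglyMeasurable_gridIncrement n i).mono (𝓕.le _)).measurable.ennreal_ofReal).mul
          (V.measurable _).ennreal_ofReal
    _ = ∑ i ∈ Finset.range (2 ^ n), ∫⁻ ω, V.pathMeasure ω (Iic (g.pt n i)) *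
          V.pathMeasure ω (Ioc (g.pt n i) (g.pt n (i + 1))) ∂P := by
        refine Finset.sum_congr rfl fun i hi => ?_
        have hi' := Finset.mem_range.1 hi
        simp_rw [V.pathMeasure_Iic, V.pathMeasure_Ioc]
        have e1 : ∀ ω, ENNReal.ofReal (B i ω) * ENNReal.ofReal (V.toFun (g.pt n i) ω) =
            ENNReal.ofReal (V.toFun (g.pt n i) ω * B i ω) := fun ω => by
          rw [ENNReal.ofReal_mul (V.nonneg _ _), mul_comm]
        have e2 : ∀ ω, ENNReal.ofReal (V.toFun (g.pt n i) ω) *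
            ENNReal.ofReal (V.toFun (g.pt n (i + 1)) ω - V.toFun (g.pt n i) ω) =
            ENNReal.ofReal (V.toFun (g.pt n i) ω *
              (V.toFun (g.pt n (i + 1)) ω - V.toFun (g.pt n i) ω)) := fun ω => by
          rw [ENNReal.ofReal_mul (V.nonneg _ _)]
        simp_rw [e1, e2]
        rw [← ofReal_integral_eq_lintegral_ofReal (i1 i hi') (Eventually.of_forall (hnn i)),
          ← ofReal_integral_eq_lintegral_ofReal (i2 i), hstep i hi']
        refine Eventually.of_forall fun ω => mul_nonneg (V.nonneg _ _) ?_
        exact sub_nonneg.2 (V.mono ω (g.mono (Nat.le_succ i) hi'))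
    _ = ∫⁻ ω, ∑ i ∈ Finset.range (2 ^ n), V.pathMeasure ω (Iic (g.pt n i)) *
          V.pathMeasure ω (Ioc (g.pt n i) (g.pt n (i + 1))) ∂P := by
        rw [lintegral_finsetSum]
        intro i _
        exact ((Measure.measurable_coe measurableSet_Iic).comp V.measurable_pathMeasure).mul
          ((Measure.measurable_coe measurableSet_Ioc).comp V.measurable_pathMeasure)
    _ ≤ ∫⁻ ω, ∫⁻ t, ENNReal.ofReal (V.toFun ⊤ ω - V.toFun t ω) ∂V.pathMeasure ω ∂P := by
        refine lintegral_mono fun ω => ?_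
        refine (g.sum_measure_mul_le (V.pathMeasure ω) n).trans ?_
        rw [lintegral_measure_Iio_eq]
        simp_rw [V.pathMeasure_Ioi]
        exact le_rfl

end Energy

/-! ### Strong convergence of convex combinations -/

section ConvexCombinations

/-- A bounded sequence in a Hilbert space has convex combinations of its tails converging to a
point. -/
lemma exists_convex_combination_tendsto {E : Type*} [NormedAddCommGroup E] [InnerProductSpace ℝ E]
    [CompleteSpace E] {x : ℕ → E} {c : ℝ} (hx : ∀ n, ‖x n‖ ≤ c) :
    ∃ Φ : E, ∀ (n : ℕ) (ε : ℝ), 0 < ε → ∃ (κ : Type) (_ : Fintype κ) (w : κ → ℝ) (k : κ → ℕ),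
      (∀ i, n ≤ k i) ∧ (∀ i, 0 ≤ w i) ∧ ∑ i, w i = 1 ∧ ‖∑ i, w i • x (k i) - Φ‖ < ε := by
  set K : ℕ → Set E := fun n => closure (convexHull ℝ (x '' Ici n)) with hK
  have hKanti : Antitone K := fun n k h =>
    closure_mono (convexHull_mono (image_mono (Ici_subset_Ici.2 h)))
  have hKne : ∀ n, (K n).Nonempty := fun n =>
    ⟨x n, subset_closure (subset_convexHull ℝ _ ⟨n, self_mem_Ici, rfl⟩)⟩
  have hKconv : ∀ n, Convex ℝ (K n) := fun n => (convex_convexHull ℝ _).closure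
  have hKbdd : ∀ n, ∀ y ∈ K n, ‖y‖ ≤ c := by
    intro n y hy
    have h1 : closure (convexHull ℝ (x '' Ici n)) ⊆ Metric.closedBall 0 c := by
      refine closure_minimal (convexHull_min ?_ (convex_closedBall 0 c)) Metric.isClosed_closedBall
      rintro _ ⟨k, -, rfl⟩
      simpa using hx k
    simpa using h1 hy
  -- The elements of least norm in the decreasing closed convex hulls have increasing bounded norms.
  -- Midpoints stay in the larger hull, so the parallelogram law makes the sequence Cauchy.
  choose y hyK hymin using fun n => exists_norm_eq_iInf_of_complete_convex (hKne n)
    isClosed_closure.isComplete (hKconv n) 0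
  have hmin : ∀ n, ∀ z ∈ K n, ‖y n‖ ≤ ‖z‖ := by
    intro n z hz
    have h1 := hymin n
    simp only [zero_sub, norm_neg] at h1
    rw [h1]
    exact ciInf_le ⟨0, by rintro _ ⟨w, rfl⟩; exact norm_nonneg _⟩ (⟨z, hz⟩ : K n)
  have hmono : Monotone fun n => ‖y n‖ := fun n k h => hmin n _ (hKanti h (hyK k))
  have hlim := tendsto_atTop_ciSup hmono ⟨c, by rintro _ ⟨n, rfl⟩; exact hKbdd n _ (hyK n)⟩
  have hdist : ∀ n k, n ≤ k → ‖y n - y k‖ ^ 2 ≤ 2 * (‖y k‖ ^ 2 - ‖y n‖ ^ 2) := by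
    intro n k h
    have hmid : (1 / 2 : ℝ) • y n + (1 / 2 : ℝ) • y k ∈ K n :=
      hKconv n (hyK n) (hKanti h (hyK k)) (by norm_num) (by norm_num) (by norm_num)
    have h1 := hmin n _ hmid
    rw [← smul_add, norm_smul, Real.norm_of_nonneg (by norm_num)] at h1
    have h2 := parallelogram_law_with_norm ℝ (y n) (y k)
    have h3 : (2 * ‖y n‖) ^ 2 ≤ ‖y n + y k‖ ^ 2 := by
      refine pow_le_pow_left₀ (by positivity) ?_ 2
      linarith
    nlinarith
  have hcauchy : CauchySeq y := by
    have hec : CauchySeq fun n => ‖y n‖ ^ 2 := (hlim.pow 2).cauchySeq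
    rw [Metric.cauchySeq_iff'] at hec ⊢
    intro ε hε
    obtain ⟨N, hN⟩ := hec (ε ^ 2 / 2) (by positivity)
    refine ⟨N, fun n hn => ?_⟩
    have h1 := hdist N n hn
    have h2 := hN n hn
    rw [Real.dist_eq] at h2
    rw [dist_comm, dist_eq_norm]
    refine lt_of_pow_lt_pow_left₀ 2 hε.le ?_
    have := le_abs_self (‖y n‖ ^ 2 - ‖y N‖ ^ 2)
    linarith
  obtain ⟨Φ, hΦ⟩ := cauchySeq_tendsto_of_complete hcauchy
  have hΦK : ∀ n, Φ ∈ K n := fun n => isClosed_closure.mem_of_tendsto hΦ <| by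
    filter_upwards [eventually_ge_atTop n] with k hk
    exact hKanti hk (hyK k)
  refine ⟨Φ, fun n ε hε => ?_⟩
  obtain ⟨z, hz, hzε⟩ := Metric.mem_closure_iff.1 (hΦK n) ε hε
  obtain ⟨κ, _, w, a, hw, hw1, ha, rfl⟩ := mem_convexHull_iff_exists_fintype.1 hz
  choose k hk hka using ha
  refine ⟨κ, inferInstance, w, k, hk, hw, hw1, ?_⟩
  simp_rw [hka]
  rwa [← dist_eq_norm, dist_comm]

end ConvexCombinations

/-! ### Approximating predictable increasing processes -/

section Approx

variable {Ω ι : Type*} {m : MeasurableSpace Ω} [LinearOrder ι] [OrderBot ι] [OrderTop ι]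
  [TopologicalSpace ι] [OrderTopology ι] [MeasurableSpace ι] [BorelSpace ι]
  [SecondCountableTopology ι] [DenselyOrdered ι] [CompactIccSpace ι]

/-- `V` compensates `X` at the points of the grid. -/
structure IsCompensatorOnPoints (g : RefiningGrid ι) (𝓕 : Filtration ι m) (P : Measure Ω)
    (X : ι → Ω → ℝ) (V : IncreasingProcess Ω ι) : Prop where
  adapted : ∀ t, Measurable[𝓕 t] (V.toFun t)
  memLp : MemLp (V.toFun ⊤) 2 P
  setIntegral : ∀ s ∈ g.points, ∀ t ∈ g.points, s ≤ t → ∀ F, MeasurableSet[𝓕 s] F →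
    ∫ ω in F, (V.toFun t ω - V.toFun s ω) ∂P = ∫ ω in F, (X t ω - X s ω) ∂P

/-- `D` is a predictable increasing process which compensates `X` at the points of the `n`-th
partition and satisfies the energy inequality of the discrete compensators. -/
structure IsGridCompensator (g : RefiningGrid ι) (𝓕 : Filtration ι m) (P : Measure Ω)
    (X : ι → Ω → ℝ) (n : ℕ) (D : ι → Ω → ℝ) : Prop where
  predictable : Measurable[𝓕.predictable] (Function.uncurry D)
  mono : ∀ ω, Monotone fun t => D t ω
  bot : ∀ ω, D ⊥ ω = 0
  memLp : ∀ t, MemLp (D t) 2 P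
  setIntegral : ∀ j ≤ 2 ^ n, ∀ F, MeasurableSet[𝓕 (g.pt n j)] F →
    ∫ ω in F, (D ⊤ ω - D (g.pt n j) ω) ∂P = ∫ ω in F, (X ⊤ ω - X (g.pt n j) ω) ∂P
  energy : ∀ V, IsCompensatorOnPoints g 𝓕 P X V →
    ∫⁻ p, ENNReal.ofReal (D ⊤ p.2 - D p.1 p.2) ∂V.doleans P ≤
      ∫⁻ ω, ∫⁻ t, ENNReal.ofReal (V.toFun ⊤ ω - V.toFun t ω) ∂V.pathMeasure ω ∂P

variable {g : RefiningGrid ι} {𝓕 : Filtration ι m} {P : Measure Ω} {X : ι → Ω → ℝ} {c : ℝ}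
  [IsProbabilityMeasure P]

/-- The points of a coarse partition belong to every finer one, so all later discrete compensators
meet the requirements at level `n`, and so can convex combinations of a tail. -/
lemma isGridCompensator_gridCompensator (hX : Submartingale X 𝓕 P)
    (hXc : ∀ t, ∀ᵐ ω ∂P, X t ω ∈ Icc 0 c) {n k : ℕ} (hnk : n ≤ k) :
    IsGridCompensator g 𝓕 P X n (gridCompensator g 𝓕 P X k) where
  predictable := measurable_predictable_gridCompensator k
  mono := monotone_gridCompensator k
  bot := gridCompensator_bot k
  memLp t := (memLp_gridCompensator hX hXc k t).mono_exponent le_top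
  setIntegral j hj F hF := by
    obtain ⟨i, hi, h⟩ := g.exists_pt_of_le hnk hj
    rw [← h] at hF ⊢
    exact setIntegral_gridCompensator hX hi hF
  energy V hV := lintegral_doleans_gridCompensator_le hX hXc V hV.adapted hV.memLp hV.setIntegral k

lemma measurable_sum_mul_aux {α κ : Type*} {mα : MeasurableSpace α} [Fintype κ] (w : κ → ℝ)
    {f : κ → α → ℝ} (hf : ∀ i, Measurable (f i)) : Measurable fun a => ∑ i, w i * f i a :=
  Finset.measurable_sum _ fun i _ => (hf i).const_mul (w i)

/-- The compensation identity and the energy bound are affine in `D`; the other conditions pass to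
nonnegative combinations. -/
lemma IsGridCompensator.sum {κ : Type*} [Fintype κ] {w : κ → ℝ} (hw : ∀ i, 0 ≤ w i)
    (hw1 : ∑ i, w i = 1) {n : ℕ} {D : κ → ι → Ω → ℝ}
    (hD : ∀ i, IsGridCompensator g 𝓕 P X n (D i)) :
    IsGridCompensator g 𝓕 P X n fun t ω => ∑ i, w i * D i t ω where
  predictable := measurable_sum_mul_aux (mα := 𝓕.predictable) w fun i => (hD i).predictable
  mono ω s t hst := Finset.sum_le_sum fun i _ =>
    mul_le_mul_of_nonneg_left ((hD i).mono ω hst) (hw i)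
  bot ω := by simp [(hD _).bot]
  memLp t := memLp_finsetSum _ fun i _ => ((hD i).memLp t).const_mul (w i)
  setIntegral j hj F hF := by
    have h1 : ∀ ω, ∑ i, w i * D i ⊤ ω - ∑ i, w i * D i (g.pt n j) ω =
        ∑ i, w i * (D i ⊤ ω - D i (g.pt n j) ω) := fun ω => by
      rw [← Finset.sum_sub_distrib]
      exact Finset.sum_congr rfl fun i _ => by ring
    simp_rw [h1]
    rw [integral_finsetSum]
    · simp_rw [integral_const_mul, (hD _).setIntegral j hj F hF]
      rw [← Finset.sum_mul, hw1, one_mul]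
    · intro i _
      exact (((((hD i).memLp _).sub ((hD i).memLp _)).integrable (by norm_num)).const_mul
        (w i)).restrict
  energy V hV := by
    have h1 : ∀ p : ι × Ω, ENNReal.ofReal (∑ i, w i * D i ⊤ p.2 - ∑ i, w i * D i p.1 p.2) =
        ∑ i, ENNReal.ofReal (w i) * ENNReal.ofReal (D i ⊤ p.2 - D i p.1 p.2) := fun p => by
      rw [← Finset.sum_sub_distrib, ENNReal.ofReal_sum_of_nonneg]
      · refine Finset.sum_congr rfl fun i _ => ?_
        rw [← mul_sub, ENNReal.ofReal_mul (hw i)]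
      · intro i _
        rw [← mul_sub]
        exact mul_nonneg (hw i) (sub_nonneg.2 ((hD i).mono p.2 le_top))
    have hm : ∀ i, Measurable fun p : ι × Ω => ENNReal.ofReal (D i ⊤ p.2 - D i p.1 p.2) := by
      intro i
      have h1 : Measurable (Function.uncurry (D i)) :=
        (hD i).predictable.mono predictable_le_prod le_rfl
      exact ((h1.comp (measurable_const.prodMk measurable_snd)).sub h1).ennreal_ofReal
    simp_rw [h1]
    rw [lintegral_finsetSum _ fun i _ => (hm i).const_mul _]
    simp_rw [lintegral_const_mul _ (hm _)]
    refine (Finset.sum_le_sum fun i _ => mul_le_mul_right ((hD i).energy V hV) _).trans_eq ?_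
    rw [← Finset.sum_mul, ← ENNReal.ofReal_sum_of_nonneg fun i _ => hw i, hw1, ENNReal.ofReal_one,
      one_mul]

/-- The L² bound on the terminal values supplies convex combinations of tails within any prescribed
distance of one limit `Φ`. The geometric rate is chosen for later almost sure convergence. -/
lemma exists_isGridCompensator_tendsto (g : RefiningGrid ι) (hX : Submartingale X 𝓕 P)
    (hXc : ∀ t, ∀ᵐ ω ∂P, X t ω ∈ Icc 0 c) :
    ∃ (Φ : Ω → ℝ) (D : ℕ → ι → Ω → ℝ), MemLp Φ 2 P ∧
      ∀ n, IsGridCompensator g 𝓕 P X n (D n) ∧ ∫ ω, |D n ⊤ ω - Φ ω| ∂P ≤ (1 / 2) ^ n := by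
  have hA2 : ∀ n, MemLp (gridCompensator g 𝓕 P X n ⊤) 2 P := fun n =>
    (memLp_gridCompensator hX hXc n ⊤).mono_exponent le_top
  set x : ℕ → Lp ℝ 2 P := fun n => (hA2 n).toLp _ with hx
  have hxc : ∀ n, ‖x n‖ ≤ √(2 * c ^ 2) := by
    intro n
    refine Real.le_sqrt_of_sq_le ?_
    simp only [hx]
    rw [sq_norm_toLp (hA2 n)]
    simpa using integral_sq_gridCompensator_le (g := g) hX hXc n
  obtain ⟨Φ, hΦ⟩ := exists_convex_combination_tendsto hxc
  choose κ _ w k hk hw hw1 hlt using fun n : ℕ => hΦ n ((1 / 2) ^ n) (by positivity)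
  refine ⟨Φ, fun n t ω => ∑ i, w n i * gridCompensator g 𝓕 P X (k n i) t ω, Lp.memLp Φ,
    fun n => ?_⟩
  have hG : IsGridCompensator g 𝓕 P X n
      (fun t ω => ∑ i, w n i * gridCompensator g 𝓕 P X (k n i) t ω) :=
    IsGridCompensator.sum (hw n) (hw1 n) fun i =>
      isGridCompensator_gridCompensator hX hXc (hk n i)
  refine ⟨hG, ?_⟩
  have hcoe : (∑ i, w n i • x (k n i) - Φ : Lp ℝ 2 P) =ᵐ[P]
      fun ω => ∑ i, w n i * gridCompensator g 𝓕 P X (k n i) ⊤ ω - Φ ω := by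
    have h2 : ((hG.memLp ⊤).toLp _ - Φ : Lp ℝ 2 P) = ∑ i, w n i • x (k n i) - Φ := by
      congr 1
      refine Lp.ext ((hG.memLp ⊤).coeFn_toLp.trans ?_)
      have h3 := Lp.coeFn_finsetSum Finset.univ fun i => w n i • x (k n i)
      have h4 : ∀ᵐ ω ∂P, ∀ i, (w n i • x (k n i) : Lp ℝ 2 P) ω =
          w n i * gridCompensator g 𝓕 P X (k n i) ⊤ ω := by
        rw [ae_all_iff]
        intro i
        filter_upwards [Lp.coeFn_smul (w n i) (x (k n i)), (hA2 (k n i)).coeFn_toLp] with ω a b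
        rw [a, Pi.smul_apply, smul_eq_mul, ← b]
      filter_upwards [h3, h4] with ω a b
      rw [a]
      simp [b]
    rw [← h2]
    filter_upwards [Lp.coeFn_sub ((hG.memLp ⊤).toLp _) Φ, (hG.memLp ⊤).coeFn_toLp] with ω a b
    rw [a, Pi.sub_apply, b]
  have hsub : MemLp (fun ω => ∑ i, w n i * gridCompensator g 𝓕 P X (k n i) ⊤ ω - Φ ω) 2 P :=
    (hG.memLp ⊤).sub (Lp.memLp Φ)
  have h5 : eLpNorm (fun ω => ∑ i, w n i * gridCompensator g 𝓕 P X (k n i) ⊤ ω - Φ ω) 1 P ≤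
      ENNReal.ofReal ((1 / 2) ^ n) := by
    refine (eLpNorm_le_eLpNorm_of_exponent_le (p := 1) (q := 2) (by norm_num) hsub.1).trans ?_
    rw [← eLpNorm_congr_ae hcoe, ← Lp.enorm_def, ← ofReal_norm]
    exact ENNReal.ofReal_le_ofReal (hlt n).le
  rw [eLpNorm_one_eq_lintegral_enorm] at h5
  have h6 := integral_norm_eq_lintegral_enorm hsub.1
  simp only [Real.norm_eq_abs] at h6
  rw [h6]
  exact ENNReal.toReal_le_of_le_ofReal (by positivity) h5

end Approx

/-! ### Passage to the limit at the grid points -/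

namespace RefiningGrid

variable {ι : Type*} [LinearOrder ι] [OrderBot ι] [OrderTop ι]

/-- The right limits along the grid points of a function on an order interval, extended by the value
at the last point. -/
noncomputable def rightLim (g : RefiningGrid ι) (u : ι → ℝ) (t : ι) : ℝ :=
  sInf (u '' {q | q ∈ g.points ∧ (t < q ∨ q = ⊤)})

variable {g : RefiningGrid ι} {u : ι → ℝ}

lemma bddBelow_rightLim (hu : MonotoneOn u g.points) (t : ι) :
    BddBelow (u '' {q | q ∈ g.points ∧ (t < q ∨ q = ⊤)}) := by
  refine ⟨u ⊥, ?_⟩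
  rintro _ ⟨q, hq, rfl⟩
  exact hu g.bot_mem hq.1 bot_le

lemma nonempty_rightLim (t : ι) : (u '' {q | q ∈ g.points ∧ (t < q ∨ q = ⊤)}).Nonempty :=
  ⟨u ⊤, ⊤, ⟨g.top_mem, Or.inr rfl⟩, rfl⟩

lemma rightLim_le (hu : MonotoneOn u g.points) {q t : ι} (hq : q ∈ g.points)
    (h : t < q ∨ q = ⊤) : g.rightLim u t ≤ u q :=
  csInf_le (bddBelow_rightLim hu t) ⟨q, ⟨hq, h⟩, rfl⟩

lemma le_rightLim (hu : MonotoneOn u g.points) {q t : ι} (hq : q ∈ g.points) (h : q ≤ t) :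
    u q ≤ g.rightLim u t := by
  refine le_csInf (nonempty_rightLim t) ?_
  rintro _ ⟨r, ⟨hr, hr'⟩, rfl⟩
  refine hu hq hr ?_
  rcases hr' with h1 | rfl
  · exact h.trans h1.le
  · exact le_top

lemma monotone_rightLim (hu : MonotoneOn u g.points) : Monotone (g.rightLim u) := by
  intro s t hst
  refine csInf_le_csInf (bddBelow_rightLim hu s) (nonempty_rightLim t) (image_mono ?_)
  rintro q ⟨hq, h⟩
  exact ⟨hq, h.imp (fun h => hst.trans_lt h) id⟩

lemma rightLim_top (hu : MonotoneOn u g.points) : g.rightLim u ⊤ = u ⊤ :=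
  le_antisymm (rightLim_le hu g.top_mem (Or.inr rfl)) (le_rightLim hu g.top_mem le_rfl)

variable [TopologicalSpace ι] [OrderTopology ι]

lemma tendsto_rightLim (hu : MonotoneOn u g.points) {t : ι} {q : ℕ → ι}
    (hq : ∀ n, q n ∈ g.points) (hqt : ∀ n, t < q n) (hlim : Tendsto q atTop (𝓝 t)) :
    Tendsto (fun n => u (q n)) atTop (𝓝 (g.rightLim u t)) := by
  refine tendsto_order.2 ⟨fun a ha => Eventually.of_forall fun n =>
    ha.trans_le (rightLim_le hu (hq n) (Or.inl (hqt n))), fun a ha => ?_⟩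
  obtain ⟨_, ⟨r, ⟨hr, hr'⟩, rfl⟩, hra⟩ := exists_lt_of_csInf_lt (nonempty_rightLim t) ha
  rcases hr' with h | rfl
  · filter_upwards [hlim.eventually_lt_const h] with n hn
    exact (hu (hq n) hr hn.le).trans_lt hra
  · exact Eventually.of_forall fun n => (hu (hq n) hr le_top).trans_lt hra

lemma continuousWithinAt_rightLim (hu : MonotoneOn u g.points) (t : ι) :
    ContinuousWithinAt (g.rightLim u) (Ici t) t := by
  refine tendsto_order.2 ⟨fun a ha => ?_, fun a ha => ?_⟩
  · filter_upwards [self_mem_nhdsWithin] with s hs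
    exact ha.trans_le (monotone_rightLim hu hs)
  · obtain ⟨_, ⟨r, ⟨hr, hr'⟩, rfl⟩, hra⟩ := exists_lt_of_csInf_lt (nonempty_rightLim t) ha
    rcases hr' with h | rfl
    · filter_upwards [mem_nhdsWithin_of_mem_nhds (Iio_mem_nhds h)] with s hs
      exact (rightLim_le hu hr (Or.inl hs)).trans_lt hra
    · exact Eventually.of_forall fun s => (rightLim_le hu hr (Or.inr rfl)).trans_lt hra

end RefiningGrid

/-- Summable L¹ norms make the series of absolute values finite almost surely. The bound is required
only from `N` on, since a grid point belongs to the partitions only from some level on. -/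
lemma ae_tendsto_zero_of_integral_abs_le {Ω : Type*} {m : MeasurableSpace Ω} {P : Measure Ω}
    {f : ℕ → Ω → ℝ} (hf : ∀ n, Integrable (f n) P) {N : ℕ}
    (h : ∀ n, N ≤ n → ∫ ω, |f n ω| ∂P ≤ (1 / 2) ^ n) :
    ∀ᵐ ω ∂P, Tendsto (fun n => f n ω) atTop (𝓝 0) := by
  have h1 : ∫⁻ ω, ∑' n, ‖f (n + N) ω‖ₑ ∂P ≠ ∞ := by
    rw [lintegral_tsum fun n => (hf _).1.enorm]
    have h2 : ∀ n, ∫⁻ ω, ‖f (n + N) ω‖ₑ ∂P ≤ ENNReal.ofReal ((1 / 2) ^ (n + N)) := by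
      intro n
      have h3 := integral_norm_eq_lintegral_enorm (hf (n + N)).1
      have h4 := h (n + N) (Nat.le_add_left _ _)
      simp only [Real.norm_eq_abs] at h3
      rw [h3] at h4
      rwa [ENNReal.le_ofReal_iff_toReal_le (hf _).2.ne (by positivity)]
    refine ne_top_of_le_ne_top ?_ (ENNReal.tsum_le_tsum h2)
    have hs : Summable fun n : ℕ => ((1 : ℝ) / 2) ^ (n + N) :=
      (summable_nat_add_iff N).2 summable_geometric_two
    rw [← ENNReal.ofReal_tsum_of_nonneg (fun n => by positivity) hs]
    exact ENNReal.ofReal_ne_top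
  have h2 := ae_lt_top' (AEMeasurable.tsum fun n => (hf _).1.enorm) h1
  filter_upwards [h2] with ω hω
  have h3 := ENNReal.tendsto_atTop_zero_of_tsum_ne_top hω.ne
  rw [← tendsto_add_atTop_iff_nat N]
  exact tendsto_zero_iff_enorm_tendsto_zero.2 h3

section Limit

variable {Ω ι : Type*} {m : MeasurableSpace Ω} [LinearOrder ι] [OrderBot ι] [OrderTop ι]
  [TopologicalSpace ι] [OrderTopology ι] [MeasurableSpace ι] [BorelSpace ι]
  [SecondCountableTopology ι] [DenselyOrdered ι] [CompactIccSpace ι]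
  {g : RefiningGrid ι} {𝓕 : Filtration ι m} {P : Measure Ω} {X : ι → Ω → ℝ} {c : ℝ}
  [IsProbabilityMeasure P] {Φ : Ω → ℝ}

/-- At a grid point `D` is determined by its terminal value, because `X - D` satisfies the
martingale identity between that point and `⊤`. -/
lemma IsGridCompensator.ae_eq {n : ℕ} {D : ι → Ω → ℝ} (hD : IsGridCompensator g 𝓕 P X n D)
    (hX : Submartingale X 𝓕 P) {j : ℕ} (hj : j ≤ 2 ^ n) :
    D (g.pt n j) =ᵐ[P] X (g.pt n j) - P[X ⊤ - D ⊤|𝓕 (g.pt n j)] := by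
  set q := g.pt n j
  have hDi : ∀ t, Integrable (D t) P := fun t => (hD.memLp t).integrable (by norm_num)
  have h1 := condExp_ae_eq_of_setIntegral_eq (P := P) (𝓕.le q) (f := D ⊤ - D q) (f' := X ⊤ - X q)
    ((hDi _).sub (hDi _)) ((hX.integrable _).sub (hX.integrable _)) (hD.setIntegral j hj)
  have h2 : P[D q|𝓕 q] = D q := condExp_of_stronglyMeasurable (𝓕.le q)
    (measurable_of_predictable hD.predictable q).stronglyMeasurable (hDi q)
  have h3 : P[X q|𝓕 q] = X q :=
    condExp_of_stronglyMeasurable (𝓕.le q) (hX.stronglyMeasurable q) (hX.integrable q)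
  filter_upwards [h1, condExp_sub (hDi ⊤) (hDi q) (𝓕 q),
    condExp_sub (hX.integrable ⊤) (hX.integrable q) (𝓕 q),
    condExp_sub (hX.integrable ⊤) (hDi ⊤) (𝓕 q)] with ω a b c d
  rw [b, c, h2, h3] at a
  simp only [Pi.sub_apply] at a d ⊢
  rw [d]
  linarith

/-- Conditional expectation contracts L¹, so the geometric rate at the terminal time is inherited by
every grid point. -/
lemma IsGridCompensator.ae_tendsto {D : ℕ → ι → Ω → ℝ} (hX : Submartingale X 𝓕 P)
    (hΦ : MemLp Φ 2 P)
    (hD : ∀ n, IsGridCompensator g 𝓕 P X n (D n) ∧ ∫ ω, |D n ⊤ ω - Φ ω| ∂P ≤ (1 / 2) ^ n)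
    {q : ι} (hq : q ∈ g.points) :
    ∀ᵐ ω ∂P, Tendsto (fun n => D n q ω) atTop (𝓝 (X q ω - (P[X ⊤ - Φ|𝓕 q]) ω)) := by
  have hDi : ∀ n t, Integrable (D n t) P := fun n t => ((hD n).1.memLp t).integrable (by norm_num)
  have hΦi : Integrable Φ P := hΦ.integrable (by norm_num)
  set U : Ω → ℝ := X q - P[X ⊤ - Φ|𝓕 q] with hU
  have hUi : Integrable U P := (hX.integrable q).sub integrable_condExp
  obtain ⟨N, j, hj, rfl⟩ := hq
  have h1 : ∀ n, N ≤ n → ∫ ω, |D n (g.pt N j) ω - U ω| ∂P ≤ (1 / 2) ^ n := by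
    intro n hn
    obtain ⟨i, hi, h⟩ := g.exists_pt_of_le hn hj
    have h2 := (hD n).1.ae_eq hX hi
    rw [h] at h2
    have h3 : (fun ω => D n (g.pt N j) ω - U ω) =ᵐ[P] P[D n ⊤ - Φ|𝓕 (g.pt N j)] := by
      filter_upwards [h2, condExp_sub (hX.integrable ⊤) (hDi n ⊤) (𝓕 (g.pt N j)),
        condExp_sub (hX.integrable ⊤) hΦi (𝓕 (g.pt N j)),
        condExp_sub (hDi n ⊤) hΦi (𝓕 (g.pt N j))] with ω a b c d
      simp only [hU, Pi.sub_apply] at a b c d ⊢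
      rw [a, b, c, d]
      ring
    have h4 : ∫ ω, |D n (g.pt N j) ω - U ω| ∂P = ∫ ω, |(P[D n ⊤ - Φ|𝓕 (g.pt N j)]) ω| ∂P := by
      refine integral_congr_ae ?_
      filter_upwards [h3] with ω hω
      rw [hω]
    rw [h4]
    exact (integral_abs_condExp_le _).trans (hD n).2
  filter_upwards [ae_tendsto_zero_of_integral_abs_le (fun n => (hDi n _).sub hUi) h1] with ω hω
  exact tendsto_sub_nhds_zero_iff.1 hω

/-- Right-continuous increasing processes with prescribed values at the grid points. -/
lemma exists_increasingProcess_of_tendsto {D : ℕ → ι → Ω → ℝ} {U : ι → Ω → ℝ}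
    (h𝓕 : UsualConditions 𝓕 P) (hDmono : ∀ n ω, Monotone fun t => D n t ω)
    (hDbot : ∀ n ω, D n ⊥ ω = 0) (hUm : ∀ t, Measurable[𝓕 t] (U t)) (hU2 : MemLp (U ⊤) 2 P)
    (hUi : ∀ t, Integrable (U t) P)
    (hlim : ∀ q ∈ g.points, ∀ᵐ ω ∂P, Tendsto (fun n => D n q ω) atTop (𝓝 (U q ω)))
    (hUrc : ∀ (t : ι) (q : ℕ → ι), StrictAnti q → (∀ n, t < q n) → Tendsto q atTop (𝓝 t) →
      Tendsto (fun n => ∫ ω, U (q n) ω ∂P) atTop (𝓝 (∫ ω, U t ω ∂P))) :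
    ∃ V : IncreasingProcess Ω ι, (∀ t, Measurable[𝓕 t] (V.toFun t)) ∧ MemLp (V.toFun ⊤) 2 P ∧
      (∀ᵐ ω ∂P, ∀ q ∈ g.points, V.toFun q ω = U q ω) ∧
      ∀ᵐ ω ∂P, ∀ q ∈ g.points, Tendsto (fun n => D n q ω) atTop (𝓝 (V.toFun q ω)) := by
  classical
  have hgood : ∀ᵐ ω ∂P, ∀ q ∈ g.points, Tendsto (fun n => D n q ω) atTop (𝓝 (U q ω)) :=
    (ae_ball_iff g.countable_points).2 hlim
  have hmono : ∀ ω, (∀ q ∈ g.points, Tendsto (fun n => D n q ω) atTop (𝓝 (U q ω))) →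
      MonotoneOn (fun q => U q ω) g.points := fun ω hω s hs t ht hst =>
    le_of_tendsto_of_tendsto' (hω s hs) (hω t ht) fun n => hDmono n ω hst
  set V₀ : ι → Ω → ℝ := fun t ω => g.rightLim (fun q => U q ω) t with hV₀
  have hV₀m : ∀ t, Measurable[𝓕 t] (V₀ t) := by
    intro t
    rcases eq_or_lt_of_le (le_top : t ≤ ⊤) with rfl | ht
    · refine h𝓕.measurable_of_ae_eq (hUm ⊤) ?_
      filter_upwards [hgood] with ω hω
      exact (RefiningGrid.rightLim_top (hmono ω hω)).symm
    · obtain ⟨q, hqa, hqp, hqt, hql⟩ := g.exists_strictAnti_tendsto ht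
      refine h𝓕.measurable_of_forall_gt (not_isMax_iff.2 ⟨⊤, ht⟩) hql fun j => ?_
      refine h𝓕.measurable_of_tendsto_ae (f := fun n => U (q (n + j))) (fun n => ?_) ?_
      · exact (hUm _).mono (𝓕.mono (hqa.antitone (Nat.le_add_left _ _))) le_rfl
      · filter_upwards [hgood] with ω hω
        exact (RefiningGrid.tendsto_rightLim (hmono ω hω) hqp hqt hql).comp
          (tendsto_add_atTop_nat j)
  have hUnn : ∀ᵐ ω ∂P, ∀ q ∈ g.points, 0 ≤ U q ω ∧ U q ω ≤ U ⊤ ω := by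
    filter_upwards [hgood] with ω hω q hq
    refine ⟨ge_of_tendsto' (hω q hq) fun n => ?_, hmono ω hω hq g.top_mem le_top⟩
    rw [← hDbot n ω]
    exact hDmono n ω bot_le
  -- Monotonicity gives `U t ≤ V₀ t` at a grid point, and right-continuity of the mean of `U` gives
  -- equal expectations; hence equality almost surely.
  have hUV : ∀ q ∈ g.points, ∀ᵐ ω ∂P, V₀ q ω = U q ω := by
    intro t ht
    rcases eq_or_lt_of_le (le_top : t ≤ ⊤) with rfl | htop
    · filter_upwards [hgood] with ω hω
      exact RefiningGrid.rightLim_top (hmono ω hω)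
    · obtain ⟨q, hqa, hqp, hqt, hql⟩ := g.exists_strictAnti_tendsto htop
      have hle : U t ≤ᵐ[P] V₀ t := by
        filter_upwards [hgood] with ω hω
        exact RefiningGrid.le_rightLim (hmono ω hω) ht le_rfl
      have h1 : Tendsto (fun n => ∫ ω, U (q n) ω ∂P) atTop (𝓝 (∫ ω, V₀ t ω ∂P)) := by
        refine tendsto_integral_of_dominated_convergence (fun ω => U ⊤ ω) (fun n => (hUi _).1)
          (hUi ⊤) (fun n => ?_) ?_
        · filter_upwards [hUnn] with ω hω
          rw [Real.norm_of_nonneg (hω _ (hqp n)).1]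
          exact (hω _ (hqp n)).2
        · filter_upwards [hgood] with ω hω
          exact RefiningGrid.tendsto_rightLim (hmono ω hω) hqp hqt hql
      have h2 := tendsto_nhds_unique h1 (hUrc t q hqa hqt hql)
      have hVi : Integrable (V₀ t) P := by
        refine (hUi ⊤).mono' ((hV₀m t).mono (𝓕.le t) le_rfl).aestronglyMeasurable ?_
        filter_upwards [hgood, hUnn] with ω hω hω'
        have h3 := RefiningGrid.le_rightLim (hmono ω hω) ht (le_refl t)
        rw [Real.norm_of_nonneg ((hω' t ht).1.trans h3)]
        exact RefiningGrid.rightLim_le (hmono ω hω) g.top_mem (Or.inr rfl)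
      exact ((integral_eq_iff_of_ae_le (hUi t) hVi hle).1 h2.symm).symm
  set G : Set Ω := {ω | (∀ q ∈ g.points, Tendsto (fun n => D n q ω) atTop (𝓝 (U q ω))) ∧
    ∀ q ∈ g.points, V₀ q ω = U q ω} with hG
  have hGae : ∀ᵐ ω ∂P, ω ∈ G := by
    filter_upwards [hgood, (ae_ball_iff g.countable_points).2 hUV] with ω h1 h2
    exact ⟨h1, h2⟩
  have hGm : ∀ t, MeasurableSet[𝓕 t] G := fun t => by
    have := (h𝓕.measurableSet_of_null (N := Gᶜ) hGae t).compl
    rwa [compl_compl] at this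
  have hVm : ∀ t, Measurable[𝓕 t] (G.indicator (V₀ t)) := fun t => (hV₀m t).indicator (hGm t)
  let V : IncreasingProcess Ω ι :=
    { toFun := fun t => G.indicator (V₀ t)
      mono := by
        intro ω s t hst
        by_cases hω : ω ∈ G
        · simp only [indicator_of_mem hω]
          exact RefiningGrid.monotone_rightLim (hmono ω hω.1) hst
        · simp [indicator_of_notMem hω]
      rightCont := by
        intro ω t
        by_cases hω : ω ∈ G
        · simp only [indicator_of_mem hω]
          exact RefiningGrid.continuousWithinAt_rightLim (hmono ω hω.1) t
        · simp only [indicator_of_notMem hω]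
          exact continuousWithinAt_const
      measurable := fun t => (hVm t).mono (𝓕.le t) le_rfl
      bot := by
        intro ω
        by_cases hω : ω ∈ G
        · rw [indicator_of_mem hω, hω.2 ⊥ g.bot_mem]
          refine tendsto_nhds_unique (hω.1 ⊥ g.bot_mem) ?_
          simp only [hDbot]
          exact tendsto_const_nhds
        · simp [indicator_of_notMem hω] }
  have hVU : ∀ ω ∈ G, ∀ q ∈ g.points, V.toFun q ω = U q ω := by
    intro ω hω q hq
    change G.indicator (V₀ q) ω = _
    rw [indicator_of_mem hω, hω.2 q hq]
  refine ⟨V, hVm, hU2.ae_eq ?_, ?_, ?_⟩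
  · filter_upwards [hGae] with ω hω
    exact (hVU ω hω ⊤ g.top_mem).symm
  · filter_upwards [hGae] with ω hω q hq
    exact hVU ω hω q hq
  · filter_upwards [hGae] with ω hω q hq
    rw [hVU ω hω q hq]
    exact hω.1 q hq

end Limit

/-! ### Upper limits of increasing functions -/

section PathLimit

variable {ι : Type*} [LinearOrder ι] [OrderBot ι] [OrderTop ι] [TopologicalSpace ι]
  [OrderTopology ι] [DenselyOrdered ι] [FirstCountableTopology ι]
  {g : RefiningGrid ι} {d : ℕ → ι → ℝ} {v : ι → ℝ}

/-- Bound `d n t` by its value at grid points to the right of `t`, where convergence is known, and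
let these decrease to `t`. -/
lemma RefiningGrid.limsup_le_of_tendsto (hd : ∀ n, Monotone (d n)) (hd0 : ∀ n, d n ⊥ = 0)
    (hv : ∀ t, ContinuousWithinAt v (Ici t) t)
    (hlim : ∀ q ∈ g.points, Tendsto (fun n => d n q) atTop (𝓝 (v q))) (t : ι) :
    limsup (fun n => d n t) atTop ≤ v t := by
  have hnn : ∀ n t, 0 ≤ d n t := fun n t => hd0 n ▸ hd n bot_le
  rcases eq_or_lt_of_le (le_top : t ≤ ⊤) with rfl | ht
  · exact (hlim ⊤ g.top_mem).limsup_eq.le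
  · obtain ⟨q, hqa, hqp, hqt, hql⟩ := g.exists_strictAnti_tendsto ht
    have h1 : Tendsto (fun n => v (q n)) atTop (𝓝 (v t)) :=
      (hv t).tendsto.comp (tendsto_nhdsWithin_iff.2
        ⟨hql, Eventually.of_forall fun n => (hqt n).le⟩)
    refine ge_of_tendsto' h1 fun k => ?_
    rw [← (hlim (q k) (hqp k)).limsup_eq]
    refine limsup_le_limsup (Eventually.of_forall fun n => hd n (hqt k).le) ?_
      (hlim _ (hqp k)).isBoundedUnder_le
    exact IsBoundedUnder.isCoboundedUnder_le
      ⟨0, eventually_map.2 (Eventually.of_forall fun n => hnn n t)⟩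

lemma RefiningGrid.ofReal_sub_le_liminf (hd : ∀ n, Monotone (d n))
    (hv : ∀ t, ContinuousWithinAt v (Ici t) t)
    (hlim : ∀ q ∈ g.points, Tendsto (fun n => d n q) atTop (𝓝 (v q))) (t : ι) :
    ENNReal.ofReal (v ⊤ - v t) ≤ liminf (fun n => ENNReal.ofReal (d n ⊤ - d n t)) atTop := by
  rcases eq_or_lt_of_le (le_top : t ≤ ⊤) with rfl | ht
  · simp
  · obtain ⟨q, hqa, hqp, hqt, hql⟩ := g.exists_strictAnti_tendsto ht
    have h1 : Tendsto (fun n => ENNReal.ofReal (v ⊤ - v (q n))) atTop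
        (𝓝 (ENNReal.ofReal (v ⊤ - v t))) :=
      ENNReal.tendsto_ofReal (tendsto_const_nhds.sub ((hv t).tendsto.comp
        (tendsto_nhdsWithin_iff.2 ⟨hql, Eventually.of_forall fun n => (hqt n).le⟩)))
    refine le_of_tendsto' h1 fun k => ?_
    have h2 : Tendsto (fun n => ENNReal.ofReal (d n ⊤ - d n (q k))) atTop
        (𝓝 (ENNReal.ofReal (v ⊤ - v (q k)))) :=
      ENNReal.tendsto_ofReal ((hlim ⊤ g.top_mem).sub (hlim _ (hqp k)))
    rw [← h2.liminf_eq]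
    refine liminf_le_liminf (Eventually.of_forall fun n => ?_)
    exact ENNReal.ofReal_le_ofReal (sub_le_sub_left (hd n (hqt k).le) _)

/-- Increasing functions converging on the grid to a right-continuous increasing function, and
asymptotically as large as possible at its jumps, have upper limit that function. -/
lemma RefiningGrid.limsup_eq_of_tendsto (hd : ∀ n, Monotone (d n)) (hd0 : ∀ n, d n ⊥ = 0)
    (hvm : Monotone v) (hv : ∀ t, ContinuousWithinAt v (Ici t) t)
    (hlim : ∀ q ∈ g.points, Tendsto (fun n => d n q) atTop (𝓝 (v q)))
    (hjump : ∀ t, Function.leftLim v t < v t →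
      liminf (fun n => ENNReal.ofReal (d n ⊤ - d n t)) atTop = ENNReal.ofReal (v ⊤ - v t)) (t : ι) :
    limsup (fun n => d n t) atTop = v t := by
  have hnn : ∀ n t, 0 ≤ d n t := fun n t => hd0 n ▸ hd n bot_le
  have hbdd : ∀ t, IsBoundedUnder (· ≤ ·) atTop fun n => d n t := fun t =>
    (hlim ⊤ g.top_mem).isBoundedUnder_le.mono_le (Eventually.of_forall fun n => hd n le_top)
  have hcob : ∀ t, IsCoboundedUnder (· ≤ ·) atTop fun n => d n t := fun t =>
    IsBoundedUnder.isCoboundedUnder_le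
      ⟨0, eventually_map.2 (Eventually.of_forall fun n => hnn n t)⟩
  have hle := limsup_le_of_tendsto hd hd0 hv hlim t
  refine le_antisymm hle ?_
  by_cases hj : Function.leftLim v t < v t
  -- If the upper limit were below some `a < v t`, the remaining increments would eventually exceed
  -- `d n ⊤ - a`. Their lower limit would then be larger than the prescribed `v ⊤ - v t`.
  · by_contra hlt
    obtain ⟨a, ha1, ha2⟩ := _root_.exists_between (not_le.1 hlt)
    have h1 := eventually_lt_of_limsup_lt ha1 (hbdd t)
    have h2 : Tendsto (fun n => ENNReal.ofReal (d n ⊤ - a)) atTop (𝓝 (ENNReal.ofReal (v ⊤ - a))) :=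
      ENNReal.tendsto_ofReal ((hlim ⊤ g.top_mem).sub_const a)
    have h3 : ENNReal.ofReal (v ⊤ - a) ≤ ENNReal.ofReal (v ⊤ - v t) := by
      rw [← hjump t hj, ← h2.liminf_eq]
      refine liminf_le_liminf ?_
      filter_upwards [h1] with n hn
      exact ENNReal.ofReal_le_ofReal (sub_le_sub_left hn.le _)
    have h4 : v t ≤ v ⊤ := hvm le_top
    rw [ENNReal.ofReal_le_ofReal_iff (by linarith)] at h3
    linarith
  · rcases eq_or_ne t ⊥ with rfl | ht
    · exact (hlim ⊥ g.bot_mem).limsup_eq.ge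
    -- Without a jump it suffices to reach the left limit, and grid points before `t` give this by
    -- monotonicity.
    · refine (not_lt.1 hj).trans ?_
      have hne : (𝓝[<] t).NeBot := (g.tendsto_below ht).neBot
      refine le_of_tendsto ((hvm.tendsto_leftLim t).comp (g.tendsto_below ht)) ?_
      refine Eventually.of_forall fun k => ?_
      obtain ⟨i, hi, h1, h2, -⟩ := g.below_spec k ht
      have hmem : g.below k t ∈ g.points := h1 ▸ g.pt_mem hi.le
      rw [Function.comp_apply, ← (hlim _ hmem).limsup_eq]
      exact limsup_le_limsup (Eventually.of_forall fun n => hd n (g.below_lt k ht).le) (hcob _)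
        (hbdd t)

end PathLimit

lemma measurable_limsup_aux {α : Type*} {mα : MeasurableSpace α} {f : ℕ → α → ℝ}
    (hf : ∀ n, Measurable (f n)) : Measurable fun a => limsup (fun n => f n a) atTop :=
  Measurable.limsup hf

/-! ### Doob–Meyer decomposition of a bounded submartingale -/

section Compensator

variable {Ω ι : Type*} {m : MeasurableSpace Ω} [LinearOrder ι] [OrderBot ι] [OrderTop ι]
  [TopologicalSpace ι] [OrderTopology ι] [MeasurableSpace ι] [BorelSpace ι]
  [SecondCountableTopology ι] [DenselyOrdered ι] [CompactIccSpace ι]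
  {g : RefiningGrid ι} {𝓕 : Filtration ι m} {P : Measure Ω} {X : ι → Ω → ℝ} {c : ℝ}
  [IsProbabilityMeasure P]

lemma IncreasingProcess.lintegral_top_sub_lt_top (V : IncreasingProcess Ω ι)
    (hV2 : MemLp (V.toFun ⊤) 2 P) :
    ∫⁻ ω, ∫⁻ t, ENNReal.ofReal (V.toFun ⊤ ω - V.toFun t ω) ∂V.pathMeasure ω ∂P < ∞ := by
  have h1 : ∀ ω, ∫⁻ t, ENNReal.ofReal (V.toFun ⊤ ω - V.toFun t ω) ∂V.pathMeasure ω ≤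
      ENNReal.ofReal (V.toFun ⊤ ω ^ 2) := by
    intro ω
    calc ∫⁻ t, ENNReal.ofReal (V.toFun ⊤ ω - V.toFun t ω) ∂V.pathMeasure ω
        ≤ ∫⁻ t, ENNReal.ofReal (V.toFun ⊤ ω) ∂V.pathMeasure ω := by
          refine lintegral_mono fun t => ENNReal.ofReal_le_ofReal ?_
          linarith [V.nonneg t ω]
      _ = ENNReal.ofReal (V.toFun ⊤ ω ^ 2) := by
          rw [lintegral_const, V.pathMeasure_univ, sq, ENNReal.ofReal_mul (V.nonneg _ _)]
  refine (lintegral_mono h1).trans_lt ?_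
  exact hV2.integrable_sq.lintegral_lt_top

/-- The approximating increasing processes have upper limit `V`, for all times almost surely. -/
lemma ae_limsup_eq_of_isGridCompensator {D : ℕ → ι → Ω → ℝ}
    (hD : ∀ n, IsGridCompensator g 𝓕 P X n (D n)) {V : IncreasingProcess Ω ι}
    (hV : IsCompensatorOnPoints g 𝓕 P X V)
    (hlim : ∀ᵐ ω ∂P, ∀ q ∈ g.points, Tendsto (fun n => D n q ω) atTop (𝓝 (V.toFun q ω))) :
    ∀ᵐ ω ∂P, ∀ t, limsup (fun n => D n t ω) atTop = V.toFun t ω := by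
  set f : ℕ → ι × Ω → ℝ≥0∞ := fun n p => ENNReal.ofReal (D n ⊤ p.2 - D n p.1 p.2) with hf
  have hfm : ∀ n, Measurable (f n) := by
    intro n
    have h1 : Measurable (Function.uncurry (D n)) :=
      (hD n).predictable.mono predictable_le_prod le_rfl
    exact ((h1.comp (measurable_const.prodMk measurable_snd)).sub h1).ennreal_ofReal
  set F : ι × Ω → ℝ≥0∞ := fun p => liminf (fun n => f n p) atTop with hF
  have hFm : Measurable F := Measurable.liminf hfm
  -- Fatou for the Doléans measure of `V`, together with the energy inequality for each `D n`.
  have hfat : ∫⁻ p, F p ∂V.doleans P ≤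
      ∫⁻ ω, ∫⁻ t, ENNReal.ofReal (V.toFun ⊤ ω - V.toFun t ω) ∂V.pathMeasure ω ∂P := by
    refine (lintegral_liminf_le hfm).trans ?_
    refine liminf_le_of_le (by isBoundedDefault) fun b hb => ?_
    obtain ⟨n, hn⟩ := hb.exists
    exact hn.trans ((hD n).energy V hV)
  rw [V.lintegral_doleans hFm] at hfat
  have hle : ∀ᵐ ω ∂P, ∀ t, ENNReal.ofReal (V.toFun ⊤ ω - V.toFun t ω) ≤ F (t, ω) := by
    filter_upwards [hlim] with ω hω
    exact RefiningGrid.ofReal_sub_le_liminf (d := fun n t => D n t ω) (v := fun t => V.toFun t ω)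
      (fun n => (hD n).mono ω) (V.rightCont ω) hω
  have hae := ae_eq_of_ae_le_of_lintegral_le (hle.mono fun ω hω => lintegral_mono hω)
    (V.lintegral_top_sub_lt_top hV.memLp).ne
    (V.measurable_lintegral_pathMeasure hFm).aemeasurable hfat
  filter_upwards [hae, hle, hlim] with ω h1 h2 h3
  have hfin : ∫⁻ t, ENNReal.ofReal (V.toFun ⊤ ω - V.toFun t ω) ∂V.pathMeasure ω ≠ ∞ := by
    refine ne_top_of_le_ne_top ?_ (lintegral_mono (g := fun _ => ENNReal.ofReal (V.toFun ⊤ ω))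
      fun t => ENNReal.ofReal_le_ofReal ?_)
    · rw [lintegral_const]
      exact ENNReal.mul_ne_top ENNReal.ofReal_ne_top (measure_ne_top _ _)
    · linarith [V.nonneg t ω]
  have h4 := ae_eq_of_ae_le_of_lintegral_le (Eventually.of_forall h2) hfin
    (hFm.comp measurable_prodMk_right).aemeasurable h1.ge
  refine RefiningGrid.limsup_eq_of_tendsto (d := fun n t => D n t ω)
    (v := fun t => V.toFun t ω) (fun n => (hD n).mono ω) (fun n => (hD n).bot ω) (V.mono ω)
    (V.rightCont ω) h3 fun t ht => ?_
  -- The two integrands agree almost everywhere for the path measure. A jump time is an atom, so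
  -- they agree there.
  have h5 : V.pathMeasure ω {t} ≠ 0 := by
    rw [V.pathMeasure_singleton]
    simpa using ht
  by_contra hne
  refine h5 (measure_mono_null ?_ h4)
  rintro s rfl
  exact fun h => hne h.symm

/-- The limit at the grid points extends to a right-continuous increasing `V`. Up to a null set of
paths it is the upper limit, at all times at once, of predictable processes, and is therefore
predictable after modification. The hypothesis on means replaces right-continuity of the paths of
`X`. -/
lemma exists_predictable_compensator (g : RefiningGrid ι) (h𝓕 : UsualConditions 𝓕 P)
    (hX : Submartingale X 𝓕 P) (hXc : ∀ t, ∀ᵐ ω ∂P, X t ω ∈ Icc 0 c)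
    (hXrc : ∀ (t : ι) (q : ℕ → ι), StrictAnti q → (∀ n, t < q n) → Tendsto q atTop (𝓝 t) →
      Tendsto (fun n => ∫ ω, X (q n) ω ∂P) atTop (𝓝 (∫ ω, X t ω ∂P))) :
    ∃ V : IncreasingProcess Ω ι, Measurable[𝓕.predictable] (Function.uncurry V.toFun) ∧
      MemLp (V.toFun ⊤) 2 P ∧ Martingale (fun t ω => X t ω - V.toFun t ω) 𝓕 P := by
  classical
  obtain ⟨Φ, D, hΦ, hD⟩ := exists_isGridCompensator_tendsto g hX hXc
  have hΦi : Integrable Φ P := hΦ.integrable (by norm_num)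
  have hX2 : MemLp (X ⊤) 2 P := by
    refine MemLp.mono_exponent (q := ∞) ?_ le_top
    refine memLp_top_of_bound (hX.integrable ⊤).1 c ?_
    filter_upwards [hXc ⊤] with ω hω
    rw [Real.norm_of_nonneg hω.1]
    exact hω.2
  -- The only possible limit: `X - U` has to be the martingale with terminal value `X ⊤ - Φ`.
  set U : ι → Ω → ℝ := fun t => X t - P[X ⊤ - Φ|𝓕 t] with hU
  have hUm : ∀ t, Measurable[𝓕 t] (U t) := fun t =>
    (hX.stronglyMeasurable t).measurable.sub stronglyMeasurable_condExp.measurable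
  have hUi : ∀ t, Integrable (U t) P := fun t => (hX.integrable t).sub integrable_condExp
  have hUint : ∀ t (F : Set Ω), MeasurableSet[𝓕 t] F →
      ∫ ω in F, U t ω ∂P = ∫ ω in F, X t ω ∂P - ∫ ω in F, (X ⊤ - Φ) ω ∂P := by
    intro t F hF
    rw [← setIntegral_condExp (𝓕.le t) ((hX.integrable ⊤).sub hΦi) hF]
    exact integral_sub (hX.integrable t).integrableOn integrable_condExp.integrableOn
  obtain ⟨V, hVm, hV2, hVU, hVlim⟩ := exists_increasingProcess_of_tendsto (g := g) (D := D) (U := U)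
    h𝓕 (fun n => (hD n).1.mono) (fun n => (hD n).1.bot) hUm
    (hX2.sub ((hX2.sub hΦ).condExp (by norm_num))) hUi
    (fun q hq => IsGridCompensator.ae_tendsto hX hΦ hD hq) (by
      intro t q hqa hqt hql
      have h1 := hUint t univ MeasurableSet.univ
      have h2 := fun n => hUint (q n) univ MeasurableSet.univ
      simp only [Measure.restrict_univ] at h1 h2
      simp_rw [h1, h2]
      exact (hXrc t q hqa hqt hql).sub_const _)
  have hVi : ∀ t, Integrable (V.toFun t) P := fun t => (V.memLp hV2 t).integrable (by norm_num)
  have hVint : ∀ t ∈ g.points, ∀ F, MeasurableSet[𝓕 t] F → ∫ ω in F, V.toFun t ω ∂P =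
      ∫ ω in F, X t ω ∂P - ∫ ω in F, (X ⊤ - Φ) ω ∂P := by
    intro t ht F hF
    rw [← hUint t F hF]
    refine integral_congr_ae (ae_restrict_of_ae ?_)
    filter_upwards [hVU] with ω hω
    exact hω t ht
  have hcomp : IsCompensatorOnPoints g 𝓕 P X V := by
    refine ⟨hVm, hV2, fun s hs t ht hst F hF => ?_⟩
    rw [integral_sub (hVi t).integrableOn (hVi s).integrableOn,
      integral_sub (hX.integrable t).integrableOn (hX.integrable s).integrableOn,
      hVint t ht F (𝓕.mono hst _ hF), hVint s hs F hF]
    ring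
  -- The identity holds at grid points and is carried to `t` by grid points decreasing to it: on the
  -- left by dominated convergence, on the right by continuity of the mean of `X`.
  have hmart : ∀ t F, MeasurableSet[𝓕 t] F →
      ∫ ω in F, (V.toFun ⊤ ω - V.toFun t ω) ∂P = ∫ ω in F, (X ⊤ ω - X t ω) ∂P := by
    intro t F hF
    rcases eq_or_lt_of_le (le_top : t ≤ ⊤) with rfl | ht
    · simp
    obtain ⟨q, hqa, hqp, hqt, hql⟩ := g.exists_strictAnti_tendsto ht
    have h1 : Tendsto (fun n => ∫ ω in F, (V.toFun ⊤ ω - V.toFun (q n) ω) ∂P) atTop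
        (𝓝 (∫ ω in F, (V.toFun ⊤ ω - V.toFun t ω) ∂P)) := by
      refine tendsto_integral_of_dominated_convergence (fun ω => V.toFun ⊤ ω)
        (fun n => ((hVi _).sub (hVi _)).1.restrict) (hVi ⊤).integrableOn
        (fun n => Eventually.of_forall fun ω => ?_) (Eventually.of_forall fun ω => ?_)
      · rw [Real.norm_of_nonneg (sub_nonneg.2 (V.mono ω le_top))]
        linarith [V.nonneg (q n) ω]
      · exact tendsto_const_nhds.sub ((V.rightCont ω t).tendsto.comp
          (tendsto_nhdsWithin_iff.2 ⟨hql, Eventually.of_forall fun n => (hqt n).le⟩))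
    -- A submartingale has nonnegative increments over `F` and over its complement, so the part over
    -- `F` is squeezed by the full mean increment.
    have h2 : Tendsto (fun n => ∫ ω in F, (X (q n) ω - X t ω) ∂P) atTop (𝓝 0) := by
      have h3 : Tendsto (fun n => ∫ ω, X (q n) ω ∂P - ∫ ω, X t ω ∂P) atTop (𝓝 0) := by
        simpa using (hXrc t q hqa hqt hql).sub_const (∫ ω, X t ω ∂P)
      refine squeeze_zero (fun n => ?_) (fun n => ?_) h3
      · have := hX.setIntegral_le (hqt n).le hF
        rw [integral_sub (hX.integrable _).integrableOn (hX.integrable _).integrableOn]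
        linarith
      · have := hX.setIntegral_le (hqt n).le hF.compl
        have e1 := integral_add_compl (𝓕.le t _ hF) (hX.integrable (q n))
        have e2 := integral_add_compl (𝓕.le t _ hF) (hX.integrable t)
        rw [integral_sub (hX.integrable _).integrableOn (hX.integrable _).integrableOn]
        linarith
    have h4 : Tendsto (fun n => ∫ ω in F, (V.toFun ⊤ ω - V.toFun (q n) ω) ∂P) atTop
        (𝓝 (∫ ω in F, (X ⊤ ω - X t ω) ∂P)) := by
      have h5 := (tendsto_const_nhds (x := ∫ ω in F, (X ⊤ ω - X t ω) ∂P)).sub h2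
      rw [sub_zero] at h5
      refine h5.congr fun n => ?_
      rw [hcomp.setIntegral _ (hqp n) _ g.top_mem le_top F (𝓕.mono (hqt n).le _ hF)]
      simp only [integral_sub (hX.integrable _).integrableOn (hX.integrable _).integrableOn]
      ring
    exact tendsto_nhds_unique h1 h4
  have hlims := ae_limsup_eq_of_isGridCompensator (fun n => (hD n).1) hcomp hVlim
  set G : Set Ω := {ω | ∀ t, limsup (fun n => D n t ω) atTop = V.toFun t ω} with hG
  have hGm : ∀ t, MeasurableSet[𝓕 t] G := fun t => by
    have := (h𝓕.measurableSet_of_null (N := Gᶜ) hlims t).compl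
    rwa [compl_compl] at this
  have hind : ∀ ω ∈ G, ∀ t, G.indicator (V.toFun t) ω = V.toFun t ω := fun ω hω t =>
    indicator_of_mem hω _
  let V' : IncreasingProcess Ω ι :=
    { toFun := fun t => G.indicator (V.toFun t)
      mono := by
        intro ω s t hst
        by_cases hω : ω ∈ G
        · simp only [indicator_of_mem hω]
          exact V.mono ω hst
        · simp [indicator_of_notMem hω]
      rightCont := by
        intro ω t
        by_cases hω : ω ∈ G
        · simp only [indicator_of_mem hω]
          exact V.rightCont ω t
        · simp only [indicator_of_notMem hω]
          exact continuousWithinAt_const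
      measurable := fun t => (V.measurable t).indicator (𝓕.le t _ (hGm t))
      bot := by
        intro ω
        by_cases hω : ω ∈ G
        · rw [indicator_of_mem hω, V.bot]
        · simp [indicator_of_notMem hω] }
  have hVV' : ∀ t, V'.toFun t =ᵐ[P] V.toFun t := by
    intro t
    filter_upwards [hlims] with ω hω
    exact hind ω hω t
  refine ⟨V', ?_, hV2.ae_eq (hVV' ⊤).symm, ?_⟩
  · have h1 := measurable_limsup_aux (mα := 𝓕.predictable)
      (f := fun n p => Function.uncurry (D n) p) fun n => (hD n).1.predictable
    have h2 := measurable_predictable_indicator (𝓕 := 𝓕)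
      (f := fun t ω => limsup (fun n => D n t ω) atTop) h1 (hGm ⊥)
    have h3 : V'.toFun = fun t => G.indicator fun ω => limsup (fun n => D n t ω) atTop := by
      funext t ω
      by_cases hω : ω ∈ G
      · simp [V', indicator_of_mem hω, hω t]
      · simp [V', indicator_of_notMem hω]
    rw [h3]
    exact h2
  · have hM : Martingale (fun t => P[X ⊤ - V.toFun ⊤|𝓕 t]) 𝓕 P := martingale_condExp _ _ _
    refine hM.congr_ae (fun t => ?_) fun t => ?_
    · have h1 := ae_eq_condExp_of_forall_setIntegral_eq (𝓕.le t)
        ((hX.integrable ⊤).sub (hVi ⊤)) (g := fun ω => X t ω - V.toFun t ω)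
        (fun _ _ _ => ((hX.integrable t).sub (hVi t)).integrableOn) (fun F hF _ => ?_)
        ((hX.stronglyMeasurable t).measurable.sub
          (hVm t)).stronglyMeasurable.aestronglyMeasurable
      · filter_upwards [h1, hVV' t] with ω a b
        rw [← a, b]
      · have h2 := hmart t F hF
        rw [integral_sub (hVi _).integrableOn (hVi _).integrableOn,
          integral_sub (hX.integrable _).integrableOn (hX.integrable _).integrableOn] at h2
        simp only [Pi.sub_apply]
        rw [integral_sub (hX.integrable _).integrableOn (hVi _).integrableOn,
          integral_sub (hX.integrable _).integrableOn (hVi _).integrableOn]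
        linarith
    · exact ((hX.stronglyMeasurable t).measurable.sub
        ((hVm t).indicator (hGm t))).stronglyMeasurable

end Compensator

/-! ### Linearity of compensators; the bounded martingale case -/

section PredictableCompensator

variable {Ω ι H : Type*} {m : MeasurableSpace Ω} [LinearOrder ι] [OrderBot ι] [OrderTop ι]
  [TopologicalSpace ι] [OrderTopology ι] [MeasurableSpace ι] [BorelSpace ι]
  [SecondCountableTopology ι] [DenselyOrdered ι] [CompactIccSpace ι]
  {g : RefiningGrid ι} {𝓕 : Filtration ι m} {P : Measure Ω} {X : ι → Ω → ℝ} {c : ℝ}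
  [IsProbabilityMeasure P]
  [NormedAddCommGroup H] [InnerProductSpace ℝ H] [CompleteSpace H]

/-- `V` is a predictable increasing process such that `X - V` is a martingale. -/
structure IsPredictableCompensator (𝓕 : Filtration ι m) (P : Measure Ω) (X : ι → Ω → ℝ)
    (V : IncreasingProcess Ω ι) : Prop where
  predictable : Measurable[𝓕.predictable] (Function.uncurry V.toFun)
  martingale : Martingale (fun t ω => X t ω - V.toFun t ω) 𝓕 P

lemma IncreasingProcess.locallyBoundedVariationOn (V : IncreasingProcess Ω ι) (ω : Ω) :
    LocallyBoundedVariationOn (fun t => V.toFun t ω) univ :=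
  ((V.mono ω).monotoneOn univ).locallyBoundedVariationOn

lemma LocallyBoundedVariationOn.const_mul_real {f : ι → ℝ} {s : Set ι}
    (hf : LocallyBoundedVariationOn f s) (a : ℝ) :
    LocallyBoundedVariationOn (fun t => a * f t) s :=
  (LipschitzWith.of_dist_le_mul (K := ‖a‖₊) (f := fun x : ℝ => a * x) fun x y => by
    rw [Real.dist_eq, ← mul_sub, abs_mul, coe_nnnorm, Real.norm_eq_abs,
      Real.dist_eq]).comp_locallyBoundedVariationOn hf

lemma measurable_linear_combination_aux {α : Type*} {mα : MeasurableSpace α}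
    {f₁ f₂ f₃ f₄ f₅ : α → ℝ} (h₁ : Measurable f₁) (h₂ : Measurable f₂) (h₃ : Measurable f₃)
    (h₄ : Measurable f₄) (h₅ : Measurable f₅) (a b c : ℝ) :
    StronglyMeasurable fun x => (a * f₁ x - -b * f₂ x) - ((f₅ x - c * f₃ x) - -c * f₄ x) :=
  (((h₁.const_mul _).sub (h₂.const_mul _)).sub
    ((h₅.sub (h₃.const_mul _)).sub (h₄.const_mul _))).stronglyMeasurable

/-- Compensators depend linearly on the compensated process. -/
lemma IsPredictableCompensator.ae_eq_combination (g : RefiningGrid ι) (h𝓕 : UsualConditions 𝓕 P)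
    {X₁ X₂ X₃ X₄ X₅ : ι → Ω → ℝ} {V₁ V₂ V₃ V₄ V₅ : IncreasingProcess Ω ι}
    (h₁ : IsPredictableCompensator 𝓕 P X₁ V₁) (h₂ : IsPredictableCompensator 𝓕 P X₂ V₂)
    (h₃ : IsPredictableCompensator 𝓕 P X₃ V₃) (h₄ : IsPredictableCompensator 𝓕 P X₄ V₄)
    (h₅ : IsPredictableCompensator 𝓕 P X₅ V₅) {a b c : ℝ}
    (hX : ∀ t ω, X₅ t ω = a * X₁ t ω + b * X₂ t ω + c * (X₃ t ω - X₄ t ω)) (t : ι) :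
    ∀ᵐ ω ∂P, V₅.toFun t ω =
      a * V₁.toFun t ω + b * V₂.toFun t ω + c * (V₃.toFun t ω - V₄.toFun t ω) := by
  -- Sums are written as differences, so that finite variation follows from `sub_real` and
  -- `const_mul_real` alone.
  have h := predictable_martingale_eq_zero g h𝓕 (D := fun t ω =>
    (a * V₁.toFun t ω - -b * V₂.toFun t ω) -
      ((V₅.toFun t ω - c * V₃.toFun t ω) - -c * V₄.toFun t ω)) ?_ ?_ ?_ ?_ ?_ t
  · filter_upwards [h] with ω hω
    simp only [Pi.zero_apply] at hω
    linarith
  · have hM := (h₅.martingale.sub (((h₁.martingale.smul a).add (h₂.martingale.smul b)).add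
      ((h₃.martingale.sub h₄.martingale).smul c)))
    convert hM using 1
    ext t ω
    simp only [Pi.sub_apply, Pi.add_apply, Pi.smul_apply, smul_eq_mul, hX]
    ring
  · exact measurable_linear_combination_aux (mα := 𝓕.predictable) h₁.predictable h₂.predictable
      h₃.predictable h₄.predictable h₅.predictable a b c
  · refine Eventually.of_forall fun ω t => ?_
    exact (((V₁.rightCont ω t).const_mul _).sub ((V₂.rightCont ω t).const_mul _)).sub
      (((V₅.rightCont ω t).sub ((V₃.rightCont ω t).const_mul _)).sub
        ((V₄.rightCont ω t).const_mul _))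
  · refine Eventually.of_forall fun ω => ?_
    have hb := fun V : IncreasingProcess Ω ι => V.locallyBoundedVariationOn ω
    exact (((hb V₁).const_mul_real a).sub_real ((hb V₂).const_mul_real (-b))).sub_real
      (((hb V₅).sub_real ((hb V₃).const_mul_real c)).sub_real ((hb V₄).const_mul_real (-c)))
  · refine Eventually.of_forall fun ω => ?_
    simp [IncreasingProcess.bot]

lemma IsPredictableCompensator.integrable {V : IncreasingProcess Ω ι}
    (h : IsPredictableCompensator 𝓕 P X V) (hX : ∀ t, Integrable (X t) P) (t : ι) :
    Integrable (V.toFun t) P := by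
  have := (hX t).sub (h.martingale.integrable t)
  refine this.congr (Eventually.of_forall fun ω => ?_)
  simp

/-- The martingale `X - V` has constant mean, equal to that of `X ⊥`, which is nonnegative. -/
lemma IsPredictableCompensator.integral_le {V : IncreasingProcess Ω ι}
    (h : IsPredictableCompensator 𝓕 P X V) (hX : ∀ t, Integrable (X t) P)
    (hX0 : ∀ ω, 0 ≤ X ⊥ ω) (t : ι) : ∫ ω, V.toFun t ω ∂P ≤ ∫ ω, X t ω ∂P := by
  have h1 := h.martingale.setIntegral_eq (bot_le : ⊥ ≤ t) MeasurableSet.univ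
  simp only [Measure.restrict_univ] at h1
  rw [integral_sub (hX t) (h.integrable hX t), integral_sub (hX ⊥) (h.integrable hX ⊥)] at h1
  simp only [IncreasingProcess.bot, integral_zero, sub_zero] at h1
  have : 0 ≤ ∫ ω, X ⊥ ω ∂P := integral_nonneg fun ω => hX0 ω
  linarith

lemma ae_sq_norm_mem_Icc {Y : ι → Ω → H} (hY : Martingale Y 𝓕 P)
    (hYc : ∀ᵐ ω ∂P, ‖Y ⊤ ω‖ ≤ c) (t : ι) : ∀ᵐ ω ∂P, ‖Y t ω‖ ^ 2 ∈ Icc 0 (c ^ 2) := by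
  have h := ae_bdd_norm_condExp_of_ae_bdd_norm (m := 𝓕 t) hYc
  filter_upwards [h, hY.2 t ⊤ le_top] with ω h1 h2
  rw [h2] at h1
  exact ⟨by positivity, pow_le_pow_left₀ (norm_nonneg _) h1 2⟩

lemma exists_isPredictableCompensator_of_bdd [TopologicalSpace.SeparableSpace H]
    (g : RefiningGrid ι) (h𝓕 : UsualConditions 𝓕 P) {Y : ι → Ω → H}
    (hY : Martingale Y 𝓕 P) (hYc : ∀ᵐ ω ∂P, ‖Y ⊤ ω‖ ≤ c) :
    ∃ V : IncreasingProcess Ω ι, IsPredictableCompensator 𝓕 P (fun t ω => ‖Y t ω‖ ^ 2) V := by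
  have hY2 : ∀ t, MemLp (Y t) 2 P := memLp_of_martingale hY
    ((memLp_top_of_bound (hY.integrable ⊤).1 c hYc).mono_exponent le_top)
  obtain ⟨V, h1, -, h2⟩ := exists_predictable_compensator g h𝓕 (submartingale_sq_norm hY hY2)
    (ae_sq_norm_mem_Icc hY hYc)
    (fun t q hqa hqt hql => tendsto_integral_sq_norm h𝓕 hY hY2 hqa hqt hql)
  exact ⟨V, h1, h2⟩

end PredictableCompensator

/-! ### Truncation and convergence estimates -/

section Truncation

variable {Ω H : Type*} {m : MeasurableSpace Ω} {P : Measure Ω} [IsProbabilityMeasure P]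
  [NormedAddCommGroup H] [InnerProductSpace ℝ H] [CompleteSpace H]

lemma exists_truncation {m' : MeasurableSpace Ω} (hm' : m' ≤ m) {f : Ω → H}
    (hfm : StronglyMeasurable[m'] f) (hf : MemLp f 2 P) {ε : ℝ}
    (hε : 0 < ε) : ∃ (ξ : Ω → H) (c : ℝ), StronglyMeasurable[m'] ξ ∧ (∀ ω, ‖ξ ω‖ ≤ c) ∧
      (∀ ω, ‖ξ ω‖ ≤ ‖f ω‖) ∧ ∫ ω, ‖f ω - ξ ω‖ ^ 2 ∂P ≤ ε := by
  set ξ : ℕ → Ω → H := fun n => {ω | ‖f ω‖ ≤ n}.indicator f with hξ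
  have hm : ∀ n, StronglyMeasurable[m'] (ξ n) := fun n =>
    hfm.indicator (hfm.norm.measurable measurableSet_Iic)
  have hle : ∀ n ω, ‖ξ n ω‖ ≤ ‖f ω‖ := fun n ω => norm_indicator_le_norm_self _ _
  have hlim : Tendsto (fun n => ∫ ω, ‖f ω - ξ n ω‖ ^ 2 ∂P) atTop (𝓝 (∫ _, (0 : ℝ) ∂P)) := by
    refine tendsto_integral_of_dominated_convergence (fun ω => ‖f ω‖ ^ 2)
      (fun n => (((hfm.sub (hm n)).norm.pow 2).mono hm').aestronglyMeasurable) hf.integrable_sq_norm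
      (fun n => Eventually.of_forall fun ω => ?_) (Eventually.of_forall fun ω => ?_)
    · by_cases h : ω ∈ {ω | ‖f ω‖ ≤ n}
      · simp [hξ, indicator_of_mem h]
      · simp [hξ, indicator_of_notMem h]
    · refine tendsto_const_nhds.congr' ?_
      obtain ⟨N, hN⟩ := exists_nat_ge ‖f ω‖
      filter_upwards [eventually_ge_atTop N] with n hn
      have h : ω ∈ {ω | ‖f ω‖ ≤ n} := hN.trans (Nat.cast_le.2 hn)
      simp [hξ, indicator_of_mem h]
  rw [integral_zero] at hlim
  obtain ⟨n, hn⟩ := (hlim.eventually_lt_const hε).exists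
  refine ⟨ξ n, n, hm n, fun ω => ?_, hle n, hn.le⟩
  by_cases h : ω ∈ {ω | ‖f ω‖ ≤ n}
  · simpa [hξ, indicator_of_mem h] using h
  · simp [hξ, indicator_of_notMem h]

lemma integral_sq_norm_add_le {f f' : Ω → H} (hf : MemLp f 2 P) (hf' : MemLp f' 2 P) :
    ∫ ω, ‖f ω + f' ω‖ ^ 2 ∂P ≤ 2 * ∫ ω, ‖f ω‖ ^ 2 ∂P + 2 * ∫ ω, ‖f' ω‖ ^ 2 ∂P := by
  rw [← integral_const_mul, ← integral_const_mul, ← integral_add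
    (hf.integrable_sq_norm.const_mul 2) (hf'.integrable_sq_norm.const_mul 2)]
  refine integral_mono (hf.add hf').integrable_sq_norm
    ((hf.integrable_sq_norm.const_mul 2).add (hf'.integrable_sq_norm.const_mul 2)) fun ω => ?_
  have := parallelogram_law_with_norm ℝ (f ω) (f' ω)
  nlinarith [sq_nonneg ‖f ω - f' ω‖]

end Truncation

section UniformLimit

lemma continuousWithinAt_of_uniform_bound {α : Type*} [TopologicalSpace α] {s : Set α} {x : α}
    (hx : x ∈ s) {f : ℕ → α → ℝ} {v : α → ℝ} {r : ℕ → ℝ} (hr : Tendsto r atTop (𝓝 0))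
    (hf : ∀ n, ContinuousWithinAt (f n) s x) (h : ∀ n t, dist (f n t) (v t) ≤ r n) :
    ContinuousWithinAt v s x := by
  refine continuousWithinAt_of_locally_uniform_approx_of_continuousWithinAt hx fun u hu => ?_
  obtain ⟨ε, hε, hεu⟩ := Metric.mem_uniformity_dist.1 hu
  obtain ⟨n, hn⟩ := (hr.eventually_lt_const hε).exists
  refine ⟨univ, univ_mem, f n, hf n, fun t _ => hεu ?_⟩
  rw [dist_comm]
  exact (h n t).trans_lt hn

end UniformLimit

section Convergence

variable {Ω H : Type*} {m : MeasurableSpace Ω} {P : Measure Ω} [IsProbabilityMeasure P]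
  [NormedAddCommGroup H] [InnerProductSpace ℝ H] [CompleteSpace H]

lemma ae_summable_of_integral_le {b : ℕ → Ω → ℝ} (hb : ∀ n, Integrable (b n) P)
    (hb0 : ∀ n ω, 0 ≤ b n ω) {r : ℕ → ℝ} (hr : Summable r) (h : ∀ n, ∫ ω, b n ω ∂P ≤ r n) :
    (∀ᵐ ω ∂P, Summable fun n => b n ω) ∧ Integrable (fun ω => ∑' n, b n ω) P := by
  have hr0 : ∀ n, 0 ≤ r n := fun n => (integral_nonneg fun ω => hb0 n ω).trans (h n)
  have h1 : ∀ n, ∫⁻ ω, ENNReal.ofReal (b n ω) ∂P ≤ ENNReal.ofReal (r n) := by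
    intro n
    rw [← ofReal_integral_eq_lintegral_ofReal (hb n) (Eventually.of_forall (hb0 n))]
    exact ENNReal.ofReal_le_ofReal (h n)
  have hm : ∀ n, AEMeasurable (fun ω => ENNReal.ofReal (b n ω)) P := fun n =>
    (hb n).1.aemeasurable.ennreal_ofReal
  have h2 : ∫⁻ ω, ∑' n, ENNReal.ofReal (b n ω) ∂P < ∞ := by
    rw [lintegral_tsum hm]
    refine (ENNReal.tsum_le_tsum h1).trans_lt ?_
    rw [← ENNReal.ofReal_tsum_of_nonneg hr0 hr]
    exact ENNReal.ofReal_lt_top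
  have h3 : ∀ᵐ ω ∂P, Summable fun n => b n ω := by
    filter_upwards [ae_lt_top' (AEMeasurable.tsum hm) h2.ne] with ω hω
    have := ENNReal.summable_toReal hω.ne
    simpa only [ENNReal.toReal_ofReal (hb0 _ ω)] using this
  refine ⟨h3, ?_⟩
  have h4 : (fun ω => ∑' n, b n ω) =ᵐ[P] fun ω => (∑' n, ENNReal.ofReal (b n ω)).toReal := by
    filter_upwards [h3] with ω hω
    rw [← ENNReal.ofReal_tsum_of_nonneg (fun n => hb0 n ω) hω,
      ENNReal.toReal_ofReal (tsum_nonneg fun n => hb0 n ω)]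
  exact (integrable_congr h4).2 (integrable_toReal_of_lintegral_ne_top (AEMeasurable.tsum hm) h2.ne)

/-- Young's inequality bounds `|‖a‖² - ‖b‖²|` by `(1 + x) ‖b - a‖² + ‖b‖² / x`. With `x = 2 ^ k` the
rate `16 ^ (-k)` absorbs the growing factor while the second term tends to `0`. -/
lemma tendsto_setIntegral_sq_norm {f : ℕ → Ω → H} {f₀ : Ω → H} (hf : ∀ k, MemLp (f k) 2 P)
    (hf₀ : MemLp f₀ 2 P) (h : ∀ k, ∫ ω, ‖f₀ ω - f k ω‖ ^ 2 ∂P ≤ (1 / 16) ^ k) (F : Set Ω) :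
    Tendsto (fun k => ∫ ω in F, ‖f k ω‖ ^ 2 ∂P) atTop (𝓝 (∫ ω in F, ‖f₀ ω‖ ^ 2 ∂P)) := by
  have hpt : ∀ (x : ℝ), 0 < x → ∀ a b : H,
      |‖a‖ ^ 2 - ‖b‖ ^ 2| ≤ (1 + x) * ‖b - a‖ ^ 2 + x⁻¹ * ‖b‖ ^ 2 := by
    intro x hx a b
    have h1 : |‖b‖ - ‖a‖| ≤ ‖b - a‖ := abs_norm_sub_norm_le b a
    have h2 : ‖a‖ ≤ ‖b‖ + ‖b - a‖ := by linarith [(abs_le.1 h1).1]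
    have h3 : |‖a‖ ^ 2 - ‖b‖ ^ 2| ≤ ‖b - a‖ * (‖b - a‖ + 2 * ‖b‖) := by
      rw [sq_sub_sq, abs_mul, abs_of_nonneg (by positivity : 0 ≤ ‖a‖ + ‖b‖), abs_sub_comm ‖a‖,
        mul_comm]
      exact mul_le_mul h1 (by linarith) (by positivity) (norm_nonneg _)
    have h4 : 2 * (‖b - a‖ * ‖b‖) ≤ x * ‖b - a‖ ^ 2 + x⁻¹ * ‖b‖ ^ 2 := by
      have h5 : x * ‖b - a‖ ^ 2 + x⁻¹ * ‖b‖ ^ 2 - 2 * (‖b - a‖ * ‖b‖) =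
          x⁻¹ * (x * ‖b - a‖ - ‖b‖) ^ 2 := by
        field_simp
        ring
      have : 0 ≤ x⁻¹ * (x * ‖b - a‖ - ‖b‖) ^ 2 := by positivity
      linarith
    linarith
  rw [← tendsto_sub_nhds_zero_iff]
  have hb : Tendsto (fun k : ℕ => 2 * ((1 : ℝ) / 8) ^ k + (1 / 2) ^ k * ∫ ω, ‖f₀ ω‖ ^ 2 ∂P) atTop
      (𝓝 0) := by
    have h1 := tendsto_pow_atTop_nhds_zero_of_lt_one (r := (1 : ℝ) / 8) (by norm_num) (by norm_num)
    have h2 := tendsto_pow_atTop_nhds_zero_of_lt_one (r := (1 : ℝ) / 2) (by norm_num) (by norm_num)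
    simpa using (h1.const_mul 2).add (h2.mul_const (∫ ω, ‖f₀ ω‖ ^ 2 ∂P))
  refine squeeze_zero_norm (fun k => ?_) hb
  have hx : (0 : ℝ) < 2 ^ k := by positivity
  have i1 := ((hf k).integrable_sq_norm.sub hf₀.integrable_sq_norm).abs
  have i2 : Integrable (fun ω => (1 + (2 : ℝ) ^ k) * ‖f₀ ω - f k ω‖ ^ 2) P :=
    (hf₀.sub (hf k)).integrable_sq_norm.const_mul _
  have i3 : Integrable (fun ω => ((2 : ℝ) ^ k)⁻¹ * ‖f₀ ω‖ ^ 2) P :=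
    hf₀.integrable_sq_norm.const_mul _
  rw [← integral_sub (hf k).integrable_sq_norm.integrableOn hf₀.integrable_sq_norm.integrableOn,
    Real.norm_eq_abs]
  calc |∫ ω in F, (‖f k ω‖ ^ 2 - ‖f₀ ω‖ ^ 2) ∂P|
      ≤ ∫ ω in F, |‖f k ω‖ ^ 2 - ‖f₀ ω‖ ^ 2| ∂P := abs_integral_le_integral_abs
    _ ≤ ∫ ω, |‖f k ω‖ ^ 2 - ‖f₀ ω‖ ^ 2| ∂P :=
        setIntegral_le_integral i1 (Eventually.of_forall fun ω => abs_nonneg _)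
    _ ≤ ∫ ω, ((1 + (2 : ℝ) ^ k) * ‖f₀ ω - f k ω‖ ^ 2 + ((2 : ℝ) ^ k)⁻¹ * ‖f₀ ω‖ ^ 2) ∂P :=
        integral_mono i1 (i2.add i3) fun ω => hpt _ hx (f k ω) (f₀ ω)
    _ = (1 + (2 : ℝ) ^ k) * ∫ ω, ‖f₀ ω - f k ω‖ ^ 2 ∂P +
          ((2 : ℝ) ^ k)⁻¹ * ∫ ω, ‖f₀ ω‖ ^ 2 ∂P := by
        rw [integral_add i2 i3, integral_const_mul, integral_const_mul]
    _ ≤ 2 * (1 / 8) ^ k + (1 / 2) ^ k * ∫ ω, ‖f₀ ω‖ ^ 2 ∂P := by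
        have h1 : (1 : ℝ) ≤ 2 ^ k := one_le_pow₀ (by norm_num)
        have h2 : ((2 : ℝ) ^ k)⁻¹ = (1 / 2) ^ k := by rw [one_div, inv_pow]
        have h3 : ((1 : ℝ) / 8) ^ k = 2 ^ k * (1 / 16) ^ k := by
          rw [← mul_pow]
          norm_num
        rw [h2, h3]
        refine add_le_add ?_ le_rfl
        calc (1 + (2 : ℝ) ^ k) * ∫ ω, ‖f₀ ω - f k ω‖ ^ 2 ∂P
            ≤ (2 * 2 ^ k) * (1 / 16) ^ k :=
              mul_le_mul (by linarith) (h k) (integral_nonneg fun ω => by positivity) (by positivity)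
          _ = 2 * (2 ^ k * (1 / 16) ^ k) := by ring

end Convergence

/-! ### Predictable quadratic variation of a square integrable martingale -/

section Existence

variable {Ω ι H : Type*} {m : MeasurableSpace Ω} [LinearOrder ι] [OrderBot ι] [OrderTop ι]
  [TopologicalSpace ι] [OrderTopology ι] [MeasurableSpace ι] [BorelSpace ι]
  [SecondCountableTopology ι] [DenselyOrdered ι] [CompactIccSpace ι]
  {g : RefiningGrid ι} {𝓕 : Filtration ι m} {P : Measure Ω} {X : ι → Ω → ℝ} {c : ℝ}
  [IsProbabilityMeasure P]
  [NormedAddCommGroup H] [InnerProductSpace ℝ H] [CompleteSpace H]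

lemma RefiningGrid.le_of_le_on_points (g : RefiningGrid ι) {f : ι → ℝ} {b : ℝ}
    (hf : ∀ t, ContinuousWithinAt f (Ici t) t) (h : ∀ q ∈ g.points, f q ≤ b) (t : ι) : f t ≤ b := by
  have h0 := (hf t).tendsto.comp (g.tendsto_above t)
  refine le_of_tendsto' h0 fun n => ?_
  obtain ⟨φ, -, h1, h2⟩ := g.exists_above_index n
  refine h (g.above n t) ?_
  rw [h2 t]
  exact g.pt_mem (h1 t)

/-- The compensators of two bounded martingales are close if the martingales are. -/
lemma ae_forall_abs_sub_le [TopologicalSpace.SeparableSpace H]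
    (g : RefiningGrid ι) (h𝓕 : UsualConditions 𝓕 P) {Y Y' : ι → Ω → H}
    (hY : Martingale Y 𝓕 P) (hY' : Martingale Y' 𝓕 P) {c c' : ℝ} (hYc : ∀ᵐ ω ∂P, ‖Y ⊤ ω‖ ≤ c)
    (hYc' : ∀ᵐ ω ∂P, ‖Y' ⊤ ω‖ ≤ c') {V V' A B : IncreasingProcess Ω ι}
    (hV : IsPredictableCompensator 𝓕 P (fun t ω => ‖Y t ω‖ ^ 2) V)
    (hV' : IsPredictableCompensator 𝓕 P (fun t ω => ‖Y' t ω‖ ^ 2) V')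
    (hA : IsPredictableCompensator 𝓕 P (fun t ω => ‖Y' t ω - Y t ω‖ ^ 2) A)
    (hB : IsPredictableCompensator 𝓕 P (fun t ω => ‖Y' t ω + Y t ω‖ ^ 2) B) {s : ℝ} (hs : 0 < s) :
    ∀ᵐ ω ∂P, ∀ t, |V'.toFun t ω - V.toFun t ω| ≤
      (s ^ 2 * A.toFun ⊤ ω + s⁻¹ ^ 2 * B.toFun ⊤ ω) / 2 := by
  have key : ∀ σ : ℝ, σ ^ 2 = 1 → ∀ᵐ ω ∂P, ∀ t, σ * (V'.toFun t ω - V.toFun t ω) ≤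
      (s ^ 2 * A.toFun ⊤ ω + s⁻¹ ^ 2 * B.toFun ⊤ ω) / 2 := by
    intro σ hσ
    -- The squared norm of this martingale is `s² ‖Y' - Y‖² + s⁻² ‖Y' + Y‖² - 2σ (‖Y'‖² - ‖Y‖²)`.
    -- Its compensator is nonnegative, so linearity of compensators gives the bound; the two signs
    -- of `σ` give the absolute value.
    have hR : Martingale (s • (Y' - Y) - (σ * s⁻¹) • (Y' + Y)) 𝓕 P :=
      ((hY'.sub hY).smul s).sub ((hY'.add hY).smul (σ * s⁻¹))
    have hRc : ∀ᵐ ω ∂P, ‖(s • (Y' - Y) - (σ * s⁻¹) • (Y' + Y)) ⊤ ω‖ ≤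
        |s| * (c' + c) + |σ * s⁻¹| * (c' + c) := by
      filter_upwards [hYc, hYc'] with ω h1 h2
      refine (norm_sub_le _ _).trans (add_le_add ?_ ?_)
      · refine (norm_smul_le _ _).trans (mul_le_mul_of_nonneg_left ?_ (abs_nonneg _))
        exact (norm_sub_le _ _).trans (add_le_add h2 h1)
      · refine (norm_smul_le _ _).trans (mul_le_mul_of_nonneg_left ?_ (abs_nonneg _))
        exact (norm_add_le _ _).trans (add_le_add h2 h1)
    obtain ⟨R, hRV⟩ := exists_isPredictableCompensator_of_bdd g h𝓕 hR hRc
    have h1 : ∀ t, ∀ᵐ ω ∂P, R.toFun t ω = s ^ 2 * A.toFun t ω + s⁻¹ ^ 2 * B.toFun t ω +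
        (-2 * σ) * (V'.toFun t ω - V.toFun t ω) := by
      refine IsPredictableCompensator.ae_eq_combination g h𝓕 hA hB hV' hV hRV fun t ω => ?_
      simp only [Pi.sub_apply, Pi.smul_apply, Pi.add_apply]
      rw [norm_sub_sq_real, norm_smul, norm_smul, real_inner_smul_left, real_inner_smul_right,
        inner_add_right, inner_sub_left, inner_sub_left, real_inner_self_eq_norm_sq,
        real_inner_self_eq_norm_sq, real_inner_comm (Y t ω) (Y' t ω), mul_pow, mul_pow,
        Real.norm_eq_abs, Real.norm_eq_abs, sq_abs, sq_abs, mul_pow, hσ]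
      field_simp
      ring
    have h2 := (ae_ball_iff g.countable_points).2 fun q _ => h1 q
    filter_upwards [h2] with ω hω
    refine g.le_of_le_on_points (fun t => ?_) fun q hq => ?_
    · exact ((V'.rightCont ω t).sub (V.rightCont ω t)).const_mul σ
    · have h3 := hω q hq
      have h4 := R.nonneg q ω
      have h5 : s ^ 2 * A.toFun q ω ≤ s ^ 2 * A.toFun ⊤ ω :=
        mul_le_mul_of_nonneg_left (A.mono ω le_top) (by positivity)
      have h6 : s⁻¹ ^ 2 * B.toFun q ω ≤ s⁻¹ ^ 2 * B.toFun ⊤ ω :=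
        mul_le_mul_of_nonneg_left (B.mono ω le_top) (by positivity)
      linarith
  filter_upwards [key 1 (by norm_num), key (-1) (by norm_num)] with ω h1 h2 t
  rw [abs_le]
  constructor
  · linarith [h2 t]
  · linarith [h1 t]

/-- The square of the norm of a square integrable martingale has a predictable compensator. -/
theorem exists_isPredictableCompensator [TopologicalSpace.SeparableSpace H]
    (g : RefiningGrid ι) (h𝓕 : UsualConditions 𝓕 P) {Y : ι → Ω → H}
    (hY : Martingale Y 𝓕 P) (hYtop : MemLp (Y ⊤) 2 P) :
    ∃ V : IncreasingProcess Ω ι, IsPredictableCompensator 𝓕 P (fun t ω => ‖Y t ω‖ ^ 2) V := by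
  classical
  have hY2 := memLp_of_martingale hY hYtop
  choose ξ c hξm hξc hξY hξε using fun k : ℕ =>
    exists_truncation (𝓕.le ⊤) (hY.1 ⊤) hYtop (ε := (1 / 16) ^ k) (by positivity)
  have hξ2 : ∀ k, MemLp (ξ k) 2 P := fun k =>
    (memLp_top_of_bound ((hξm k).mono (𝓕.le ⊤)).aestronglyMeasurable (c k)
      (Eventually.of_forall (hξc k))).mono_exponent le_top
  set Z : ℕ → ι → Ω → H := fun k t => P[ξ k|𝓕 t] with hZ
  have hZm : ∀ k, Martingale (Z k) 𝓕 P := fun k => martingale_condExp _ _ _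
  have hZtop : ∀ k, Z k ⊤ = ξ k := fun k =>
    condExp_of_stronglyMeasurable (𝓕.le ⊤) (hξm k) ((hξ2 k).integrable (by norm_num))
  have hZ2 : ∀ k t, MemLp (Z k t) 2 P := fun k =>
    memLp_of_martingale (hZm k) (by rw [hZtop]; exact hξ2 k)
  have hZc : ∀ k, ∀ᵐ ω ∂P, ‖Z k ⊤ ω‖ ≤ c k := fun k => by
    rw [hZtop]
    exact Eventually.of_forall (hξc k)
  have hYZ : ∀ k t, ∫ ω, ‖Y t ω - Z k t ω‖ ^ 2 ∂P ≤ (1 / 16) ^ k := by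
    intro k t
    have h1 := integral_sq_norm_martingale (hY.sub (hZm k)) (fun t => (hY2 t).sub (hZ2 k t))
      (le_top : t ≤ ⊤)
    simp only [Pi.sub_apply] at h1
    have h2 : 0 ≤ ∫ ω, ‖Y ⊤ ω - Z k ⊤ ω - (Y t ω - Z k t ω)‖ ^ 2 ∂P :=
      integral_nonneg fun ω => by positivity
    have h3 := hξε k
    rw [← hZtop] at h3
    linarith
  have hP : ∀ k, ∀ᵐ ω ∂P, ‖(Z (k + 1) - Z k) ⊤ ω‖ ≤ c (k + 1) + c k := fun k => by
    filter_upwards [hZc k, hZc (k + 1)] with ω h1 h2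
    exact (norm_sub_le _ _).trans (add_le_add h2 h1)
  have hQ : ∀ k, ∀ᵐ ω ∂P, ‖(Z (k + 1) + Z k) ⊤ ω‖ ≤ c (k + 1) + c k := fun k => by
    filter_upwards [hZc k, hZc (k + 1)] with ω h1 h2
    exact (norm_add_le _ _).trans (add_le_add h2 h1)
  choose V hV using fun k => exists_isPredictableCompensator_of_bdd g h𝓕 (hZm k) (hZc k)
  choose A hA using fun k =>
    exists_isPredictableCompensator_of_bdd g h𝓕 ((hZm (k + 1)).sub (hZm k)) (hP k)
  choose B hB using fun k =>
    exists_isPredictableCompensator_of_bdd g h𝓕 ((hZm (k + 1)).add (hZm k)) (hQ k)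
  simp only [Pi.sub_apply, Pi.add_apply] at hA hB
  -- The parameter is `s = 2 ^ k`. The difference martingale contributes a mean of at most `4 / 16 ^
  -- k` and the sum martingale at most `4 K`, so `b k` has mean at most `(2 + 2 K) / 4 ^ k`.
  set b : ℕ → Ω → ℝ := fun k ω =>
    (((2 : ℝ) ^ k) ^ 2 * (A k).toFun ⊤ ω + ((2 : ℝ) ^ k)⁻¹ ^ 2 * (B k).toFun ⊤ ω) / 2 with hb
  have hclose : ∀ k, ∀ᵐ ω ∂P, ∀ t, |(V (k + 1)).toFun t ω - (V k).toFun t ω| ≤ b k ω := fun k =>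
    ae_forall_abs_sub_le g h𝓕 (hZm k) (hZm (k + 1)) (hZc k) (hZc (k + 1)) (hV k) (hV (k + 1))
      (hA k) (hB k) (by positivity)
  have hAi : ∀ k, Integrable ((A k).toFun ⊤) P := fun k =>
    (hA k).integrable (fun t => ((hZ2 (k + 1) t).sub (hZ2 k t)).integrable_sq_norm) ⊤
  have hBi : ∀ k, Integrable ((B k).toFun ⊤) P := fun k =>
    (hB k).integrable (fun t => ((hZ2 (k + 1) t).add (hZ2 k t)).integrable_sq_norm) ⊤
  have hVi : ∀ k t, Integrable ((V k).toFun t) P := fun k t =>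
    (hV k).integrable (fun t => (hZ2 k t).integrable_sq_norm) t
  have hbi : ∀ k, Integrable (b k) P := fun k =>
    (((hAi k).const_mul _).add ((hBi k).const_mul _)).div_const 2
  have hb0 : ∀ k ω, 0 ≤ b k ω := fun k ω => by
    have h1 := (A k).nonneg ⊤ ω
    have h2 := (B k).nonneg ⊤ ω
    simp only [hb]
    positivity
  set K := ∫ ω, ‖Y ⊤ ω‖ ^ 2 ∂P with hK
  have hK0 : 0 ≤ K := integral_nonneg fun ω => by positivity
  have hξK : ∀ k, ∫ ω, ‖ξ k ω‖ ^ 2 ∂P ≤ K := fun k =>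
    integral_mono (hξ2 k).integrable_sq_norm hYtop.integrable_sq_norm fun ω =>
      pow_le_pow_left₀ (norm_nonneg _) (hξY k ω) 2
  have hbint : ∀ k, ∫ ω, b k ω ∂P ≤ (2 + 2 * K) * (1 / 4) ^ k := by
    intro k
    have hA1 : ∫ ω, (A k).toFun ⊤ ω ∂P ≤ 4 * (1 / 16) ^ k := by
      refine ((hA k).integral_le (fun t => ((hZ2 (k + 1) t).sub (hZ2 k t)).integrable_sq_norm)
        (fun ω => by positivity) ⊤).trans ?_
      have h1 := integral_sq_norm_add_le ((hY2 ⊤).sub (hZ2 k ⊤)) ((hZ2 (k + 1) ⊤).sub (hY2 ⊤))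
      have h2 : ∀ ω, (Y ⊤ - Z k ⊤) ω + (Z (k + 1) ⊤ - Y ⊤) ω = Z (k + 1) ⊤ ω - Z k ⊤ ω := fun ω => by
        simp only [Pi.sub_apply]
        abel
      have h3 : ∀ ω, ‖(Z (k + 1) ⊤ - Y ⊤) ω‖ = ‖Y ⊤ ω - Z (k + 1) ⊤ ω‖ := fun ω => by
        rw [Pi.sub_apply, norm_sub_rev]
      simp_rw [h2, h3] at h1
      have h4 := hYZ k ⊤
      have h5 := hYZ (k + 1) ⊤
      have h6 : ((1 : ℝ) / 16) ^ (k + 1) ≤ (1 / 16) ^ k :=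
        pow_le_pow_of_le_one (by norm_num) (by norm_num) (Nat.le_succ k)
      simp only [Pi.sub_apply] at h1
      linarith
    have hB1 : ∫ ω, (B k).toFun ⊤ ω ∂P ≤ 4 * K := by
      refine ((hB k).integral_le (fun t => ((hZ2 (k + 1) t).add (hZ2 k t)).integrable_sq_norm)
        (fun ω => by positivity) ⊤).trans ?_
      have h1 := integral_sq_norm_add_le (hZ2 (k + 1) ⊤) (hZ2 k ⊤)
      have h2 := hξK k
      have h3 := hξK (k + 1)
      rw [← hZtop] at h2 h3
      linarith
    simp only [hb]
    rw [integral_div, integral_add ((hAi k).const_mul _) ((hBi k).const_mul _),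
      integral_const_mul, integral_const_mul]
    have h1 : ((2 : ℝ) ^ k) ^ 2 * (1 / 16) ^ k = (1 / 4) ^ k := by
      rw [← pow_mul, mul_comm k 2, pow_mul, ← mul_pow]
      norm_num
    have h2 : ((2 : ℝ) ^ k)⁻¹ ^ 2 = (1 / 4) ^ k := by
      rw [inv_pow, ← pow_mul, mul_comm k 2, pow_mul, ← inv_pow]
      norm_num
    have h3 : ((2 : ℝ) ^ k) ^ 2 * ∫ ω, (A k).toFun ⊤ ω ∂P ≤ 4 * (1 / 4) ^ k := by
      rw [← h1]
      have := mul_le_mul_of_nonneg_left hA1 (by positivity : (0 : ℝ) ≤ (2 ^ k) ^ 2)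
      linarith
    have h4 : ((2 : ℝ) ^ k)⁻¹ ^ 2 * ∫ ω, (B k).toFun ⊤ ω ∂P ≤ (1 / 4) ^ k * (4 * K) := by
      rw [h2]
      exact mul_le_mul_of_nonneg_left hB1 (by positivity)
    linarith
  obtain ⟨hsum, hsumi⟩ := ae_summable_of_integral_le hbi hb0
    ((summable_geometric_of_lt_one (by norm_num) (by norm_num : (1 : ℝ) / 4 < 1)).mul_left
      (2 + 2 * K)) hbint
  set G : Set Ω := {ω | (Summable fun k => b k ω) ∧
    ∀ k t, |(V (k + 1)).toFun t ω - (V k).toFun t ω| ≤ b k ω} with hG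
  have hGae : ∀ᵐ ω ∂P, ω ∈ G := by
    filter_upwards [hsum, ae_all_iff.2 hclose] with ω h1 h2
    exact ⟨h1, h2⟩
  have hGm : ∀ t, MeasurableSet[𝓕 t] G := fun t => by
    have := (h𝓕.measurableSet_of_null (N := Gᶜ) hGae t).compl
    rwa [compl_compl] at this
  set W : ι → Ω → ℝ := fun t ω => limsup (fun k => G.indicator ((V k).toFun t) ω) atTop with hW
  have hstep : ∀ ω ∈ G, ∀ t k, dist ((V k).toFun t ω) ((V k.succ).toFun t ω) ≤ b k ω := by
    intro ω hω t k
    rw [dist_comm]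
    exact hω.2 k t
  have hWlim : ∀ t ω, Tendsto (fun k => G.indicator ((V k).toFun t) ω) atTop (𝓝 (W t ω)) := by
    intro t ω
    by_cases hω : ω ∈ G
    · obtain ⟨a, ha⟩ := cauchySeq_tendsto_of_complete
        (cauchySeq_of_dist_le_of_summable _ (hstep ω hω t) hω.1)
      simp only [hW, indicator_of_mem hω]
      rwa [ha.limsup_eq]
    · simp only [hW, indicator_of_notMem hω]
      rw [tendsto_const_nhds.limsup_eq]
      exact tendsto_const_nhds
  have hWlim' : ∀ ω ∈ G, ∀ t, Tendsto (fun k => (V k).toFun t ω) atTop (𝓝 (W t ω)) := by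
    intro ω hω t
    simpa only [indicator_of_mem hω] using hWlim t ω
  have hWnot : ∀ ω ∉ G, ∀ t, W t ω = 0 := by
    intro ω hω t
    refine tendsto_nhds_unique (hWlim t ω) ?_
    simp only [indicator_of_notMem hω]
    exact tendsto_const_nhds
  have hWp : Measurable[𝓕.predictable] (Function.uncurry W) :=
    measurable_limsup_aux (mα := 𝓕.predictable)
      (f := fun k => Function.uncurry fun t => G.indicator ((V k).toFun t)) fun k =>
        measurable_predictable_indicator (hV k).predictable (hGm ⊥)
  have hWm : ∀ t, Measurable[𝓕 t] (W t) := measurable_of_predictable hWp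
  let V' : IncreasingProcess Ω ι :=
    { toFun := W
      mono := by
        intro ω s t hst
        refine le_of_tendsto_of_tendsto' (hWlim s ω) (hWlim t ω) fun k => ?_
        exact indicator_le_indicator ((V k).mono ω hst)
      rightCont := by
        intro ω t
        by_cases hω : ω ∈ G
        -- The tails of the summable `b` bound the distance to the limit uniformly in time, so
        -- right-continuity passes to it.
        · refine continuousWithinAt_of_uniform_bound self_mem_Ici
            (tendsto_sum_nat_add fun k => b k ω) (fun k => (V k).rightCont ω t) fun k s => ?_
          have := dist_le_tsum_of_dist_le_of_tendsto _ (hstep ω hω s) hω.1 (hWlim' ω hω s) k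
          simpa only [add_comm] using this
        · have : (fun s => W s ω) = fun _ => 0 := funext (hWnot ω hω)
          rw [this]
          exact continuousWithinAt_const
      measurable := fun t => (hWm t).mono (𝓕.le t) le_rfl
      bot := by
        intro ω
        refine tendsto_nhds_unique (hWlim ⊥ ω) ?_
        have : ∀ k, G.indicator ((V k).toFun ⊥) ω = 0 := fun k => by
          simp [indicator, IncreasingProcess.bot]
        simp only [this]
        exact tendsto_const_nhds }
  have hbound : ∀ k t, ∀ᵐ ω ∂P, ‖(V k).toFun t ω‖ ≤ (V 0).toFun ⊤ ω + 2 * ∑' k, b k ω := by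
    intro k t
    filter_upwards [hGae] with ω hω
    have h1 := dist_le_tsum_of_dist_le_of_tendsto _ (hstep ω hω t) hω.1 (hWlim' ω hω t)
    have h2 := h1 0
    have h3 := h1 k
    have h4 : ∑' j, b (k + j) ω ≤ ∑' j, b j ω := by
      have h5 := hω.1.sum_add_tsum_nat_add k
      have h6 : 0 ≤ ∑ i ∈ Finset.range k, b i ω := Finset.sum_nonneg fun i _ => hb0 i ω
      simp only [add_comm _ k] at h5
      linarith
    have h5 := (V 0).mono ω (le_top : t ≤ ⊤)
    simp only [zero_add] at h2 h5
    rw [Real.dist_eq, abs_le] at h2 h3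
    rw [Real.norm_of_nonneg ((V k).nonneg t ω)]
    linarith [h2.1, h2.2, h3.1, h3.2]
  have hboundi : Integrable (fun ω => (V 0).toFun ⊤ ω + 2 * ∑' k, b k ω) P :=
    (hVi 0 ⊤).add (hsumi.const_mul 2)
  have hWi : ∀ t, Integrable (W t) P := by
    intro t
    refine hboundi.mono' ((hWm t).mono (𝓕.le t) le_rfl).aestronglyMeasurable ?_
    filter_upwards [ae_all_iff.2 fun k => hbound k t, hGae] with ω h1 h2
    exact le_of_tendsto' (hWlim' ω h2 t).norm h1
  have hVlim : ∀ t (F : Set Ω), Tendsto (fun k => ∫ ω in F, (V k).toFun t ω ∂P) atTop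
      (𝓝 (∫ ω in F, W t ω ∂P)) := by
    intro t F
    refine tendsto_integral_of_dominated_convergence _ (fun k => (hVi k t).1.restrict)
      hboundi.integrableOn (fun k => ae_restrict_of_ae (hbound k t)) (ae_restrict_of_ae ?_)
    filter_upwards [hGae] with ω hω
    exact hWlim' ω hω t
  have hlim : ∀ t (F : Set Ω), Tendsto
      (fun k => ∫ ω in F, (‖Z k t ω‖ ^ 2 - (V k).toFun t ω) ∂P) atTop
      (𝓝 (∫ ω in F, (‖Y t ω‖ ^ 2 - W t ω) ∂P)) := by
    intro t F
    rw [integral_sub (hY2 t).integrable_sq_norm.integrableOn (hWi t).integrableOn]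
    have h1 : ∀ k, ∫ ω in F, (‖Z k t ω‖ ^ 2 - (V k).toFun t ω) ∂P =
        ∫ ω in F, ‖Z k t ω‖ ^ 2 ∂P - ∫ ω in F, (V k).toFun t ω ∂P := fun k =>
      integral_sub (hZ2 k t).integrable_sq_norm.integrableOn (hVi k t).integrableOn
    simp_rw [h1]
    exact (tendsto_setIntegral_sq_norm (fun k => hZ2 k t) (hY2 t) (fun k => hYZ k t) F).sub
      (hVlim t F)
  have hMm : ∀ t, StronglyMeasurable[𝓕 t] fun ω => ‖Y t ω‖ ^ 2 - W t ω := fun t =>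
    ((((hY.1 t).norm.pow 2).measurable).sub (hWm t)).stronglyMeasurable
  have hMi : ∀ t, Integrable (fun ω => ‖Y t ω‖ ^ 2 - W t ω) P := fun t =>
    (hY2 t).integrable_sq_norm.sub (hWi t)
  refine ⟨V', hWp, hMm, fun s t hst => ?_⟩
  refine (ae_eq_condExp_of_forall_setIntegral_eq (𝓕.le s) (hMi t)
    (fun _ _ _ => (hMi s).integrableOn) (fun F hF _ => ?_) (hMm s).aestronglyMeasurable).symm
  refine tendsto_nhds_unique (hlim s F) ((hlim t F).congr fun k => ?_)
  exact ((hV k).martingale.setIntegral_eq hst hF).symm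

end Existence

/-! ### Additivity of the quadratic variations in the set -/

instance {Ω ι : Type*} [MeasurableSpace Ω] [LinearOrder ι] [OrderBot ι] [TopologicalSpace ι] :
    Nonempty (IncreasingProcess Ω ι) :=
  ⟨⟨fun _ _ => 0, fun _ => monotone_const, fun _ _ => continuousWithinAt_const,
    fun _ => measurable_const, fun _ => rfl⟩⟩

/-- An almost surely additive family of predictable integrable increasing processes, indexed by a
ring of sets. -/
structure IsAdditiveFamily {Ω ι U : Type*} {m : MeasurableSpace Ω} [LinearOrder ι] [OrderBot ι]
    [OrderTop ι] [TopologicalSpace ι] (𝓕 : Filtration ι m) (P : Measure Ω) (𝒜 : Set (Set U))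
    (V : Set U → IncreasingProcess Ω ι) : Prop where
  ring : IsSetRing 𝒜
  predictable : ∀ A ∈ 𝒜, Measurable[𝓕.predictable] (Function.uncurry (V A).toFun)
  integrable : ∀ A ∈ 𝒜, Integrable ((V A).toFun ⊤) P
  add : ∀ A ∈ 𝒜, ∀ B ∈ 𝒜, Disjoint A B →
    ∀ᵐ ω ∂P, ∀ t, (V (A ∪ B)).toFun t ω = (V A).toFun t ω + (V B).toFun t ω

section OrthogonalMeasure

variable {Ω ι U H : Type*} {m : MeasurableSpace Ω} [LinearOrder ι] [OrderBot ι] [OrderTop ι]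
  [TopologicalSpace ι] [OrderTopology ι] [MeasurableSpace ι] [BorelSpace ι]
  [SecondCountableTopology ι] [DenselyOrdered ι] [CompactIccSpace ι]
  {g : RefiningGrid ι} {𝓕 : Filtration ι m} {P : Measure Ω}
  [IsProbabilityMeasure P] [MeasurableSpace U]
  [NormedAddCommGroup H] [InnerProductSpace ℝ H] [CompleteSpace H]

lemma RefiningGrid.bot_lt_top (g : RefiningGrid ι) : (⊥ : ι) < ⊤ := by
  rw [← g.zero 0, ← g.last 0]
  exact g.strict 0 0 (2 ^ 0) (by norm_num) le_rfl

variable {𝒜 : Set (Set U)} {M : ι → Set U → Ω → H}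

lemma IsOrthogonalMartingaleMeasure.ae_add (hM : IsOrthogonalMartingaleMeasure 𝓕 P 𝒜 M)
    (h𝒜 : IsSetRing 𝒜) {A B : Set U} (hA : A ∈ 𝒜) (hB : B ∈ 𝒜) (hAB : Disjoint A B) (t : ι) :
    ∀ᵐ ω ∂P, M t (A ∪ B) ω = M t A ω + M t B ω := by
  rcases eq_bot_or_bot_lt t with rfl | ht
  · filter_upwards [hM.initial A hA, hM.initial B hB, hM.initial _ (h𝒜.union_mem hA hB)]
      with ω h1 h2 h3
    rw [h1, h2, h3, add_zero]
  · exact (hM.l2Measure t ht).additive A hA B hB hAB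

/-- A vanishing covariation process can be removed from the martingale `(Y, Z) - V` by a
modification at each time. -/
lemma IsOrthogonalMartingaleMeasure.martingale_inner
    (hM : IsOrthogonalMartingaleMeasure 𝓕 P 𝒜 M) {A B : Set U} (hA : A ∈ 𝒜) (hB : B ∈ 𝒜)
    (hAB : Disjoint A B) : Martingale (fun t ω => (inner ℝ (M t A ω) (M t B ω) : ℝ)) 𝓕 P := by
  obtain ⟨V, hV, hV0⟩ := hM.orthogonal A hA B hB hAB
  refine hV.martingale.congr_ae (fun t => ?_) fun t =>
    ((hM.martingale A hA).martingale.1 t).inner ((hM.martingale B hB).martingale.1 t)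
  rcases eq_bot_or_bot_lt t with rfl | ht
  · filter_upwards [hV.initial] with ω hω
    rw [hω, sub_zero]
  · filter_upwards [hV0 t ht] with ω hω
    rw [hω, sub_zero]

lemma measurable_sub_sub_aux {α : Type*} {mα : MeasurableSpace α} {f₁ f₂ f₃ : α → ℝ}
    (h₁ : Measurable f₁) (h₂ : Measurable f₂) (h₃ : Measurable f₃) :
    StronglyMeasurable fun x => f₁ x - f₂ x - f₃ x := ((h₁.sub h₂).sub h₃).stronglyMeasurable

/-- The quadratic variations of an orthogonal martingale-valued measure form an additive family. -/
lemma IsOrthogonalMartingaleMeasure.exists_isAdditiveFamily [TopologicalSpace.SeparableSpace H]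
    (g : RefiningGrid ι) (h𝓕 : UsualConditions 𝓕 P)
    (hM : IsOrthogonalMartingaleMeasure 𝓕 P 𝒜 M) (h𝒜 : IsSetRing 𝒜) :
    ∃ V : Set U → IncreasingProcess Ω ι, IsAdditiveFamily 𝓕 P 𝒜 V ∧
      ∀ A ∈ 𝒜, IsPredictableCompensator 𝓕 P (fun t ω => ‖M t A ω‖ ^ 2) (V A) := by
  have h := fun A hA => exists_isPredictableCompensator g h𝓕 (hM.martingale A hA).martingale
    ((hM.martingale A hA).memLp ⊤)
  choose! V hV using h
  refine ⟨V, ⟨h𝒜, fun A hA => (hV A hA).predictable, fun A hA => (hV A hA).integrable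
    (fun t => ((hM.martingale A hA).memLp t).integrable_sq_norm) ⊤, fun A hA B hB hAB => ?_⟩, hV⟩
  have hAB' := h𝒜.union_mem hA hB
  have key : ∀ t, ∀ᵐ ω ∂P, (V (A ∪ B)).toFun t ω = (V A).toFun t ω + (V B).toFun t ω := by
    intro t
    have h := predictable_martingale_eq_zero g h𝓕 (D := fun t ω =>
      (V (A ∪ B)).toFun t ω - (V A).toFun t ω - (V B).toFun t ω) ?_ ?_ ?_ ?_ ?_ t
    · filter_upwards [h] with ω hω
      simp only [Pi.zero_apply] at hω
      linarith
    -- Expanding `‖M(A) + M(B)‖²`, the cross term is twice a martingale by orthogonality, so the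
    -- defect of additivity of the compensators is a martingale.
    · have hmart := (((hV A hA).martingale.add (hV B hB).martingale).add
        ((hM.martingale_inner hA hB hAB).smul (2 : ℝ))).sub (hV _ hAB').martingale
      refine hmart.congr_ae (fun t => ?_) fun t => ?_
      · filter_upwards [hM.ae_add h𝒜 hA hB hAB t] with ω hω
        simp only [Pi.sub_apply, Pi.add_apply, Pi.smul_apply, smul_eq_mul]
        rw [hω, norm_add_sq_real]
        ring
      · have hm := fun A hA => measurable_of_predictable (hV A hA).predictable t
        exact measurable_sub_sub_aux (mα := 𝓕 t) (hm _ hAB') (hm A hA) (hm B hB)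
    · exact measurable_sub_sub_aux (mα := 𝓕.predictable) (hV _ hAB').predictable
        (hV A hA).predictable (hV B hB).predictable
    · refine Eventually.of_forall fun ω t => ?_
      exact (((V _).rightCont ω t).sub ((V A).rightCont ω t)).sub ((V B).rightCont ω t)
    · refine Eventually.of_forall fun ω => ?_
      have hb := fun V : IncreasingProcess Ω ι => V.locallyBoundedVariationOn ω
      exact ((hb _).sub_real (hb (V A))).sub_real (hb (V B))
    · refine Eventually.of_forall fun ω => ?_
      simp [IncreasingProcess.bot]
  -- One null set serves all times: the identity holds on the countable grid, and both sides are
  -- right-continuous.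
  filter_upwards [(ae_ball_iff g.countable_points).2 fun q _ => key q] with ω hω t
  exact g.eq_of_eqOn_points (f' := fun t => (V A).toFun t ω + (V B).toFun t ω)
    ((V _).rightCont ω) (fun t => ((V A).rightCont ω t).add ((V B).rightCont ω t)) hω t

end OrthogonalMeasure

/-- The pointwise infimum has integral `0`, and an almost surely decreasing sequence converges to
its infimum. -/
lemma ae_tendsto_zero_of_antitone {Ω : Type*} {m : MeasurableSpace Ω} {P : Measure Ω}
    {W : ℕ → Ω → ℝ} (hW0 : ∀ n ω, 0 ≤ W n ω) (hWi : ∀ n, Integrable (W n) P)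
    (hanti : ∀ n, ∀ᵐ ω ∂P, W (n + 1) ω ≤ W n ω)
    (hlim : Tendsto (fun n => ∫ ω, W n ω ∂P) atTop (𝓝 0)) :
    ∀ᵐ ω ∂P, Tendsto (fun n => W n ω) atTop (𝓝 0) := by
  have h1 : ∫⁻ ω, ⨅ n, ENNReal.ofReal (W n ω) ∂P = 0 := by
    have h2 : Tendsto (fun n => ENNReal.ofReal (∫ ω, W n ω ∂P)) atTop (𝓝 0) := by
      simpa using ENNReal.tendsto_ofReal hlim
    refine le_antisymm (ge_of_tendsto' h2 fun n => ?_) bot_le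
    rw [ofReal_integral_eq_lintegral_ofReal (hWi n) (Eventually.of_forall (hW0 n))]
    exact lintegral_mono fun ω => iInf_le _ n
  rw [lintegral_eq_zero_iff' (AEMeasurable.iInf fun n => (hWi n).1.aemeasurable.ennreal_ofReal)]
    at h1
  filter_upwards [h1, ae_all_iff.2 hanti] with ω h2 h3
  have h4 : Antitone fun n => ENNReal.ofReal (W n ω) :=
    antitone_nat_of_succ_le fun n => ENNReal.ofReal_le_ofReal (h3 n)
  have h5 := tendsto_atTop_iInf h4
  rw [h2] at h5
  have h6 := (ENNReal.tendsto_toReal ENNReal.zero_ne_top).comp h5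
  simpa [Function.comp_def, ENNReal.toReal_ofReal (hW0 _ ω)] using h6

namespace IsAdditiveFamily

variable {Ω ι U : Type*} {m : MeasurableSpace Ω} [LinearOrder ι] [OrderBot ι]
  [OrderTop ι] [TopologicalSpace ι] {𝓕 : Filtration ι m} {P : Measure Ω} {𝒜 : Set (Set U)}
  {V : Set U → IncreasingProcess Ω ι} (h : IsAdditiveFamily 𝓕 P 𝒜 V)

include h

lemma empty : ∀ᵐ ω ∂P, ∀ t, (V ∅).toFun t ω = 0 := by
  filter_upwards [h.add ∅ h.ring.empty_mem ∅ h.ring.empty_mem (disjoint_empty _)] with ω hω t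
  have := hω t
  rw [union_empty] at this
  linarith

lemma diff {A B : Set U} (hA : A ∈ 𝒜) (hB : B ∈ 𝒜) (hAB : A ⊆ B) :
    ∀ᵐ ω ∂P, ∀ t, (V (B \ A)).toFun t ω = (V B).toFun t ω - (V A).toFun t ω := by
  filter_upwards [h.add A hA (B \ A) (h.ring.sdiff_mem hB hA) disjoint_sdiff_right] with ω hω t
  have := hω t
  rw [union_sdiff_cancel hAB] at this
  linarith

lemma mono {A B : Set U} (hA : A ∈ 𝒜) (hB : B ∈ 𝒜) (hAB : A ⊆ B) :
    ∀ᵐ ω ∂P, ∀ t, (V A).toFun t ω ≤ (V B).toFun t ω := by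
  filter_upwards [h.diff hA hB hAB] with ω hω t
  linarith [hω t, (V (B \ A)).nonneg t ω]

/-- Continuity in mean improves to almost sure continuity, by monotonicity in the set. The null set
depends on the sequence, so only countably many sequences may be used at once. -/
lemma ae_tendsto_zero {B : ℕ → Set U} (hB : ∀ n, B n ∈ 𝒜) (hanti : Antitone B)
    (hlim : Tendsto (fun n => ∫ ω, (V (B n)).toFun ⊤ ω ∂P) atTop (𝓝 0)) :
    ∀ᵐ ω ∂P, Tendsto (fun n => (V (B n)).toFun ⊤ ω) atTop (𝓝 0) := by
  refine ae_tendsto_zero_of_antitone (fun n => (V (B n)).nonneg ⊤)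
    (fun n => h.integrable _ (hB n)) (fun n => ?_) hlim
  filter_upwards [h.mono (hB (n + 1)) (hB n) (hanti (Nat.le_succ n))] with ω hω
  exact hω ⊤

end IsAdditiveFamily

/-! ### Measures from distribution functions on the rationals -/

section RatStieltjes

/-- The right limits along the rational numbers of a function on the rational numbers. -/
noncomputable def ratRightLim (f : ℚ → ℝ) (x : ℝ) : ℝ := sInf (f '' {q : ℚ | x < q})

variable {f f' : ℚ → ℝ}

lemma nonempty_ratRightLim (x : ℝ) : (f '' {q : ℚ | x < q}).Nonempty := by
  obtain ⟨q, hq⟩ := exists_rat_gt x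
  exact ⟨f q, q, hq, rfl⟩

lemma le_ratRightLim (hf : Monotone f) {q : ℚ} {x : ℝ} (h : (q : ℝ) ≤ x) :
    f q ≤ ratRightLim f x := by
  refine le_csInf (nonempty_ratRightLim x) ?_
  rintro _ ⟨r, hr, rfl⟩
  exact hf (Rat.cast_le.1 (h.trans (le_of_lt hr)))

lemma ratRightLim_le (hf0 : ∀ q, 0 ≤ f q) {q : ℚ} {x : ℝ} (h : x < q) : ratRightLim f x ≤ f q := by
  refine csInf_le ⟨0, ?_⟩ ⟨q, h, rfl⟩
  rintro _ ⟨r, -, rfl⟩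
  exact hf0 r

lemma ratRightLim_nonneg (hf0 : ∀ q, 0 ≤ f q) (x : ℝ) : 0 ≤ ratRightLim f x := by
  refine le_csInf (nonempty_ratRightLim x) ?_
  rintro _ ⟨r, -, rfl⟩
  exact hf0 r

lemma monotone_ratRightLim (hf0 : ∀ q, 0 ≤ f q) : Monotone (ratRightLim f) := by
  intro x y hxy
  refine csInf_le_csInf ⟨0, ?_⟩ (nonempty_ratRightLim y) (image_mono fun q hq => hxy.trans_lt hq)
  rintro _ ⟨r, -, rfl⟩
  exact hf0 r

lemma tendsto_ratRightLim (hf : Monotone f) (hf0 : ∀ q, 0 ≤ f q) {x : ℝ} {q : ℕ → ℚ}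
    (hq : ∀ n, x < q n) (hlim : Tendsto (fun n => (q n : ℝ)) atTop (𝓝 x)) :
    Tendsto (fun n => f (q n)) atTop (𝓝 (ratRightLim f x)) := by
  refine tendsto_order.2 ⟨fun a ha => Eventually.of_forall fun n =>
    ha.trans_le (ratRightLim_le hf0 (hq n)), fun a ha => ?_⟩
  obtain ⟨_, ⟨r, hr, rfl⟩, hra⟩ := exists_lt_of_csInf_lt (nonempty_ratRightLim x) ha
  filter_upwards [hlim.eventually_lt_const hr] with n hn
  exact (hf (Rat.cast_le.1 hn.le)).trans_lt hra

lemma continuousWithinAt_ratRightLim (hf0 : ∀ q, 0 ≤ f q) (x : ℝ) :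
    ContinuousWithinAt (ratRightLim f) (Ici x) x := by
  refine tendsto_order.2 ⟨fun a ha => ?_, fun a ha => ?_⟩
  · filter_upwards [self_mem_nhdsWithin] with y hy
    exact ha.trans_le (monotone_ratRightLim hf0 hy)
  · obtain ⟨_, ⟨r, hr, rfl⟩, hra⟩ := exists_lt_of_csInf_lt (nonempty_ratRightLim x) ha
    filter_upwards [mem_nhdsWithin_of_mem_nhds (Iio_mem_nhds hr)] with y hy
    exact (ratRightLim_le hf0 hy).trans_lt hra

lemma exists_seq_rat_gt_tendsto (x : ℝ) :
    ∃ q : ℕ → ℚ, (∀ n, x < q n) ∧ Tendsto (fun n => (q n : ℝ)) atTop (𝓝 x) := by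
  choose q hq1 hq2 using fun n : ℕ =>
    exists_rat_btwn (lt_add_of_pos_right x (Nat.one_div_pos_of_nat (α := ℝ) (n := n)))
  refine ⟨q, hq1, tendsto_of_tendsto_of_tendsto_of_le_of_le tendsto_const_nhds ?_
    (fun n => (hq1 n).le) fun n => (hq2 n).le⟩
  simpa using (tendsto_one_div_add_atTop_nhds_zero_nat (𝕜 := ℝ)).const_add x

/-- The Stieltjes function of right limits of an increasing function on the rational numbers. -/
noncomputable def ratStieltjes (f : ℚ → ℝ) (hf0 : ∀ q, 0 ≤ f q) : StieltjesFunction ℝ where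
  toFun := ratRightLim f
  mono' := monotone_ratRightLim hf0
  right_continuous' := continuousWithinAt_ratRightLim hf0

lemma tendsto_ratRightLim_atBot (hf0 : ∀ q, 0 ≤ f q)
    (hbot : Tendsto (fun n : ℕ => f (-(n : ℚ))) atTop (𝓝 0)) :
    Tendsto (ratRightLim f) atBot (𝓝 0) := by
  refine tendsto_order.2 ⟨fun a ha => Eventually.of_forall fun x =>
    ha.trans_le (ratRightLim_nonneg hf0 x), fun a ha => ?_⟩
  obtain ⟨n, hn⟩ := (hbot.eventually_lt_const ha).exists
  filter_upwards [eventually_lt_atBot (((-(n : ℚ) : ℚ)) : ℝ)] with x hx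
  exact (ratRightLim_le hf0 hx).trans_lt hn

lemma tendsto_ratRightLim_atTop (hf : Monotone f) {L : ℝ}
    (htop : Tendsto (fun n : ℕ => f (n : ℚ)) atTop (𝓝 L)) :
    Tendsto (ratRightLim f) atTop (𝓝 L) := by
  have hle : ∀ q, f q ≤ L := by
    intro q
    obtain ⟨N, hN⟩ := exists_nat_ge q
    refine ge_of_tendsto htop ?_
    filter_upwards [eventually_ge_atTop N] with n hn
    exact hf (hN.trans (Nat.cast_le.2 hn))
  refine tendsto_order.2 ⟨fun a ha => ?_, fun a ha => Eventually.of_forall fun x => ?_⟩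
  · obtain ⟨n, hn⟩ := (htop.eventually_const_lt ha).exists
    filter_upwards [eventually_ge_atTop ((n : ℚ) : ℝ)] with x hx
    exact hn.trans_le (le_ratRightLim hf hx)
  · obtain ⟨_, r, hr, rfl⟩ := nonempty_ratRightLim (f := f) x
    refine lt_of_le_of_lt ?_ ha
    obtain ⟨q, hq, -⟩ := exists_seq_rat_gt_tendsto x
    by_cases hb : BddBelow (f '' {q : ℚ | x < q})
    · exact (csInf_le hb ⟨q 0, hq 0, rfl⟩).trans (hle _)
    · exfalso
      obtain ⟨p, hp⟩ := exists_rat_lt x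
      refine hb ⟨f p, ?_⟩
      rintro _ ⟨r, hr, rfl⟩
      exact hf (Rat.cast_le.1 (hp.trans hr).le)

lemma measure_ratStieltjes_Iic (hf0 : ∀ q, 0 ≤ f q)
    (hbot : Tendsto (fun n : ℕ => f (-(n : ℚ))) atTop (𝓝 0)) (x : ℝ) :
    (ratStieltjes f hf0).measure (Iic x) = ENNReal.ofReal (ratRightLim f x) := by
  rw [StieltjesFunction.measure_Iic _ (tendsto_ratRightLim_atBot hf0 hbot), sub_zero]
  rfl

lemma measure_ratStieltjes_univ (hf : Monotone f) (hf0 : ∀ q, 0 ≤ f q)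
    (hbot : Tendsto (fun n : ℕ => f (-(n : ℚ))) atTop (𝓝 0)) {L : ℝ}
    (htop : Tendsto (fun n : ℕ => f (n : ℚ)) atTop (𝓝 L)) :
    (ratStieltjes f hf0).measure univ = ENNReal.ofReal L := by
  rw [StieltjesFunction.measure_univ _ (tendsto_ratRightLim_atBot hf0 hbot)
    (tendsto_ratRightLim_atTop hf htop), sub_zero]

/-- The difference of the right limits is itself increasing and right-continuous, so the larger
measure is the smaller one plus a Stieltjes measure. -/
lemma measure_ratStieltjes_mono (hf : Monotone f) (hf' : Monotone f') (hf0 : ∀ q, 0 ≤ f q)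
    (hf0' : ∀ q, 0 ≤ f' q) (h : ∀ q r, q ≤ r → f r - f q ≤ f' r - f' q) :
    (ratStieltjes f hf0).measure ≤ (ratStieltjes f' hf0').measure := by
  have hmono : Monotone fun x => ratRightLim f' x - ratRightLim f x := by
    refine monotone_iff_forall_lt.2 fun x y hxy => ?_
    obtain ⟨q, hq, hql⟩ := exists_seq_rat_gt_tendsto x
    obtain ⟨r, hr, hrl⟩ := exists_seq_rat_gt_tendsto y
    refine le_of_tendsto_of_tendsto
      ((tendsto_ratRightLim hf' hf0' hq hql).sub (tendsto_ratRightLim hf hf0 hq hql))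
      ((tendsto_ratRightLim hf' hf0' hr hrl).sub (tendsto_ratRightLim hf hf0 hr hrl)) ?_
    filter_upwards [hql.eventually_lt_const hxy] with n hn
    have := h (q n) (r n) (Rat.cast_le.1 (hn.trans (hr n)).le)
    linarith
  let K : StieltjesFunction ℝ :=
    { toFun := fun x => ratRightLim f' x - ratRightLim f x
      mono' := hmono
      right_continuous' := fun x =>
        (continuousWithinAt_ratRightLim hf0' x).sub (continuousWithinAt_ratRightLim hf0 x) }
  have hsum : ratStieltjes f' hf0' = ratStieltjes f hf0 + K := by
    ext x
    rw [StieltjesFunction.add_apply]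
    change ratRightLim f' x = ratRightLim f x + (ratRightLim f' x - ratRightLim f x)
    ring
  rw [hsum, StieltjesFunction.measure_add]
  exact Measure.le_add_right le_rfl

end RatStieltjes

lemma measurable_measure_apply_aux {α : Type*} {mα : MeasurableSpace α} {μ : α → Measure ℝ}
    (hfin : ∀ a, IsFiniteMeasure (μ a)) (hIic : ∀ q : ℚ, Measurable fun a => μ a (Iic (q : ℝ)))
    (huniv : Measurable fun a => μ a univ) {C : Set ℝ} (hC : MeasurableSet C) :
    Measurable fun a => μ a C := by
  have h : Measurable μ := by
    refine Measurable.measure_of_isPiSystem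
      (by rw [← Real.borel_eq_generateFrom_Iic_rat]; exact BorelSpace.measurable_eq)
      Real.isPiSystem_Iic_rat ?_ huniv
    intro s hs
    simp only [mem_iUnion, mem_singleton_iff] at hs
    obtain ⟨q, rfl⟩ := hs
    exact hIic q
  exact (Measure.measurable_coe hC).comp h

lemma measurable_ofReal_limit_aux {α : Type*} {mα : MeasurableSpace α} {f : ℕ → α → ℝ} {f₀ : α → ℝ}
    (hf : ∀ n, Measurable (f n)) (h : ∀ a, Tendsto (fun n => f n a) atTop (𝓝 (f₀ a))) :
    Measurable fun a => ENNReal.ofReal (f₀ a) :=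
  (measurable_of_tendsto_metrizable hf (tendsto_pi_nhds.2 h)).ennreal_ofReal

/-! ### Regularization over the real line -/

section RealKernel

variable {Ω ι : Type*} {m : MeasurableSpace Ω} [LinearOrder ι] [OrderBot ι] [OrderTop ι]
  [TopologicalSpace ι] [OrderTopology ι] [MeasurableSpace ι] [BorelSpace ι]
  {𝓕 : Filtration ι m} {P : Measure Ω} [IsProbabilityMeasure P]
  {W : Set ℝ → IncreasingProcess Ω ι}

/-- An additive family of increasing processes indexed by the Borel sets of the real line, continuous
at the empty set, has a version which is an increasing family of measures. -/
lemma IsAdditiveFamily.exists_measure_real (h : IsAdditiveFamily 𝓕 P {C | MeasurableSet C} W)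
    (h𝓕 : UsualConditions 𝓕 P)
    (hcont : ∀ B : ℕ → Set ℝ, (∀ n, MeasurableSet (B n)) → Antitone B → ⋂ n, B n = ∅ →
      Tendsto (fun n => ∫ ω, (W (B n)).toFun ⊤ ω ∂P) atTop (𝓝 0)) :
    ∃ κ : ι → Ω → Measure ℝ, (∀ t ω, IsFiniteMeasure (κ t ω)) ∧
      (∀ C, MeasurableSet C → Measurable[𝓕.predictable] fun p : ι × Ω => κ p.1 p.2 C) ∧
      (∀ ω s t, s ≤ t → κ s ω ≤ κ t ω) ∧
      ∀ C, MeasurableSet C → ∀ᵐ ω ∂P, ∀ t, κ t ω C = ENNReal.ofReal ((W C).toFun t ω) := by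
  have huniv : MeasurableSet (univ : Set ℝ) := MeasurableSet.univ
  have hI : ∀ x : ℝ, MeasurableSet (Iic x) := fun x => measurableSet_Iic
  have hzero : ∀ B : ℕ → Set ℝ, (∀ n, MeasurableSet (B n)) → Antitone B → ⋂ n, B n = ∅ →
      ∀ᵐ ω ∂P, Tendsto (fun n => (W (B n)).toFun ⊤ ω) atTop (𝓝 0) := fun B hB hanti hemp =>
    h.ae_tendsto_zero hB hanti (hcont B hB hanti hemp)
  -- Countably many identities on rational half-lines, each valid for all times, suffice to build
  -- the distribution functions. Paths outside `G` receive the zero measure.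
  set G : Set Ω := {ω | (∀ q r : ℚ, q ≤ r → ∀ t, (W (Ioc (q : ℝ) r)).toFun t ω =
      (W (Iic (r : ℝ))).toFun t ω - (W (Iic (q : ℝ))).toFun t ω) ∧
    Tendsto (fun n : ℕ => (W (Iic (((-(n : ℚ) : ℚ)) : ℝ))).toFun ⊤ ω) atTop (𝓝 0) ∧
    Tendsto (fun n : ℕ => (W (Ioi (((n : ℚ)) : ℝ))).toFun ⊤ ω) atTop (𝓝 0) ∧
    ∀ n : ℕ, ∀ t, (W (Ioi (((n : ℚ)) : ℝ))).toFun t ω =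
      (W univ).toFun t ω - (W (Iic (((n : ℚ)) : ℝ))).toFun t ω} with hG
  have hGae : ∀ᵐ ω ∂P, ω ∈ G := by
    have h1 : ∀ q r : ℚ, ∀ᵐ ω ∂P, q ≤ r → ∀ t, (W (Ioc (q : ℝ) r)).toFun t ω =
        (W (Iic (r : ℝ))).toFun t ω - (W (Iic (q : ℝ))).toFun t ω := by
      intro q r
      by_cases hqr : q ≤ r
      · have h2 := h.diff (A := Iic (q : ℝ)) (B := Iic (r : ℝ)) (hI q) (hI r)
          (Iic_subset_Iic.2 (Rat.cast_le.2 hqr))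
        have h3 : Iic (r : ℝ) \ Iic (q : ℝ) = Ioc (q : ℝ) r := by
          ext x
          simp
        rw [h3] at h2
        filter_upwards [h2] with ω hω _ using hω
      · exact Eventually.of_forall fun ω h => absurd h hqr
    have h2 := hzero (fun n : ℕ => Iic (((-(n : ℚ) : ℚ)) : ℝ)) (fun n => measurableSet_Iic)
      (fun n k hnk => Iic_subset_Iic.2 (by push_cast; exact neg_le_neg (Nat.cast_le.2 hnk))) (by
        rw [eq_empty_iff_forall_notMem]
        intro x hx
        obtain ⟨n, hn⟩ := exists_nat_gt (-x)
        have := mem_iInter.1 hx n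
        simp only [mem_Iic] at this
        push_cast at this
        linarith)
    have h3 := hzero (fun n : ℕ => Ioi (((n : ℚ)) : ℝ)) (fun n => measurableSet_Ioi)
      (fun n k hnk => Ioi_subset_Ioi (by exact_mod_cast hnk)) (by
        rw [eq_empty_iff_forall_notMem]
        intro x hx
        obtain ⟨n, hn⟩ := exists_nat_gt x
        have := mem_iInter.1 hx n
        simp only [mem_Ioi] at this
        push_cast at this
        linarith)
    have h4 : ∀ n : ℕ, ∀ᵐ ω ∂P, ∀ t, (W (Ioi (((n : ℚ)) : ℝ))).toFun t ω =
        (W univ).toFun t ω - (W (Iic (((n : ℚ)) : ℝ))).toFun t ω := by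
      intro n
      have h5 := h.diff (A := Iic ((n : ℚ) : ℝ)) (B := univ) (hI n) huniv
        (subset_univ _)
      rwa [← compl_eq_univ_sdiff, compl_Iic] at h5
    filter_upwards [ae_all_iff.2 fun q => ae_all_iff.2 (h1 q), h2, h3, ae_all_iff.2 h4]
      with ω a b c d
    exact ⟨a, b, c, d⟩
  have hGm : ∀ t, MeasurableSet[𝓕 t] G := fun t => by
    have := (h𝓕.measurableSet_of_null (N := Gᶜ) hGae t).compl
    rwa [compl_compl] at this
  set f : ι → Ω → ℚ → ℝ := fun t ω q => G.indicator ((W (Iic (q : ℝ))).toFun t) ω with hf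
  have hf0 : ∀ t ω q, 0 ≤ f t ω q := fun t ω q =>
    indicator_nonneg (fun ω _ => (W _).nonneg t ω) ω
  -- On `G` the increment over `(q, r]` is the process of `Ioc q r`, which increases in time; off
  -- `G` all increments vanish. This gives `κ s ≤ κ t` for every path, and with `s = ⊥` the
  -- monotonicity in `q`.
  have hinc : ∀ s t ω q r, s ≤ t → q ≤ r → f s ω r - f s ω q ≤ f t ω r - f t ω q := by
    intro s t ω q r hst hqr
    by_cases hω : ω ∈ G
    · simp only [hf, indicator_of_mem hω]
      rw [← hω.1 q r hqr s, ← hω.1 q r hqr t]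
      exact (W _).mono ω hst
    · simp [hf, indicator_of_notMem hω]
  have hfm : ∀ t ω, Monotone (f t ω) := by
    intro t ω q r hqr
    have h1 := hinc ⊥ t ω q r bot_le hqr
    have h2 : ∀ q, f ⊥ ω q = 0 := fun q => by simp [hf, indicator, IncreasingProcess.bot]
    rw [h2, h2, sub_zero] at h1
    linarith
  have hbot : ∀ t ω, Tendsto (fun n : ℕ => f t ω (-(n : ℚ))) atTop (𝓝 0) := by
    intro t ω
    by_cases hω : ω ∈ G
    · refine squeeze_zero (fun n => hf0 t ω _) (fun n => ?_) hω.2.1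
      simp only [hf, indicator_of_mem hω]
      exact (W _).mono ω le_top
    · simp only [hf, indicator_of_notMem hω]
      exact tendsto_const_nhds
  have htop : ∀ t ω, Tendsto (fun n : ℕ => f t ω (n : ℚ)) atTop
      (𝓝 (G.indicator ((W univ).toFun t) ω)) := by
    intro t ω
    by_cases hω : ω ∈ G
    · simp only [hf, indicator_of_mem hω]
      have h1 : Tendsto (fun n : ℕ => (W (Ioi (((n : ℚ)) : ℝ))).toFun t ω) atTop (𝓝 0) :=
        squeeze_zero (fun n => (W _).nonneg t ω) (fun n => (W _).mono ω le_top) hω.2.2.1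
      have h2 := (tendsto_const_nhds (x := (W univ).toFun t ω)).sub h1
      rw [sub_zero] at h2
      refine h2.congr fun n => ?_
      rw [hω.2.2.2 n t]
      ring
    · simp only [hf, indicator_of_notMem hω]
      exact tendsto_const_nhds
  set κ : ι → Ω → Measure ℝ := fun t ω => (ratStieltjes (f t ω) (hf0 t ω)).measure with hκ
  have hκIic : ∀ t ω x, κ t ω (Iic x) = ENNReal.ofReal (ratRightLim (f t ω) x) := fun t ω x =>
    measure_ratStieltjes_Iic (hf0 t ω) (hbot t ω) x
  have hκuniv : ∀ t ω, κ t ω univ = ENNReal.ofReal (G.indicator ((W univ).toFun t) ω) := fun t ω =>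
    measure_ratStieltjes_univ (hfm t ω) (hf0 t ω) (hbot t ω) (htop t ω)
  have hκfin : ∀ t ω, IsFiniteMeasure (κ t ω) := fun t ω =>
    ⟨by rw [hκuniv]; exact ENNReal.ofReal_lt_top⟩
  have hpred : ∀ q : ℚ, Measurable[𝓕.predictable] fun p : ι × Ω => f p.1 p.2 q := fun q =>
    measurable_predictable_indicator (h.predictable _ (hI q)) (hGm ⊥)
  refine ⟨κ, hκfin, fun C hC => ?_, fun ω s t hst => ?_, fun C hC => ?_⟩
  · refine measurable_measure_apply_aux (mα := 𝓕.predictable) (μ := fun p : ι × Ω => κ p.1 p.2)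
      (fun p => hκfin _ _) (fun q => ?_) ?_ hC
    · obtain ⟨r, hr, hrl⟩ := exists_seq_rat_gt_tendsto (q : ℝ)
      simp_rw [hκIic]
      exact measurable_ofReal_limit_aux (mα := 𝓕.predictable) (f := fun n (p : ι × Ω) =>
        f p.1 p.2 (r n)) (fun n => hpred (r n)) fun p =>
          tendsto_ratRightLim (hfm p.1 p.2) (hf0 p.1 p.2) hr hrl
    · simp_rw [hκuniv]
      exact measurable_ofReal_limit_aux (mα := 𝓕.predictable) (f := fun n (p : ι × Ω) =>
        f p.1 p.2 (n : ℕ)) (fun n => hpred n) fun p => htop p.1 p.2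
  · exact measure_ratStieltjes_mono (hfm s ω) (hfm t ω) (hf0 s ω) (hf0 t ω)
      fun q r hqr => hinc s t ω q r hst hqr
  · refine MeasurableSpace.induction_on_inter
      (C := fun C _ => ∀ᵐ ω ∂P, ∀ t, κ t ω C = ENNReal.ofReal ((W C).toFun t ω))
      (by rw [← Real.borel_eq_generateFrom_Iic_rat]; exact BorelSpace.measurable_eq)
      Real.isPiSystem_Iic_rat ?_ ?_ ?_ ?_ C hC
    · filter_upwards [h.empty] with ω hω t
      rw [hω t, measure_empty, ENNReal.ofReal_zero]
    · intro C hC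
      simp only [mem_iUnion, mem_singleton_iff] at hC
      obtain ⟨q, rfl⟩ := hC
      -- Right limits need not return the prescribed value at `q`. The gap is the limit of the
      -- processes of `(q, q + 1 / (n + 1)]`, which vanishes almost surely by continuity at the
      -- empty set.
      have h1 := hzero (fun n : ℕ => Ioc (q : ℝ) ((q + 1 / ((n : ℚ) + 1) : ℚ) : ℝ))
        (fun n => measurableSet_Ioc)
        (fun n k hnk => Ioc_subset_Ioc_right (Rat.cast_le.2
          (add_le_add_right (Nat.one_div_le_one_div hnk) q))) (by
          rw [eq_empty_iff_forall_notMem]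
          intro x hx
          have hx0 := (mem_iInter.1 hx 0).1
          obtain ⟨n, hn⟩ := exists_nat_one_div_lt (sub_pos.2 hx0)
          have := (mem_iInter.1 hx n).2
          push_cast at this
          linarith)
      filter_upwards [hGae, h1] with ω hω h2 t
      rw [hκIic]
      congr 1
      have hpos : ∀ n : ℕ, (0 : ℚ) < 1 / ((n : ℚ) + 1) := fun n => by positivity
      have h3 := tendsto_ratRightLim (hfm t ω) (hf0 t ω) (x := (q : ℝ))
        (q := fun n : ℕ => q + 1 / ((n : ℚ) + 1))
        (fun n => Rat.cast_lt.2 (lt_add_of_pos_right _ (hpos n))) (by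
          push_cast
          simpa using (tendsto_one_div_add_atTop_nhds_zero_nat (𝕜 := ℝ)).const_add (q : ℝ))
      refine tendsto_nhds_unique h3 ?_
      simp only [hf, indicator_of_mem hω]
      have h4 : Tendsto (fun n : ℕ => (W (Ioc (q : ℝ)
          ((q + 1 / ((n : ℚ) + 1) : ℚ) : ℝ))).toFun t ω) atTop (𝓝 0) :=
        squeeze_zero (fun n => (W _).nonneg t ω) (fun n => (W _).mono ω le_top) h2
      have h5 := (tendsto_const_nhds (x := (W (Iic (q : ℝ))).toFun t ω)).add h4
      rw [add_zero] at h5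
      refine h5.congr fun n => ?_
      rw [hω.1 q _ (le_add_of_nonneg_right (hpos n).le) t]
      ring
    · intro C hC hCae
      have h1 := h.diff (A := C) (B := univ) hC huniv (subset_univ _)
      rw [← compl_eq_univ_sdiff] at h1
      filter_upwards [hCae, h1, hGae] with ω a b c t
      rw [measure_compl hC (measure_ne_top _ _), a t, b t, hκuniv, indicator_of_mem c,
        ENNReal.ofReal_sub _ ((W C).nonneg t ω)]
    · intro C hdisj hC hCae
      -- The tails of the union decrease to the empty set, so finite additivity and continuity there
      -- give the countable sum.
      set B : ℕ → Set ℝ := fun n => ⋃ i ∈ Ici n, C i with hB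
      have hBm : ∀ n, MeasurableSet (B n) := fun n =>
        MeasurableSet.biUnion (to_countable _) fun i _ => hC i
      have hBanti : Antitone B := fun n k hnk =>
        biUnion_subset_biUnion_left (Ici_subset_Ici.2 hnk)
      have hBemp : ⋂ n, B n = ∅ := by
        rw [eq_empty_iff_forall_notMem]
        intro x hx
        obtain ⟨i, -, hxi⟩ := mem_iUnion₂.1 (mem_iInter.1 hx 0)
        obtain ⟨j, hj, hxj⟩ := mem_iUnion₂.1 (mem_iInter.1 hx (i + 1))
        have hij : i ≠ j := (Nat.lt_of_succ_le hj).ne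
        exact disjoint_left.1 (hdisj hij) hxi hxj
      have hBsucc : ∀ n, B n = C n ∪ B (n + 1) := by
        intro n
        ext x
        simp only [hB, mem_iUnion, mem_Ici, exists_prop, mem_union]
        constructor
        · rintro ⟨i, hi, hx⟩
          rcases eq_or_lt_of_le hi with rfl | hlt
          · exact Or.inl hx
          · exact Or.inr ⟨i, hlt, hx⟩
        · rintro (hx | ⟨i, hi, hx⟩)
          · exact ⟨n, le_rfl, hx⟩
          · exact ⟨i, (Nat.le_succ n).trans hi, hx⟩
      have hdis : ∀ n, Disjoint (C n) (B (n + 1)) := by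
        intro n
        refine disjoint_iUnion₂_right.2 fun i hi => hdisj ?_
        exact (Nat.lt_of_succ_le hi).ne
      have hadd : ∀ n, ∀ᵐ ω ∂P, ∀ t, (W (B n)).toFun t ω =
          (W (C n)).toFun t ω + (W (B (n + 1))).toFun t ω := by
        intro n
        have := h.add (C n) (hC n) (B (n + 1)) (hBm _) (hdis n)
        rwa [← hBsucc] at this
      have hB0 : B 0 = ⋃ i, C i := by simp [hB]
      filter_upwards [ae_all_iff.2 hCae, ae_all_iff.2 hadd, hzero B hBm hBanti hBemp]
        with ω a b c t
      have hsum : ∀ n, ∑ i ∈ Finset.range n, (W (C i)).toFun t ω =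
          (W (⋃ i, C i)).toFun t ω - (W (B n)).toFun t ω := by
        intro n
        induction n with
        | zero => simp [hB0]
        | succ n ih =>
          rw [Finset.sum_range_succ, ih, b n t]
          ring
      rw [measure_iUnion (fun i j hij => hdisj hij) hC]
      simp_rw [a _ t]
      refine tendsto_nhds_unique (ENNReal.tendsto_nat_tsum _) ?_
      have h1 : Tendsto (fun n => (W (B n)).toFun t ω) atTop (𝓝 0) :=
        squeeze_zero (fun n => (W _).nonneg t ω) (fun n => (W _).mono ω le_top) c
      have h2 := ENNReal.tendsto_ofReal ((tendsto_const_nhds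
        (x := (W (⋃ i, C i)).toFun t ω)).sub h1)
      rw [sub_zero] at h2
      refine h2.congr fun n => ?_
      rw [← hsum, ENNReal.ofReal_sum_of_nonneg fun i _ => (W _).nonneg t ω]

end RealKernel

lemma measurable_tsum_aux {α : Type*} {mα : MeasurableSpace α} {f : ℕ → α → ℝ≥0∞}
    (hf : ∀ n, Measurable (f n)) : StronglyMeasurable fun a => ∑' n, f n a :=
  (Measurable.tsum hf).stronglyMeasurable

lemma stronglyMeasurable_of_measurable_aux {α : Type*} {mα : MeasurableSpace α} {f : α → ℝ}
    (hf : Measurable f) : StronglyMeasurable f := hf.stronglyMeasurable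

/-! ### The random σ-finite measures and the theorem -/

section RandomMeasure

variable {Ω ι U H : Type*} {m : MeasurableSpace Ω} [LinearOrder ι] [OrderBot ι] [OrderTop ι]
  [TopologicalSpace ι] [OrderTopology ι] [MeasurableSpace ι] [BorelSpace ι]
  {𝓕 : Filtration ι m} {P : Measure Ω} [IsProbabilityMeasure P] [MeasurableSpace U]
  [NormedAddCommGroup H] [InnerProductSpace ℝ H] [CompleteSpace H]
  {𝒜 : Set (Set U)} {V : Set U → IncreasingProcess Ω ι}

/-- The restriction of an additive family to a set all of whose measurable subsets belong to the
ring has a version which is an increasing family of measures. -/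
lemma IsAdditiveFamily.exists_measure_of_subset (h : IsAdditiveFamily 𝓕 P 𝒜 V)
    (h𝓕 : UsualConditions 𝓕 P) {e : U → ℝ} (he : MeasurableEmbedding e) {S : Set U}
    (hS : MeasurableSet S) (hS𝒜 : ∀ B, MeasurableSet B → B ⊆ S → B ∈ 𝒜)
    (hcont : ∀ B : ℕ → Set U, (∀ n, MeasurableSet (B n)) → (∀ n, B n ⊆ S) → Antitone B →
      ⋂ n, B n = ∅ → Tendsto (fun n => ∫ ω, (V (B n)).toFun ⊤ ω ∂P) atTop (𝓝 0)) :
    ∃ κ : ι → Ω → Measure U, (∀ t ω, IsFiniteMeasure (κ t ω)) ∧ (∀ t ω, κ t ω Sᶜ = 0) ∧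
      (∀ B, MeasurableSet B → Measurable[𝓕.predictable] fun p : ι × Ω => κ p.1 p.2 B) ∧
      (∀ ω s t, s ≤ t → κ s ω ≤ κ t ω) ∧
      ∀ B, MeasurableSet B → ∀ᵐ ω ∂P, ∀ t, κ t ω B = ENNReal.ofReal ((V (B ∩ S)).toFun t ω) := by
  set W : Set ℝ → IncreasingProcess Ω ι := fun C => V (e ⁻¹' C ∩ S) with hW
  have hmem : ∀ C, MeasurableSet C → e ⁻¹' C ∩ S ∈ 𝒜 := fun C hC =>
    hS𝒜 _ ((he.measurable hC).inter hS) inter_subset_right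
  have hring : IsSetRing {C : Set ℝ | MeasurableSet C} := by
    refine ⟨?_, ?_, ?_⟩
    · exact mem_ofPred.2 MeasurableSet.empty
    · intro s t hs ht
      exact mem_ofPred.2 ((mem_ofPred.1 hs).union (mem_ofPred.1 ht))
    · intro s t hs ht
      exact mem_ofPred.2 ((mem_ofPred.1 hs).diff (mem_ofPred.1 ht))
  have hWfam : IsAdditiveFamily 𝓕 P {C | MeasurableSet C} W := by
    refine ⟨hring, fun C hC => h.predictable _ (hmem C hC),
      fun C hC => h.integrable _ (hmem C hC), fun C hC C' hC' hdis => ?_⟩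
    have h1 := h.add _ (hmem C hC) _ (hmem C' hC')
      ((hdis.preimage e).mono inter_subset_left inter_subset_left)
    rwa [← union_inter_distrib_right, ← preimage_union] at h1
  obtain ⟨κ, hfin, hpred, hmono, hae⟩ := hWfam.exists_measure_real h𝓕 fun B hB hanti hemp => by
    refine hcont (fun n => e ⁻¹' B n ∩ S) (fun n => (he.measurable (hB n)).inter hS)
      (fun n => inter_subset_right)
      (fun n k hnk => inter_subset_inter_left _ (preimage_mono (hanti hnk))) ?_
    rw [← iInter_inter, ← preimage_iInter, hemp, preimage_empty, empty_inter]
  have happly : ∀ t ω B, MeasurableSet B →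
      ((κ t ω).comap e).restrict S B = κ t ω (e '' (B ∩ S)) := fun t ω B hB => by
    rw [Measure.restrict_apply hB, he.comap_apply]
  refine ⟨fun t ω => ((κ t ω).comap e).restrict S, fun t ω => ⟨?_⟩, fun t ω => ?_, fun B hB => ?_,
    fun ω s t hst => ?_, fun B hB => ?_⟩
  · rw [happly t ω univ MeasurableSet.univ]
    have := hfin t ω
    exact measure_lt_top _ _
  · rw [happly t ω _ hS.compl, compl_inter_self, image_empty, measure_empty]
  · simp_rw [happly _ _ B hB]
    exact hpred _ (he.measurableSet_image.2 (hB.inter hS))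
  · refine Measure.le_intro fun B hB _ => ?_
    rw [happly s ω B hB, happly t ω B hB]
    exact hmono ω s t hst _
  · filter_upwards [hae _ (he.measurableSet_image.2 (hB.inter hS))] with ω hω t
    rw [happly t ω B hB, hω t]
    simp only [hW]
    rw [he.injective.preimage_image, inter_assoc, inter_self]

/-- An additive family of increasing processes which is countably additive on each set of an
exhausting sequence has a version which is an increasing family of `σ`-finite measures. -/
lemma IsAdditiveFamily.exists_measure (h : IsAdditiveFamily 𝓕 P 𝒜 V)
    (h𝓕 : UsualConditions 𝓕 P) {e : U → ℝ} (he : MeasurableEmbedding e)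
    (h𝒜 : ∀ A ∈ 𝒜, MeasurableSet A) {Un : ℕ → Set U} (hUn : ∀ n, MeasurableSet (Un n))
    (hUmono : Monotone Un) (hUuniv : ⋃ n, Un n = univ)
    (hU𝒜 : ∀ n B, MeasurableSet B → B ⊆ Un n → B ∈ 𝒜)
    (hcont : ∀ n, ∀ B : ℕ → Set U, (∀ n, MeasurableSet (B n)) → (∀ k, B k ⊆ Un n) → Antitone B →
      ⋂ n, B n = ∅ → Tendsto (fun n => ∫ ω, (V (B n)).toFun ⊤ ω ∂P) atTop (𝓝 0))
    (happ : ∀ A ∈ 𝒜, Tendsto (fun n => ∫ ω, (V (A \ Un n)).toFun ⊤ ω ∂P) atTop (𝓝 0)) :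
    ∃ ν : ι → Ω → Measure U, (∀ t ω, SigmaFinite (ν t ω)) ∧ IsPredictableFamily 𝓕 ν ∧
      (∀ ω s t, s ≤ t → ν s ω ≤ ν t ω) ∧
      ∀ A ∈ 𝒜, ∀ᵐ ω ∂P, ∀ t, ν t ω A = ENNReal.ofReal ((V A).toFun t ω) := by
  -- Summing over disjoint pieces keeps the measure increasing in time and finite on each piece.
  set D : ℕ → Set U := disjointed Un with hD
  have hDm : ∀ n, MeasurableSet (D n) := fun n => MeasurableSet.disjointed hUn n
  have hDU : ∀ n, D n ⊆ Un n := fun n => disjointed_le Un n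
  choose κ hfin hsupp hpred hmono hae using fun n =>
    h.exists_measure_of_subset h𝓕 he (hDm n)
      (fun B hB hBD => hU𝒜 n B hB (hBD.trans (hDU n)))
      fun B hB hBD => hcont n B hB fun k => (hBD k).trans (hDU n)
  have happly : ∀ t ω B, MeasurableSet B → Measure.sum (fun n => κ n t ω) B = ∑' n, κ n t ω B :=
    fun t ω B hB => Measure.sum_apply _ hB
  refine ⟨fun t ω => Measure.sum fun n => κ n t ω, fun t ω => ?_, fun B hB => ?_,
    fun ω s t hst => ?_, fun A hA => ?_⟩
  · refine ⟨⟨⟨D, fun n => trivial, fun n => ?_, ?_⟩⟩⟩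
    · rw [happly t ω _ (hDm n), tsum_eq_single n]
      · have := hfin n t ω
        exact measure_lt_top _ _
      · intro k hk
        refine measure_mono_null ?_ (hsupp k t ω)
        exact subset_compl_iff_disjoint_right.2 (disjoint_disjointed Un hk.symm)
    · rw [hD, iUnion_disjointed, hUuniv]
  · simp_rw [happly _ _ B hB]
    exact measurable_tsum_aux (mα := 𝓕.predictable) (f := fun n (p : ι × Ω) => κ n p.1 p.2 B)
      fun n => hpred n B hB
  · refine Measure.le_intro fun B hB _ => ?_
    rw [happly s ω B hB, happly t ω B hB]
    exact ENNReal.tsum_le_tsum fun n => hmono n ω s t hst B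
  · have hAU : ∀ n, A ∩ Un n ∈ 𝒜 := fun n =>
      hU𝒜 n _ ((h𝒜 A hA).inter (hUn n)) inter_subset_right
    have hAD : ∀ n, A ∩ D n ∈ 𝒜 := fun n =>
      hU𝒜 n _ ((h𝒜 A hA).inter (hDm n)) (inter_subset_right.trans (hDU n))
    have hAdiff : ∀ n, A \ Un n ∈ 𝒜 := fun n => by
      rw [← sdiff_self_inter]
      exact h.ring.sdiff_mem hA (hAU n)
    have h1 : ∀ n, ∀ᵐ ω ∂P, ∀ t, (V A).toFun t ω =
        (V (A ∩ Un n)).toFun t ω + (V (A \ Un n)).toFun t ω := fun n => by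
      have := h.add _ (hAU n) _ (hAdiff n) (disjoint_sdiff_right.mono_left inter_subset_right)
      rwa [inter_union_sdiff] at this
    have h2 : ∀ n, ∀ᵐ ω ∂P, ∀ t, (V (A ∩ Un (n + 1))).toFun t ω =
        (V (A ∩ Un n)).toFun t ω + (V (A ∩ D (n + 1))).toFun t ω := fun n => by
      have hDn : D (n + 1) = Un (n + 1) \ Un n := hUmono.disjointed_add_one n
      have := h.add _ (hAU n) _ (hAD (n + 1)) (by
        rw [hDn]
        exact disjoint_sdiff_right.mono inter_subset_right inter_subset_right)
      rwa [← inter_union_distrib_left, show Un n ∪ D (n + 1) = Un (n + 1) by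
        rw [hDn, union_sdiff_cancel (hUmono (Nat.le_add_right n 1))]] at this
    have h3 := h.ae_tendsto_zero hAdiff
      (fun n k hnk => sdiff_subset_sdiff_right (hUmono hnk)) (happ A hA)
    filter_upwards [ae_all_iff.2 h1, ae_all_iff.2 h2, h3, ae_all_iff.2 fun n => hae n A (h𝒜 A hA)]
      with ω a b c d t
    have hsum : ∀ n, ∑ i ∈ Finset.range (n + 1), (V (A ∩ D i)).toFun t ω =
        (V A).toFun t ω - (V (A \ Un n)).toFun t ω := by
      intro n
      rw [a n t, add_sub_cancel_right]
      induction n with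
      | zero => simp [hD, disjointed_zero]
      | succ n ih => rw [Finset.sum_range_succ, ih, b n t]
    rw [happly t ω A (h𝒜 A hA)]
    simp_rw [d _ t]
    refine tendsto_nhds_unique ((ENNReal.tendsto_nat_tsum _).comp (tendsto_add_atTop_nat 1)) ?_
    have h4 : Tendsto (fun n => (V (A \ Un n)).toFun t ω) atTop (𝓝 0) :=
      squeeze_zero (fun n => (V _).nonneg t ω) (fun n => (V _).mono ω le_top) c
    have h5 := ENNReal.tendsto_ofReal ((tendsto_const_nhds (x := (V A).toFun t ω)).sub h4)
    rw [sub_zero] at h5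
    refine h5.congr fun n => ?_
    rw [← hsum, ENNReal.ofReal_sum_of_nonneg fun i _ => (V _).nonneg t ω]
    rfl

variable [SecondCountableTopology ι] [DenselyOrdered ι] [CompactIccSpace ι]

lemma IsPredictableCompensator.isPredictableQuadraticVariation {Y : ι → Ω → H}
    {A : IncreasingProcess Ω ι} (h : IsPredictableCompensator 𝓕 P (fun t ω => ‖Y t ω‖ ^ 2) A) :
    IsPredictableQuadraticVariation 𝓕 P Y A.toFun where
  predictable := stronglyMeasurable_of_measurable_aux (mα := 𝓕.predictable) h.predictable
  initial := Eventually.of_forall A.bot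
  rightCont := Eventually.of_forall A.rightCont
  finiteVariation := Eventually.of_forall A.locallyBoundedVariationOn
  martingale := by
    simp_rw [real_inner_self_eq_norm_sq]
    exact h.martingale

/-- The conclusion of the theorem on the intensity measure of an orthogonal martingale-valued
measure, for a general index set. -/
def HasIntensity (𝓕 : Filtration ι m) (P : Measure Ω) (𝒜 : Set (Set U)) (M : ι → Set U → Ω → H) :
    Prop :=
  ∃ ν : ι → Ω → Measure U,
    IsRandomSigmaFiniteFamily ν ∧
    IsPredictableFamily 𝓕 ν ∧
    (∀ A ∈ 𝒜,
      (∀ ω, Monotone fun t => ν t ω A) ∧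
      ∀ᵐ ω ∂P, ∀ t, ContinuousWithinAt (fun s => ν s ω A) (Ici t) t) ∧
    ∀ A ∈ 𝒜,
      (∃ V, IsPredictableQuadraticVariation 𝓕 P (fun t => M t A) V) ∧
      ∀ V, IsPredictableQuadraticVariation 𝓕 P (fun t => M t A) V →
        ∀ t, ∀ᵐ ω ∂P, ((ν t ω A : ℝ≥0∞) : EReal) = ((V t ω : ℝ) : EReal)

/-- Only the L²-measure at the final time is needed: the mean of `V(A)` at `⊤` is at most the second
moment of `M ⊤ A`, so continuity at the empty set and exhaustion pass to `V` there, and earlier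
times are dominated by monotonicity. Any other version of the quadratic variation agrees by
uniqueness. -/
theorem IsOrthogonalMartingaleMeasure.hasIntensity [TopologicalSpace.SeparableSpace H]
    (g : RefiningGrid ι) (h𝓕 : UsualConditions 𝓕 P) {e : U → ℝ} (he : MeasurableEmbedding e)
    (h𝒜 : IsSetRing 𝒜) (h𝒜_meas : ∀ A ∈ 𝒜, MeasurableSet A) {M : ι → Set U → Ω → H}
    (hM : IsOrthogonalMartingaleMeasure 𝓕 P 𝒜 M) : HasIntensity 𝓕 P 𝒜 M := by
  obtain ⟨V, hVfam, hV⟩ := hM.exists_isAdditiveFamily g h𝓕 h𝒜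
  have hl2 := hM.l2Measure ⊤ g.bot_lt_top
  obtain ⟨Un, hUn, hUmono, hUuniv, hU𝒜, -, hUcont, hUapp⟩ := hl2.sigmaFinite
  have hle : ∀ A ∈ 𝒜, ∫ ω, (V A).toFun ⊤ ω ∂P ≤ ∫ ω, ‖M ⊤ A ω‖ ^ 2 ∂P := fun A hA =>
    (hV A hA).integral_le (fun t => ((hM.martingale A hA).memLp t).integrable_sq_norm)
      (fun ω => by positivity) ⊤
  have hnn : ∀ A, 0 ≤ ∫ ω, (V A).toFun ⊤ ω ∂P := fun A => integral_nonneg fun ω => (V A).nonneg ⊤ ω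
  obtain ⟨ν, hσ, hpred, hmono, hae⟩ := hVfam.exists_measure h𝓕 he h𝒜_meas hUn hUmono hUuniv hU𝒜
    (fun n B hB hBU hanti hemp => squeeze_zero (fun k => hnn _)
      (fun k => hle _ (hU𝒜 n _ (hB k) (hBU k))) (hUcont n B hB hBU hanti hemp))
    (fun A hA => by
      refine squeeze_zero (fun k => hnn _) (fun k => ?_) (hUapp A hA)
      have hAU : A ∩ Un k ∈ 𝒜 := hU𝒜 k _ ((h𝒜_meas A hA).inter (hUn k)) inter_subset_right
      have hAdiff : A \ Un k ∈ 𝒜 := by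
        rw [← sdiff_self_inter]
        exact h𝒜.sdiff_mem hA hAU
      refine (hle _ hAdiff).trans_eq (integral_congr_ae ?_)
      have h1 := hl2.additive _ hAU _ hAdiff
        (disjoint_sdiff_right.mono_left inter_subset_right)
      rw [inter_union_sdiff] at h1
      filter_upwards [h1] with ω hω
      rw [hω, add_sub_cancel_left])
  refine ⟨ν, ⟨fun t B hB => ?_, hσ⟩, hpred, fun A hA => ⟨fun ω s t hst => hmono ω s t hst A, ?_⟩,
    fun A hA => ⟨⟨_, (hV A hA).isPredictableQuadraticVariation⟩, fun V' hV' t => ?_⟩⟩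
  · exact (measurable_of_predictable (f := fun t ω => ν t ω B) (hpred B hB).measurable t).mono
      (𝓕.le t) le_rfl
  · filter_upwards [hae A hA] with ω hω t
    simp_rw [hω]
    exact ENNReal.continuous_ofReal.continuousAt.comp_continuousWithinAt ((V A).rightCont ω t)
  · have h1 := IsPredictableCovariation.ae_eq g h𝓕
      (hV A hA).isPredictableQuadraticVariation hV' (fun _ _ => rfl) t
    filter_upwards [h1, hae A hA] with ω h2 h3
    rw [h3 t, EReal.coe_ennreal_ofReal, max_eq_left ((V A).nonneg t ω), h2]

/-- For a single time, the intensity measure vanishes. -/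
theorem IsOrthogonalMartingaleMeasure.hasIntensity_of_subsingleton [Subsingleton ι]
    {M : ι → Set U → Ω → H} (hM : IsOrthogonalMartingaleMeasure 𝓕 P 𝒜 M) :
    HasIntensity 𝓕 P 𝒜 M := by
  refine ⟨fun _ _ => 0, ⟨fun t B _ => measurable_const, fun t ω => inferInstance⟩,
    fun B _ => stronglyMeasurable_const, fun A _ => ⟨fun ω => monotone_const,
      Eventually.of_forall fun ω t => continuousWithinAt_const⟩,
    fun A hA => ⟨⟨fun _ _ => 0, ?_⟩, fun V hV t => ?_⟩⟩
  · refine ⟨stronglyMeasurable_const, Eventually.of_forall fun _ => rfl,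
      Eventually.of_forall fun ω t => continuousWithinAt_const,
      Eventually.of_forall fun ω =>
        (monotone_const.monotoneOn univ).locallyBoundedVariationOn, ?_⟩
    simp only [sub_zero]
    have hY := hM.martingale A hA
    refine ⟨fun t => (hY.martingale.1 t).inner (hY.martingale.1 t), fun s t _ => ?_⟩
    rw [Subsingleton.elim s t, condExp_of_stronglyMeasurable (𝓕.le t)
      ((hY.martingale.1 t).inner (hY.martingale.1 t))
      ((hY.memLp t).integrable_inner_real (hY.memLp t))]
  · filter_upwards [hV.initial] with ω hω
    rw [Subsingleton.elim t ⊥, hω]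
    simp

end RandomMeasure

/-- The sole use of the Lusin property: it carries the construction to the real line, where
distribution functions are available. -/
lemma IsLusin.exists_measurableEmbedding {U : Type*} [TopologicalSpace U] [MeasurableSpace U]
    [BorelSpace U] (hU : IsLusin U) : ∃ e : U → ℝ, MeasurableEmbedding e := by
  obtain ⟨S, hS, ⟨φ⟩⟩ := hU
  exact ⟨fun u => φ u, (MeasurableEmbedding.subtype_coe hS).comp φ.measurableEmbedding⟩

theorem mainTheorem9
    {Ω U H : Type*} [m : MeasurableSpace Ω] (P : Measure Ω) [IsProbabilityMeasure P]
    [NormedAddCommGroup H] [InnerProductSpace ℝ H] [CompleteSpace H]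
    [TopologicalSpace.SeparableSpace H]
    [TopologicalSpace U] [MeasurableSpace U] [BorelSpace U] (hU : IsLusin U)
    (T : ℝ≥0) (𝓕 : Filtration (Set.Iic T) m) (h𝓕 : UsualConditions 𝓕 P)
    (𝒜 : Set (Set U)) (h𝒜 : IsSetRing 𝒜) (h𝒜_meas : ∀ A ∈ 𝒜, MeasurableSet A)
    (M : Set.Iic T → Set U → Ω → H) (hM : IsOrthogonalMartingaleMeasure 𝓕 P 𝒜 M) :
    ∃ ν : Set.Iic T → Ω → Measure U,
      IsRandomSigmaFiniteFamily ν ∧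
      IsPredictableFamily 𝓕 ν ∧
      (∀ A ∈ 𝒜,
        (∀ ω, Monotone fun t => ν t ω A) ∧
        ∀ᵐ ω ∂P, ∀ t, ContinuousWithinAt (fun s => ν s ω A) (Set.Ici t) t) ∧
      ∀ A ∈ 𝒜,
        (∃ V, IsPredictableQuadraticVariation 𝓕 P (fun t => M t A) V) ∧
        ∀ V, IsPredictableQuadraticVariation 𝓕 P (fun t => M t A) V →
          ∀ t, ∀ᵐ ω ∂P, ((ν t ω A : ℝ≥0∞) : EReal) = ((V t ω : ℝ) : EReal) := by
  have := compactIccSpace_Iic T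
  -- A refining grid needs two distinct end points, so the single-time interval `T = 0` is treated
  -- apart.
  rcases eq_or_lt_of_le (zero_le (a := T)) with hT | hT
  · have : Subsingleton (Set.Iic T) := ⟨fun s t => Subtype.ext <|
      (le_antisymm (s.2.trans hT.ge) zero_le).trans
        (le_antisymm (t.2.trans hT.ge) zero_le).symm⟩
    exact hM.hasIntensity_of_subsingleton
  · obtain ⟨e, he⟩ := hU.exists_measurableEmbedding
    exact hM.hasIntensity (dyadicGrid hT) h𝓕 he h𝒜 h𝒜_meas
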